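/- Let $n\ge u\ge 1$ and let $n$ oscillators be divided into $u$ nonempty groups: let $g:\{1,\dots,n\}\to\{1,\dots,u\}$ be surjective and let $q_h$ be the number of $i$ with $g(i)=h$. Let $\epsilon_i=\pm1$ and let $s_1,\dots,s_u$ be positive integers, so that the oscillators have the frequencies $l_i=\epsilon_i s_{g(i)}$. **Operators.** On $C^\infty(\mathbb R^n;\mathbb C)$ let $\hat p_j=-i\,\partial/\partial x_j$, $\hat z_j=(x_j+i\hat p_j)/\sqrt2$, $\hat z_j^*=(x_j-i\hat p_j)/\sqrt2$; let $\hat w_j=\hat z_j$ if $\epsilon_j=1$, $\hat w_j=\hat z_j^*$ if $\epsilon_j=-1$, and let $\hat w_j^*$ be its Hermitian conjugate. Put $\hat I_j=\frac12(x_j^2+\hat p_j^2)$, $\hat P_{ij}=i(\hat w_i\hat w_j^*-\hat w_j\hat w_i^*)$, $\hat K_h=\sum_{g(i)=h}\epsilon_i\hat I_i$, $\hat W_h=\sum_{g(i)=h}\epsilon_i\hat w_i^2$, and, for $r,m\in\mathbb Z^u$, $$\hat J_r=\sum_{h=1}^u r_h\hat K_h,\qquad \hat R_m=\hat\Omega_1^{m_1}\cdots\hat\Omega_u^{m_u},\qquad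 \operatorname{Im}\hat R_m=\tfrac1{2i}(\hat R_m-\hat R_m^*),$$ where $\hat\Omega_h^{a}=\hat W_h^{a}$ for $a\ge0$ and $\hat\Omega_h^{a}=(\hat W_h^*)^{-a}$ for $a<0$. Let $P_{ij}=i(w_i\bar w_j-w_j\bar w_i)$ be the classical functions of $(x,p)\in\mathbb R^{2n}$ corresponding to $\hat P_{ij}$. **Data.** Let $1\le k'\le u$; let $r^{(1)},\dots,r^{(u)}\in\mathbb Z^u$ be linearly independent with $r^{(1)}=s$; let $m^{(1)},\dots,m^{(u-k')}\in\mathbb Z^u$ be linearly independent with $r^{(i)}\cdot m^{(j)}=0$ for all $i\le k'$ and all $j$. For each $h$ let $z_h=0$ if $q_h=1$ and $1\le z_h\le q_h-1$ if $q_h>1$; put $z=\sum_h z_h$ and $k=k'+z$. **Admissible choices.** An admissible choice consists, for every $h$, of a set $Z_h$ of $z_h$ and a set $L_h$ of $2(q_h-z_h-1)$ real polynomials in the variables $P_{ij}$ ($i<j$, $g(i)=g(j)=h$), each of the form $\sum c_{ij}P_{ij}$ or $\sum c_{ij}P_{ij}^2$, such that $(Z_h,L_h)$ is functionally independent as a set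 of functions on $\mathbb R^{2n}$ (the differentials are linearly independent at all points of an open dense set) and every element of $Z_h$ has vanishing Poisson bracket with every element of $(Z_h,L_h)$. Let $\hat Z_h,\hat L_h$ be the operators obtained by putting $\hat P_{ij}$ for $P_{ij}$ in these polynomials, and let $$\hat{\mathcal J}_1=(\hat J_{r^{(1)}},\dots,\hat J_{r^{(k')}}),\quad \hat{\mathcal J}_2=(\hat J_{r^{(k'+1)}},\dots,\hat J_{r^{(u)}}),\quad \hat{\mathcal R}=(\operatorname{Im}\hat R_{m^{(1)}},\dots,\operatorname{Im}\hat R_{m^{(u-k')}}),$$ $$\hat{\mathcal Z}=(\hat Z_1,\dots,\hat Z_u),\qquad \hat{\mathcal L}=(\hat L_1,\dots,\hat L_u).$$ **Quasi-integrability.** The main part of a linear differential operator $\sum_{|\alpha|\le d}a_\alpha(x)\hat p^\alpha$ of order exactly $d$, with smooth coefficients, is the function $\sum_{|\alpha|=d}a_\alpha(x)p^\alpha$. A set of $2n-k$ linear differential operators on $\mathbb R^n$, $k$ of which are designated as central, is quasi-integrable if each central element commutes with all elements of the set and if the main parts of the $2n-k$ operators are functionally independent. **Proposition.** Admissible choices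 exist. For every admissible choice, $\hat F=(\hat{\mathcal J}_1,\hat{\mathcal Z};\hat{\mathcal J}_2,\hat{\mathcal R},\hat{\mathcal L})$ is a quasi-integrable set of $2n-k$ linear differential operators on $\mathbb R^n$ with the $k=k'+z$ central elements $(\hat{\mathcal J}_1,\hat{\mathcal Z})$. -/

import Mathlib

open scoped ContDiff

noncomputable section

namespace ResonantOscillators

/-! ### Differential operators with smooth coefficients on `ℝⁿ` -/

/-- The complex vector space `C^∞(ℝⁿ; ℂ)`. -/
def Smooth (n : ℕ) : Submodule ℂ ((Fin n → ℝ) → ℂ) where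
  carrier := {f | ContDiff ℝ ∞ f}
  add_mem' := by
    intro f g hf hg
    rw [Set.mem_ofPred_eq] at hf hg ⊢
    exact hf.add hg
  zero_mem' := by
    rw [Set.mem_ofPred_eq]
    exact contDiff_const
  smul_mem' := by
    intro c f hf
    rw [Set.mem_ofPred_eq] at hf ⊢
    exact contDiff_const.smul hf

theorem mem_smooth {n : ℕ} {f : (Fin n → ℝ) → ℂ} : f ∈ Smooth n ↔ ContDiff ℝ ∞ f := Iff.rfl

/-- Linear operators on `C^∞(ℝⁿ; ℂ)`; the product is composition. -/
abbrev Op (n : ℕ) : Type := Module.End ℂ (Smooth n)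

/-- Multiplication by a smooth function. -/
def mulOp {n : ℕ} (a : Smooth n) : Op n where
  toFun f := ⟨fun x => a.1 x * f.1 x, mem_smooth.2 ((mem_smooth.1 a.2).mul (mem_smooth.1 f.2))⟩
  map_add' f g := by
    apply Subtype.ext; funext x
    exact mul_add (a.1 x) (f.1 x) (g.1 x)
  map_smul' c f := by
    apply Subtype.ext; funext x
    exact mul_left_comm (a.1 x) c (f.1 x)

/-- The coordinate function `x_j`. -/
def coord {n : ℕ} (j : Fin n) : Smooth n :=
  ⟨fun x => ((x j : ℝ) : ℂ),
    mem_smooth.2 (Complex.ofRealCLM.contDiff.comp (contDiff_apply ℝ ℝ j))⟩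

/-- The position operator: multiplication by `x_j`. -/
def xOp {n : ℕ} (j : Fin n) : Op n := mulOp (coord j)

/-- The momentum operator `p̂_j = -i ∂/∂x_j`. -/
def pOp {n : ℕ} (j : Fin n) : Op n where
  toFun f := ⟨fun x => -Complex.I * fderiv ℝ f.1 x (Pi.single j 1),
    mem_smooth.2 (contDiff_const.mul
      (((mem_smooth.1 f.2).fderiv_right (m := ∞) (by simp)).clm_apply contDiff_const))⟩
  map_add' f g := by
    apply Subtype.ext; funext x
    have hf : DifferentiableAt ℝ f.1 x := (mem_smooth.1 f.2).differentiable (by simp) x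
    have hg : DifferentiableAt ℝ g.1 x := (mem_smooth.1 g.2).differentiable (by simp) x
    change -Complex.I * fderiv ℝ (f.1 + g.1) x (Pi.single j 1) =
      -Complex.I * fderiv ℝ f.1 x (Pi.single j 1) + -Complex.I * fderiv ℝ g.1 x (Pi.single j 1)
    rw [fderiv_add hf hg, add_apply, mul_add]
  map_smul' c f := by
    apply Subtype.ext; funext x
    have hf : DifferentiableAt ℝ f.1 x := (mem_smooth.1 f.2).differentiable (by simp) x
    change -Complex.I * fderiv ℝ (c • f.1) x (Pi.single j 1) =
      c * (-Complex.I * fderiv ℝ f.1 x (Pi.single j 1))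
    rw [fderiv_const_smul hf c, smul_apply, smul_eq_mul]
    ring

/-- `p̂^α = p̂_1^{α_1} ⋯ p̂_n^{α_n}`. -/
def pPow {n : ℕ} (α : Fin n → ℕ) : Op n := (List.ofFn fun j => pOp j ^ α j).prod

/-- The classical phase space `ℝⁿ × ℝⁿ`, with points `(x, p)`. -/
abbrev Phase (n : ℕ) : Type := (Fin n → ℝ) × (Fin n → ℝ)

/-- `σ` is the main part, with respect to the momenta, of the operator `A`: for some `d`, `A` is a
linear differential operator `∑_{|α| ≤ d} a_α(x) p̂^α` of order exactly `d` with smooth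
coefficients, and `σ(x, p) = ∑_{|α| = d} a_α(x) p^α`. -/
def IsMainPart {n : ℕ} (A : Op n) (σ : Phase n → ℂ) : Prop :=
  ∃ (d : ℕ) (a : (Fin n → ℕ) →₀ Smooth n),
    (∀ α ∈ a.support, ∑ j, α j ≤ d) ∧
    (∃ α ∈ a.support, ∑ j, α j = d) ∧
    A = ∑ α ∈ a.support, mulOp (a α) * pPow α ∧
    σ = fun y => ∑ α ∈ a.support with ∑ j, α j = d,
      (a α).1 y.1 * ∏ j, ((y.2 j : ℝ) : ℂ) ^ α j

/-- Functional independence of a family of functions on phase space: their differentials are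
linearly independent at all points of some open dense set. -/
def FunctionallyIndependent {n : ℕ} {ι : Type} (f : ι → Phase n → ℂ) : Prop :=
  ∃ U : Set (Phase n), IsOpen U ∧ Dense U ∧
    ∀ y ∈ U, LinearIndependent ℂ fun i => fderiv ℝ (f i) y

/-- A family of differential operators is quasi-independent if the main parts of its elements are
functionally independent. -/
def QuasiIndependent {n : ℕ} {ι : Type} (A : ι → Op n) : Prop :=
  ∃ σ : ι → Phase n → ℂ, (∀ i, IsMainPart (A i) (σ i)) ∧ FunctionallyIndependent σ

/-- `(A; B)` is a quasi-integrable set of differential operators on `ℝⁿ` with the `k` central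
elements `A`: it has `2n - k` elements, `k` of them in `A`; the elements of `A` commute with all
elements of `(A; B)`; and `(A; B)` is quasi-independent. -/
def IsQuasiIntegrable {n : ℕ} (k : ℕ) {C N : Type} [Fintype C] [Fintype N]
    (A : C → Op n) (B : N → Op n) : Prop :=
  Fintype.card C = k ∧
  Fintype.card C + Fintype.card N + k = 2 * n ∧
  (∀ a a' : C, A a * A a' = A a' * A a) ∧
  (∀ (a : C) (b : N), A a * B b = B b * A a) ∧
  QuasiIndependent (Sum.elim A B)

/-! ### Classical functions -/

/-- The Poisson bracket, normalized by `{p_i, x_j} = δ_ij`. -/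
def poisson {n : ℕ} (f g : Phase n → ℂ) : Phase n → ℂ := fun y =>
  ∑ j, (fderiv ℝ f y (0, Pi.single j 1) * fderiv ℝ g y (Pi.single j 1, 0) -
    fderiv ℝ f y (Pi.single j 1, 0) * fderiv ℝ g y (0, Pi.single j 1))

/-- `z_j = (x_j + i p_j) / √2`. -/
def zFun {n : ℕ} (j : Fin n) : Phase n → ℂ := fun y =>
  ((y.1 j : ℂ) + Complex.I * (y.2 j : ℂ)) / ((√2 : ℝ) : ℂ)

/-- `w_j = z_j` if `ε_j = 1`, and `w_j` is the complex conjugate of `z_j` if `ε_j = -1`. -/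
def wFun {n : ℕ} (ε : Fin n → ℤˣ) (j : Fin n) : Phase n → ℂ := fun y =>
  if ε j = 1 then zFun j y else (starRingEnd ℂ) (zFun j y)

/-- `P_ij = i (w_i w̄_j - w_j w̄_i)`. -/
def momentum {n : ℕ} (ε : Fin n → ℤˣ) (i j : Fin n) : Phase n → ℂ := fun y =>
  Complex.I * (wFun ε i y * (starRingEnd ℂ) (wFun ε j y) -
    wFun ε j y * (starRingEnd ℂ) (wFun ε i y))

/-! ### Quantum operators -/

/-- `ẑ_j = (x_j + i p̂_j) / √2`. -/
def zOp {n : ℕ} (j : Fin n) : Op n := (((√2 : ℝ) : ℂ)⁻¹) • (xOp j + Complex.I • pOp j)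

/-- `ẑ_j^* = (x_j - i p̂_j) / √2`, the Hermitian conjugate of `ẑ_j`. -/
def zStarOp {n : ℕ} (j : Fin n) : Op n := (((√2 : ℝ) : ℂ)⁻¹) • (xOp j - Complex.I • pOp j)

/-- `ŵ_j`, which is `ẑ_j` if `ε_j = 1` and `ẑ_j^*` if `ε_j = -1`. -/
def wOp {n : ℕ} (ε : Fin n → ℤˣ) (j : Fin n) : Op n := if ε j = 1 then zOp j else zStarOp j

/-- `ŵ_j^*`, the Hermitian conjugate of `ŵ_j`. -/
def wStarOp {n : ℕ} (ε : Fin n → ℤˣ) (j : Fin n) : Op n := if ε j = 1 then zStarOp j else zOp j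

/-- `Î_j = (x_j² + p̂_j²) / 2`. -/
def actionOp {n : ℕ} (j : Fin n) : Op n := (1 / 2 : ℂ) • (xOp j ^ 2 + pOp j ^ 2)

/-- `P̂_ij = i (ŵ_i ŵ_j^* - ŵ_j ŵ_i^*)`. -/
def momentumOp {n : ℕ} (ε : Fin n → ℤˣ) (i j : Fin n) : Op n :=
  Complex.I • (wOp ε i * wStarOp ε j - wOp ε j * wStarOp ε i)

/-- `K̂_h = ∑ ε_i Î_i`, the sum being over the `i` in the group `h`. -/
def kOp {n u : ℕ} (g : Fin n → Fin u) (ε : Fin n → ℤˣ) (h : Fin u) : Op n :=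
  ∑ i with g i = h, ((ε i : ℤ) : ℂ) • actionOp i

/-- `Ĵ_r = ∑_h r_h K̂_h`. -/
def jOp {n u : ℕ} (g : Fin n → Fin u) (ε : Fin n → ℤˣ) (r : Fin u → ℤ) : Op n :=
  ∑ h, (r h : ℂ) • kOp g ε h

/-- `Ŵ_h = ∑ ε_i ŵ_i²`, the sum being over the `i` in the group `h`. -/
def bigWOp {n u : ℕ} (g : Fin n → Fin u) (ε : Fin n → ℤˣ) (h : Fin u) : Op n :=
  ∑ i with g i = h, ((ε i : ℤ) : ℂ) • wOp ε i ^ 2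

/-- `Ŵ_h^* = ∑ ε_i (ŵ_i^*)²`, the Hermitian conjugate of `Ŵ_h`. -/
def bigWStarOp {n u : ℕ} (g : Fin n → Fin u) (ε : Fin n → ℤˣ) (h : Fin u) : Op n :=
  ∑ i with g i = h, ((ε i : ℤ) : ℂ) • wStarOp ε i ^ 2

/-- `Ŵ_h^a` if `a ≥ 0`, and `(Ŵ_h^*)^{-a}` if `a < 0`. Its Hermitian conjugate is the same
expression with `-a` in place of `a`. -/
def omegaOp {n u : ℕ} (g : Fin n → Fin u) (ε : Fin n → ℤˣ) (h : Fin u) (a : ℤ) : Op n :=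
  if 0 ≤ a then bigWOp g ε h ^ a.toNat else bigWStarOp g ε h ^ (-a).toNat

/-- `R̂_m = Ω̂_1^{m_1} ⋯ Ω̂_u^{m_u}`. -/
def rOp {n u : ℕ} (g : Fin n → Fin u) (ε : Fin n → ℤˣ) (m : Fin u → ℤ) : Op n :=
  (List.ofFn fun h => omegaOp g ε h (m h)).prod

/-- `R̂_m^*`: the product of the Hermitian conjugates of the factors of `R̂_m`, in the opposite
order. -/
def rStarOp {n u : ℕ} (g : Fin n → Fin u) (ε : Fin n → ℤˣ) (m : Fin u → ℤ) : Op n :=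
  (List.ofFn fun h => omegaOp g ε h (-m h)).reverse.prod

/-- `Im R̂_m = (R̂_m - R̂_m^*) / (2i)`. -/
def imROp {n u : ℕ} (g : Fin n → Fin u) (ε : Fin n → ℤˣ) (m : Fin u → ℤ) : Op n :=
  (1 / (2 * Complex.I)) • (rOp g ε m - rStarOp g ε m)

/-! ### The sets `Z` and `L` -/

/-- The number `q_h` of oscillators in the group `h`. -/
def groupSize {n u : ℕ} (g : Fin n → Fin u) (h : Fin u) : ℕ :=
  (Finset.univ.filter fun i => g i = h).card

/-- The index pairs `i < j` of the momenta `P_(h)` of the group `h`. -/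
abbrev GroupPair {n u : ℕ} (g : Fin n → Fin u) (h : Fin u) : Type :=
  {e : Fin n × Fin n // e.1 < e.2 ∧ g e.1 = h ∧ g e.2 = h}

/-- A homogeneous real polynomial of degree 1 or 2 in momenta indexed by `ι`, in which every
monomial of degree 2 is a square: `∑ c_e P_e` or `∑ c_e P_e²`. -/
inductive MomentumForm (ι : Type) : Type
  | linear (c : ι → ℝ) : MomentumForm ι
  | squares (c : ι → ℝ) : MomentumForm ι

/-- The classical function given by a form in the momenta of the group `h`. -/
def MomentumForm.toFun {n u : ℕ} {g : Fin n → Fin u} (ε : Fin n → ℤˣ) {h : Fin u} :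
    MomentumForm (GroupPair g h) → Phase n → ℂ
  | .linear c => fun y => ∑ e, (c e : ℂ) * momentum ε e.1.1 e.1.2 y
  | .squares c => fun y => ∑ e, (c e : ℂ) * momentum ε e.1.1 e.1.2 y ^ 2

/-- The operator given by the same form in the operators `P̂_ij`. -/
def MomentumForm.toOp {n u : ℕ} {g : Fin n → Fin u} (ε : Fin n → ℤˣ) {h : Fin u} :
    MomentumForm (GroupPair g h) → Op n
  | .linear c => ∑ e, (c e : ℂ) • momentumOp ε e.1.1 e.1.2
  | .squares c => ∑ e, (c e : ℂ) • momentumOp ε e.1.1 e.1.2 ^ 2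

/-- For every group `h`, the set `Z_h` of `z_h` forms and the set `L_h` of `2 (q_h - z_h - 1)`
forms in the momenta of that group make up a functionally independent set `(Z_h, L_h)` of classical
functions, and the elements of `Z_h` are in involution with all elements of `(Z_h, L_h)`. -/
structure IsAdmissible {n u : ℕ} (g : Fin n → Fin u) (ε : Fin n → ℤˣ) (z : Fin u → ℕ)
    (Z : ∀ h, Fin (z h) → MomentumForm (GroupPair g h))
    (L : ∀ h, Fin (2 * (groupSize g h - z h - 1)) → MomentumForm (GroupPair g h)) : Prop where
  independent : ∀ h, FunctionallyIndependent
    fun i => (Sum.elim (Z h) (L h) i).toFun ε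
  involutive : ∀ h a i,
    poisson ((Z h a).toFun ε) ((Sum.elim (Z h) (L h) i).toFun ε) = 0

/-- The central operators `(Ĵ_1, Ẑ)`, where `Ĵ_1` consists of the first `k'` of the `Ĵ_{r^{(i)}}`. -/
def centralOps {n u : ℕ} (g : Fin n → Fin u) (ε : Fin n → ℤˣ) (k' : ℕ)
    (r : Fin u → Fin u → ℤ) (z : Fin u → ℕ)
    (Z : ∀ h, Fin (z h) → MomentumForm (GroupPair g h)) :
    {i : Fin u // (i : ℕ) < k'} ⊕ (Σ h, Fin (z h)) → Op n :=
  Sum.elim (fun i => jOp g ε (r i)) (fun a => (Z a.1 a.2).toOp ε)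

/-- The remaining operators `(Ĵ_2, R̂, L̂)`. -/
def otherOps {n u : ℕ} (g : Fin n → Fin u) (ε : Fin n → ℤˣ) (k' : ℕ)
    (r : Fin u → Fin u → ℤ) (m : Fin (u - k') → Fin u → ℤ) (z : Fin u → ℕ)
    (L : ∀ h, Fin (2 * (groupSize g h - z h - 1)) → MomentumForm (GroupPair g h)) :
    {i : Fin u // k' ≤ (i : ℕ)} ⊕ Fin (u - k') ⊕
      (Σ h, Fin (2 * (groupSize g h - z h - 1))) → Op n :=
  Sum.elim (fun i => jOp g ε (r i))
    (Sum.elim (fun j => imROp g ε (m j)) (fun a => (L a.1 a.2).toOp ε))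

end ResonantOscillators

end

/-! Three facts carry the theorem: involution of the classical forms passes to the operators, the
resonant products are invariant under the right elements, and the main parts are independent.

Involution. The commutator and the Poisson bracket are both biderivations, and the P̂_ij and P_ij
obey the same angular momentum relations (`IsAngular`) up to a constant. In any such algebra the
bracket of two forms is a combination of P_il, of anticommutators `anti`, or of `triangle` terms,
with coefficients depending only on the two forms. No quantum correction appears because every
quadratic monomial is a square and the `triangle` terms stay antisymmetric in the quantum algebra.
If the classical bracket vanishes, evaluation at suitable phase points shows that the relevant
symmetrized or alternated coefficients vanish, and therefore the commutator vanishes too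
(`MomentumForm.br_eval_eq_zero`).

Invariance. Ĵ_r acts diagonally on ŵ_j and ŵ_j^*, with weights -r_{g(j)} and r_{g(j)}. So R̂_m has
weight -2 r·m, which is zero under the resonance condition, and momenta inside a group have weight
zero. Moreover Ŵ_h is invariant under the momenta inside a group, as a quadratic form is under its
rotations.

Main parts. With T_h = ∑ ε_i p_i² and D_h = ∑ x_i p_i over group h, the operator Ĵ_r has main part ½
∑ r_h T_h, and forms in P̂_ij keep their classical functions. The operators R̂_m and R̂_m^* have
exactly the same leading operator, a product of commuting polynomials in the p̂_i. It cancels in Im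
R̂_m, whose main part therefore sits one order lower and is linear in the D_h (`hasSymbol_imROp`).
Independence follows by testing on vectors (`functionallyIndependent_mainParts`): a shear detects
only the Im R̂_m, a squeeze then detects only the Ĵ_r, and what remains splits by groups into the
admissible families.

Existence of admissible choices uses a chain of partial Casimirs ∑ ε_i ε_j P_ij² over nested initial
segments of each group, together with momenta lying below the lowest of them (`exists_choice`). -/

noncomputable section

namespace ResonantOscillators

/-! ### Differential operators and the calculus of leading symbols -/

section

variable {n : ℕ}

/-! ### The canonical commutation relations -/

theorem smooth_differentiableAt (f : Smooth n) (x : Fin n → ℝ) : DifferentiableAt ℝ f.1 x :=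
  (mem_smooth.1 f.2).differentiable (by simp) x

theorem op_ext {A B : Op n} (h : ∀ f x, (A f).1 x = (B f).1 x) : A = B :=
  LinearMap.ext fun f => Subtype.ext (funext (h f))

/-- Multiplication operators depend linearly on the multiplier. -/
def mulOpLinear : Smooth n →ₗ[ℂ] Op n where
  toFun := mulOp
  map_add' a b := op_ext fun f x => add_mul (a.1 x) (b.1 x) (f.1 x)
  map_smul' c a := op_ext fun f x => mul_assoc c (a.1 x) (f.1 x)

theorem mulOp_mul_mulOp (a b : Smooth n) : mulOp a * mulOp b = mulOp (mulOp a b) :=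
  op_ext fun f x => (mul_assoc (a.1 x) (b.1 x) (f.1 x)).symm

theorem pOp_mul_mulOp (j : Fin n) (a : Smooth n) :
    pOp j * mulOp a = mulOp a * pOp j + mulOp (pOp j a) := by
  refine op_ext fun f x => ?_
  change -Complex.I * fderiv ℝ (a.1 * f.1) x (Pi.single j 1) =
    a.1 x * (-Complex.I * fderiv ℝ f.1 x (Pi.single j 1)) +
      -Complex.I * fderiv ℝ a.1 x (Pi.single j 1) * f.1 x
  rw [fderiv_mul (smooth_differentiableAt a x) (smooth_differentiableAt f x)]
  simp only [add_apply, smul_apply, smul_eq_mul]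
  ring

theorem xOp_commute (i j : Fin n) : Commute (xOp i) (xOp j) :=
  op_ext fun f x => mul_left_comm ((x i : ℝ) : ℂ) ((x j : ℝ) : ℂ) (f.1 x)

theorem pOp_commute (i j : Fin n) : Commute (pOp i) (pOp j) := by
  refine op_ext fun f x => ?_
  have hf : ContDiff ℝ ∞ f.1 := mem_smooth.1 f.2
  have hd : DifferentiableAt ℝ (fderiv ℝ f.1) x :=
    (hf.fderiv_right (m := ∞) (by simp)).differentiable (by simp) x
  have key : ∀ v w : Fin n → ℝ, fderiv ℝ (fun y => -Complex.I * fderiv ℝ f.1 y v) x w =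
      -Complex.I * fderiv ℝ (fderiv ℝ f.1) x w v := by
    intro v w
    rw [fderiv_const_mul (hd.clm_apply (differentiableAt_const v)),
      fderiv_clm_apply hd (differentiableAt_const v)]
    simp
  have hs : IsSymmSndFDerivAt ℝ f.1 x :=
    hf.contDiffAt.isSymmSndFDerivAt (by
      rw [minSmoothness_of_isRCLikeNormedField]; exact WithTop.coe_le_coe.2 le_top)
  change -Complex.I * fderiv ℝ (fun y => -Complex.I * fderiv ℝ f.1 y (Pi.single j 1)) x
      (Pi.single i 1) = -Complex.I * fderiv ℝ (fun y => -Complex.I * fderiv ℝ f.1 y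
      (Pi.single i 1)) x (Pi.single j 1)
  rw [key, key, hs.eq]

theorem pOp_coord (i j : Fin n) : mulOp (pOp i (coord j)) =
    (if i = j then -Complex.I else 0) • (1 : Op n) := by
  refine op_ext fun f x => ?_
  have h : fderiv ℝ (coord j).1 x = Complex.ofRealCLM.comp (ContinuousLinearMap.proj j) :=
    (Complex.ofRealCLM.comp (ContinuousLinearMap.proj (R := ℝ) (φ := fun _ : Fin n => ℝ) j)).fderiv
  change -Complex.I * fderiv ℝ (coord j).1 x (Pi.single i 1) * f.1 x =
    (if i = j then -Complex.I else 0) * f.1 x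
  rw [h]
  by_cases hij : i = j
  · subst hij; simp
  · simp [hij, Ne.symm hij]

theorem pOp_mul_xOp (i j : Fin n) :
    pOp i * xOp j = xOp j * pOp i + (if i = j then -Complex.I else 0) • (1 : Op n) := by
  rw [xOp, pOp_mul_mulOp, pOp_coord]

/-! ### Products of momenta -/

/-- The commutative monoid generated by the momentum operators. -/
def momentumMonoid (n : ℕ) : Submonoid (Op n) := Submonoid.closure (Set.range pOp)

/-- `pPow` is an ordered product in a noncommutative ring. Inside the monoid generated by the p̂_j
the order is immaterial, so it becomes an ordinary `Finset` product and exponents can be added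
freely. -/
instance : CommMonoid (momentumMonoid n) :=
  { (momentumMonoid n).toMonoid with
    mul_comm := by
      have h : IsMulCommutative (Submonoid.closure (Set.range (pOp (n := n)))) :=
        Submonoid.isMulCommutative_closure _ (by
          rintro _ ⟨i, rfl⟩ _ ⟨j, rfl⟩
          exact (pOp_commute i j).eq)
      exact fun a b => h.is_comm.comm a b }

/-- The momentum operator as an element of the monoid generated by momenta. -/
def pElem (j : Fin n) : momentumMonoid n := ⟨pOp j, Submonoid.subset_closure ⟨j, rfl⟩⟩

theorem pPow_eq (α : Fin n → ℕ) : pPow α = ((∏ j, pElem j ^ α j : momentumMonoid n) : Op n) := by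
  rw [← List.prod_ofFn, pPow, Submonoid.coe_list_prod, List.map_ofFn]
  rfl

theorem pPow_zero : pPow (0 : Fin n → ℕ) = 1 := by
  rw [pPow_eq]; simp

theorem pPow_single_add (j : Fin n) (α : Fin n → ℕ) :
    pPow (Pi.single j 1 + α) = pOp j * pPow α := by
  have h : ∏ i, pElem i ^ (Pi.single j 1 : Fin n → ℕ) i = pElem j := by
    rw [Finset.prod_eq_single j]
    · simp
    · intro b _ hb; simp [hb]
    · simp
  rw [pPow_eq, pPow_eq]
  simp only [Pi.add_apply, pow_add, Finset.prod_mul_distrib, h]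
  rfl

/-! ### Symbols -/

theorem prod_pow_single_add (v : Fin n → ℂ) (j : Fin n) (α : Fin n → ℕ) :
    ∏ i, v i ^ (Pi.single j 1 + α : Fin n → ℕ) i = v j * ∏ i, v i ^ α i := by
  simp only [Pi.add_apply, pow_add, Finset.prod_mul_distrib]
  congr 1
  rw [Finset.prod_eq_single j (fun i _ hi => by simp [hi]) (by simp)]
  simp

/-- The monomial function `a(x) p^α`. -/
def monomialSymbol (a : Smooth n) (α : Fin n → ℕ) : Phase n → ℂ :=
  fun y => a.1 y.1 * ∏ j, ((y.2 j : ℝ) : ℂ) ^ α j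

/-- The part of degree `d` in the momenta of the monomial function `a(x) p^α`. -/
def topSymbol (d : ℤ) (α : Fin n → ℕ) (a : Smooth n) : Phase n → ℂ :=
  if ((∑ j, α j : ℕ) : ℤ) = d then monomialSymbol a α else 0

/-- The pairs `(A, σ)` such that `A` is a differential operator of order at most `d` and `σ` is
its homogeneous part of degree `d` in the momenta. -/
def symbolGraph (n : ℕ) (d : ℤ) : Submodule ℂ (Op n × (Phase n → ℂ)) :=
  Submodule.span ℂ {t | ∃ (a : Smooth n) (α : Fin n → ℕ), ((∑ j, α j : ℕ) : ℤ) ≤ d ∧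
    t = (mulOp a * pPow α, topSymbol d α a)}

/-- `A` has order at most `d`, and `σ` is its homogeneous part of degree `d` in the momenta. -/
def HasSymbol (d : ℤ) (A : Op n) (σ : Phase n → ℂ) : Prop := (A, σ) ∈ symbolGraph n d

namespace HasSymbol

theorem add {d : ℤ} {A B : Op n} {σ τ : Phase n → ℂ} (hA : HasSymbol d A σ)
    (hB : HasSymbol d B τ) : HasSymbol d (A + B) (σ + τ) := Submodule.add_mem _ hA hB

theorem smul {d : ℤ} {A : Op n} {σ : Phase n → ℂ} (c : ℂ) (hA : HasSymbol d A σ) :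
    HasSymbol d (c • A) (c • σ) := Submodule.smul_mem _ c hA

theorem zero (d : ℤ) : HasSymbol d (0 : Op n) 0 := Submodule.zero_mem _

theorem sum {ι : Type*} {d : ℤ} (s : Finset ι) {A : ι → Op n} {σ : ι → Phase n → ℂ}
    (h : ∀ i ∈ s, HasSymbol d (A i) (σ i)) : HasSymbol d (∑ i ∈ s, A i) (∑ i ∈ s, σ i) := by
  have := Submodule.sum_mem (symbolGraph n d) (t := s) (f := fun i => (A i, σ i)) h
  have hs : ∑ i ∈ s, (A i, σ i) = (∑ i ∈ s, A i, ∑ i ∈ s, σ i) := Prod.ext Prod.fst_sum Prod.snd_sum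
  rwa [hs] at this

theorem mulOp_mul_pPow (a : Smooth n) (α : Fin n → ℕ) {d : ℤ} (h : ((∑ j, α j : ℕ) : ℤ) = d) :
    HasSymbol d (mulOp a * pPow α) (monomialSymbol a α) :=
  Submodule.subset_span ⟨a, α, h.le, by rw [topSymbol, if_pos h]⟩

theorem mulOp_mul_pPow_of_lt (a : Smooth n) (α : Fin n → ℕ) {d : ℤ}
    (h : ((∑ j, α j : ℕ) : ℤ) < d) : HasSymbol d (mulOp a * pPow α) 0 :=
  Submodule.subset_span ⟨a, α, h.le, by rw [topSymbol, if_neg h.ne]⟩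

/-- Since the graph of "operator and degree-d part" is a span, properties of symbols need only be
checked on monomials a(x) p̂^α. No uniqueness of the coefficients is needed anywhere. -/
theorem induction {d : ℤ} {motive : Op n → (Phase n → ℂ) → Prop}
    (top : ∀ a α, ((∑ j, α j : ℕ) : ℤ) = d → motive (mulOp a * pPow α) (monomialSymbol a α))
    (lower : ∀ a α, ((∑ j, α j : ℕ) : ℤ) < d → motive (mulOp a * pPow α) 0)
    (zero : motive 0 0)
    (add : ∀ A B σ τ, motive A σ → motive B τ → motive (A + B) (σ + τ))
    (smul : ∀ (c : ℂ) A σ, motive A σ → motive (c • A) (c • σ))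
    {A : Op n} {σ : Phase n → ℂ} (h : HasSymbol d A σ) : motive A σ := by
  refine Submodule.span_induction (p := fun t _ => motive t.1 t.2) ?_ zero
    (fun s t _ _ hs ht => add _ _ _ _ hs ht) (fun c t _ ht => smul c _ _ ht) h
  rintro _ ⟨a, α, hd, rfl⟩
  by_cases hα : ((∑ j, α j : ℕ) : ℤ) = d
  · simp only [topSymbol, if_pos hα]; exact top a α hα
  · simp only [topSymbol, if_neg hα]; exact lower a α (lt_of_le_of_ne hd hα)

theorem of_lt {d e : ℤ} (hde : d < e) {A : Op n} {σ : Phase n → ℂ} (h : HasSymbol d A σ) :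
    HasSymbol e A 0 := by
  refine HasSymbol.induction (motive := fun A _ => HasSymbol e A 0) ?_ ?_ (HasSymbol.zero e) ?_ ?_ h
  · intro a α hα; exact mulOp_mul_pPow_of_lt a α (by omega)
  · intro a α hα; exact mulOp_mul_pPow_of_lt a α (by omega)
  · intro A B _ _ hA hB; simpa using hA.add hB
  · intro c A _ hA; simpa using hA.smul c

theorem mulOp_mul (b : Smooth n) {d : ℤ} {A : Op n} {σ : Phase n → ℂ} (h : HasSymbol d A σ) :
    HasSymbol d (mulOp b * A) ((fun y => b.1 y.1) * σ) := by
  refine HasSymbol.induction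
    (motive := fun A σ => HasSymbol d (mulOp b * A) ((fun y => b.1 y.1) * σ)) ?_ ?_ ?_ ?_ ?_ h
  · intro a α hα
    rw [← mul_assoc, mulOp_mul_mulOp]
    convert mulOp_mul_pPow (mulOp b a) α hα using 1
    funext y
    exact (mul_assoc (b.1 y.1) (a.1 y.1) _).symm
  · intro a α hα
    rw [← mul_assoc, mulOp_mul_mulOp, mul_zero]
    exact mulOp_mul_pPow_of_lt _ α hα
  · rw [mul_zero, mul_zero]; exact HasSymbol.zero d
  · intro A B σ τ hA hB; rw [mul_add, mul_add]; exact hA.add hB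
  · intro c A σ hA; rw [mul_smul_comm, mul_smul_comm]; exact hA.smul c

/-- Moving p̂_j past a coefficient a(x) costs the term (p̂_j a) p̂^α, which has order at most d and
is invisible in degree d + 1. -/
theorem pOp_mul (j : Fin n) {d : ℤ} {A : Op n} {σ : Phase n → ℂ} (h : HasSymbol d A σ) :
    HasSymbol (d + 1) (pOp j * A) ((fun y => ((y.2 j : ℝ) : ℂ)) * σ) := by
  have hdeg : ∀ α : Fin n → ℕ, ∑ i, (Pi.single j 1 + α : Fin n → ℕ) i = 1 + ∑ i, α i := by
    intro α; simp [Finset.sum_add_distrib]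
  have hsplit : ∀ (a : Smooth n) α, pOp j * (mulOp a * pPow α) =
      mulOp a * pPow (Pi.single j 1 + α) + mulOp (pOp j a) * pPow α := by
    intro a α
    rw [← mul_assoc, pOp_mul_mulOp, add_mul, mul_assoc, pPow_single_add]
  refine HasSymbol.induction
    (motive := fun A σ => HasSymbol (d + 1) (pOp j * A) ((fun y => ((y.2 j : ℝ) : ℂ)) * σ))
    ?_ ?_ ?_ ?_ ?_ h
  · intro a α hα
    rw [hsplit]
    convert (mulOp_mul_pPow a (Pi.single j 1 + α) (d := d + 1) (by rw [hdeg]; push_cast at *; omega)).add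
      (mulOp_mul_pPow_of_lt (pOp j a) α (d := d + 1) (by omega)) using 1
    rw [add_zero]
    funext y
    simp only [monomialSymbol, Pi.mul_apply, prod_pow_single_add]
    ring
  · intro a α hα
    rw [hsplit, mul_zero, ← add_zero 0]
    exact (mulOp_mul_pPow_of_lt a _ (by rw [hdeg]; push_cast at *; omega)).add
      (mulOp_mul_pPow_of_lt _ α (by omega))
  · rw [mul_zero, mul_zero]; exact HasSymbol.zero _
  · intro A B σ τ hA hB; rw [mul_add, mul_add]; exact hA.add hB
  · intro c A σ hA; rw [mul_smul_comm, mul_smul_comm]; exact hA.smul c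

theorem pPow_mul {d : ℤ} {A : Op n} {σ : Phase n → ℂ} (h : HasSymbol d A σ) :
    ∀ (k : ℕ) (α : Fin n → ℕ), ∑ j, α j = k →
      HasSymbol (k + d) (pPow α * A) ((fun y => ∏ j, ((y.2 j : ℝ) : ℂ) ^ α j) * σ) := by
  intro k
  induction k with
  | zero =>
    intro α hα
    have h0 : α = 0 := by
      funext j
      exact (Finset.sum_eq_zero_iff.1 hα) j (Finset.mem_univ j)
    subst h0
    convert h using 1
    · simp
    · rw [pPow_zero, one_mul]
    · funext y; simp
  | succ k ih =>
    intro α hα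
    obtain ⟨j, hj⟩ : ∃ j, α j ≠ 0 := by
      by_contra hcon
      push Not at hcon
      simp [hcon] at hα
    obtain ⟨β, rfl⟩ : ∃ β : Fin n → ℕ, α = Pi.single j 1 + β := by
      refine ⟨α - Pi.single j 1, ?_⟩
      funext i
      by_cases hi : i = j
      · subst hi; simp; omega
      · simp [Pi.single_eq_of_ne hi]
    have hβ : ∑ i, β i = k := by
      simp [Finset.sum_add_distrib] at hα; omega
    convert (ih β hβ).pOp_mul j using 1
    · push_cast; ring
    · rw [pPow_single_add, mul_assoc]
    · funext y
      simp only [Pi.mul_apply, prod_pow_single_add]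
      ring

theorem mul {d e : ℤ} {A B : Op n} {σ τ : Phase n → ℂ} (hA : HasSymbol d A σ)
    (hB : HasSymbol e B τ) : HasSymbol (d + e) (A * B) (σ * τ) := by
  refine HasSymbol.induction (motive := fun A σ => HasSymbol (d + e) (A * B) (σ * τ))
    ?_ ?_ ?_ ?_ ?_ hA
  · intro a α hα
    rw [mul_assoc, ← hα]
    convert (hB.pPow_mul _ α rfl).mulOp_mul a using 1
    funext y
    simp only [monomialSymbol, Pi.mul_apply]
    ring
  · intro a α hα
    rw [mul_assoc, zero_mul]
    exact ((hB.pPow_mul _ α rfl).mulOp_mul a).of_lt (by omega)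
  · rw [zero_mul, zero_mul]; exact HasSymbol.zero _
  · intro A A' σ σ' h h'; rw [add_mul, add_mul]; exact h.add h'
  · intro c A σ h; rw [smul_mul_assoc, smul_mul_assoc]; exact h.smul c

theorem exists_finsupp {d : ℤ} {A : Op n} {σ : Phase n → ℂ} (h : HasSymbol d A σ) :
    ∃ a : (Fin n → ℕ) →₀ Smooth n, (∀ α ∈ a.support, ((∑ j, α j : ℕ) : ℤ) ≤ d) ∧
      A = a.sum (fun α b => mulOp b * pPow α) ∧
      σ = a.sum (topSymbol d) := by
  classical
  have hm0 : ∀ α : Fin n → ℕ, mulOp (0 : Smooth n) * pPow α = 0 := fun α => by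
    rw [show mulOp (0 : Smooth n) = 0 from mulOpLinear.map_zero, zero_mul]
  have hm : ∀ (α : Fin n → ℕ) (b c : Smooth n), mulOp (b + c) * pPow α =
      mulOp b * pPow α + mulOp c * pPow α := fun α b c => by
    rw [show mulOp (b + c) = mulOp b + mulOp c from mulOpLinear.map_add b c, add_mul]
  have hs0 : ∀ α : Fin n → ℕ, topSymbol d α 0 = 0 := fun α => by
    unfold topSymbol
    split_ifs
    · funext y; exact zero_mul _
    · rfl
  have hs : ∀ (α : Fin n → ℕ) (b c : Smooth n),
      topSymbol d α (b + c) = topSymbol d α b + topSymbol d α c := fun α b c => by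
    unfold topSymbol
    split_ifs
    · funext y; exact add_mul _ _ _
    · rw [add_zero]
  refine HasSymbol.induction (motive := fun A σ => ∃ a : (Fin n → ℕ) →₀ Smooth n,
    (∀ α ∈ a.support, ((∑ j, α j : ℕ) : ℤ) ≤ d) ∧
      A = a.sum (fun α b => mulOp b * pPow α) ∧
      σ = a.sum (topSymbol d))
    ?_ ?_ ?_ ?_ ?_ h
  · intro a α hα
    refine ⟨Finsupp.single α a, ?_, ?_, ?_⟩
    · intro β hβ
      have := Finsupp.support_single_subset hβ
      rw [Finset.mem_singleton] at this
      rw [this]; exact hα.le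
    · rw [Finsupp.sum_single_index (hm0 α)]
    · rw [Finsupp.sum_single_index (hs0 α), topSymbol, if_pos hα]
  · intro a α hα
    refine ⟨Finsupp.single α a, ?_, ?_, ?_⟩
    · intro β hβ
      have := Finsupp.support_single_subset hβ
      rw [Finset.mem_singleton] at this
      rw [this]; exact hα.le
    · rw [Finsupp.sum_single_index (hm0 α)]
    · rw [Finsupp.sum_single_index (hs0 α), topSymbol, if_neg hα.ne]
  · exact ⟨0, by simp, by simp, by simp⟩
  · rintro A B σ τ ⟨a, ha, rfl, rfl⟩ ⟨b, hb, rfl, rfl⟩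
    refine ⟨a + b, ?_, ?_, ?_⟩
    · intro α hα
      rcases Finset.mem_union.1 (Finsupp.support_add hα) with h | h
      · exact ha α h
      · exact hb α h
    · rw [Finsupp.sum_add_index' hm0 hm]
    · rw [Finsupp.sum_add_index' hs0 hs]
  · rintro c A σ ⟨a, ha, rfl, rfl⟩
    refine ⟨c • a, fun α hα => ha α (Finsupp.support_smul hα), ?_, ?_⟩
    · rw [Finsupp.sum_smul_index' hm0, Finsupp.smul_sum]
      refine Finsupp.sum_congr fun α _ => ?_
      rw [show mulOp (c • a α) = c • mulOp (a α) from mulOpLinear.map_smul c (a α), smul_mul_assoc]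
    · rw [Finsupp.sum_smul_index' hs0, Finsupp.smul_sum]
      refine Finsupp.sum_congr fun α _ => ?_
      unfold topSymbol
      split_ifs
      · funext y; exact (mul_assoc c ((a α).1 y.1) (∏ j, ((y.2 j : ℝ) : ℂ) ^ α j)).symm
      · rw [smul_zero]

/-- `HasSymbol` only bounds the order by d. A nonzero degree-d part forces some exponent of total
degree d into the support, so the order is exactly d and σ is the main part. -/
theorem isMainPart {d : ℤ} {A : Op n} {σ : Phase n → ℂ} (h : HasSymbol d A σ) (hσ : σ ≠ 0) :
    IsMainPart A σ := by
  obtain ⟨a, ha, hA, hs⟩ := h.exists_finsupp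
  simp only [Finsupp.sum, topSymbol, ← Finset.sum_filter] at hs
  obtain ⟨α, hα⟩ : (a.support.filter fun α => ((∑ j, α j : ℕ) : ℤ) = d).Nonempty := by
    rw [Finset.nonempty_iff_ne_empty]
    intro h0
    rw [h0, Finset.sum_empty] at hs
    exact hσ hs
  rw [Finset.mem_filter] at hα
  obtain ⟨hα, rfl⟩ := hα
  refine ⟨∑ j, α j, a, fun β hβ => by exact_mod_cast ha β hβ, ⟨α, hα, rfl⟩, hA, ?_⟩
  rw [hs]
  funext y
  simp only [Nat.cast_inj, Finset.sum_apply]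
  rfl

end HasSymbol

theorem FunctionallyIndependent.ne_zero {ι : Type} {f : ι → Phase n → ℂ}
    (h : FunctionallyIndependent f) (i : ι) : f i ≠ 0 := by
  obtain ⟨U, -, hU, hi⟩ := h
  obtain ⟨y, hy⟩ := hU.nonempty
  intro h0
  refine (hi y hy).ne_zero i ?_
  rw [h0]
  exact fderiv_const_apply 0

theorem quasiIndependent_of_hasSymbol {ι : Type} {A : ι → Op n} {σ : ι → Phase n → ℂ}
    (h : ∀ i, ∃ d, HasSymbol d (A i) (σ i)) (hσ : FunctionallyIndependent σ) :
    QuasiIndependent A :=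
  ⟨σ, fun i => (h i).elim fun _ hd => hd.isMainPart (hσ.ne_zero i), hσ⟩

end

/-! ### Bracket relations of angular momenta, valid for commutators and Poisson brackets alike -/

section

/-! ### Biderivations -/

/-- A skew-symmetric bilinear operation satisfying the Leibniz rule: the common structure of the
commutator and of the Poisson bracket. -/
structure Biderivation (A : Type*) [Ring A] [Algebra ℂ A] where
  /-- The bracket. -/
  br : A →ₗ[ℂ] A →ₗ[ℂ] A
  skew : ∀ a b, br a b = -br b a
  leibniz : ∀ a b c, br a (b * c) = br a b * c + b * br a c

/-- The commutator. -/
def commutator (A : Type*) [Ring A] [Algebra ℂ A] : Biderivation A where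
  br := LinearMap.mul ℂ A - (LinearMap.mul ℂ A).flip
  skew a b := by simp
  leibniz a b c := by
    simp only [LinearMap.sub_apply, LinearMap.mul_apply', LinearMap.flip_apply]
    noncomm_ring

theorem commutator_br {A : Type*} [Ring A] [Algebra ℂ A] (a b : A) :
    (commutator A).br a b = a * b - b * a := rfl

theorem commutator_br_eq_zero {A : Type*} [Ring A] [Algebra ℂ A] {a b : A} :
    (commutator A).br a b = 0 ↔ Commute a b := by
  rw [commutator_br, sub_eq_zero]; rfl

namespace Biderivation

variable {A : Type*} [Ring A] [Algebra ℂ A] (B : Biderivation A)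

theorem leibniz_left (a b c : A) : B.br (a * b) c = B.br a c * b + a * B.br b c := by
  rw [B.skew, B.leibniz, B.skew c a, B.skew c b, neg_mul, mul_neg, ← neg_add, neg_neg]

theorem br_one (a : A) : B.br a 1 = 0 := by
  have h := B.leibniz a 1 1
  rw [mul_one, mul_one, one_mul] at h
  exact left_eq_add.1 h

theorem br_two_smul (a b : A) : B.br ((2 : ℂ) • a) ((2 : ℂ) • b) = (4 : ℂ) • B.br a b := by
  simp only [map_smul, LinearMap.smul_apply, smul_smul]
  norm_num

theorem br_sum_sum {ι : Type*} [Fintype ι] (a : A) (f : ι → ι → A) :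
    B.br a (∑ i, ∑ j, f i j) = ∑ i, ∑ j, B.br a (f i j) := by simp only [map_sum]

end Biderivation

/-! ### Oscillator systems -/

/-- Elements `w_i`, `w_i^*` satisfying the bracket relations of oscillators of signs `e_i`. -/
structure IsOscillatorSystem {A : Type*} [Ring A] [Algebra ℂ A] (B : Biderivation A) {ι : Type*}
    [DecidableEq ι] (e : ι → ℂ) (κ : ℂ) (w w' : ι → A) : Prop where
  br_self : ∀ i j, B.br (w i) (w j) = 0
  br_star : ∀ i j, B.br (w' i) (w' j) = 0
  br : ∀ i j, B.br (w i) (w' j) = (if i = j then κ * e i else 0) • (1 : A)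

/-- Elements `P_ij` satisfying the bracket relations of angular momenta of signs `e_i`. -/
structure IsAngular {A : Type*} [Ring A] [Algebra ℂ A] (B : Biderivation A) {ι : Type*}
    [DecidableEq ι] (e : ι → ℂ) (κ : ℂ) (P : ι → ι → A) : Prop where
  antisymm : ∀ i j, P i j = -P j i
  br : ∀ i j k l, B.br (P i j) (P k l) = κ • ((if j = k then e j else 0) • P i l +
    (if i = l then e i else 0) • P j k - (if j = l then e j else 0) • P i k -
    (if i = k then e i else 0) • P j l)
  commute : ∀ j k l, Commute (P l j) (P k j * P k l - P k l * P k j)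

/-- The products w_i w_j^* close under the bracket like weighted matrix units (`hE`). The P_ij are
their antisymmetrizations, which gives orthogonal-type relations with metric e. -/
theorem IsOscillatorSystem.br_momentum {A : Type*} [Ring A] [Algebra ℂ A] {B : Biderivation A}
    {ι : Type*} [DecidableEq ι] {e : ι → ℂ} {κ : ℂ} {w w' : ι → A}
    (h : IsOscillatorSystem B e κ w w') (P : ι → ι → A)
    (hP : ∀ i j, P i j = Complex.I • (w i * w' j - w j * w' i)) (i j k l : ι) :
    B.br (P i j) (P k l) = (-Complex.I * κ) • ((if j = k then e j else 0) • P i l +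
    (if i = l then e i else 0) • P j k - (if j = l then e j else 0) • P i k -
    (if i = k then e i else 0) • P j l) := by
  have hE : ∀ i j k l, B.br (w i * w' j) (w k * w' l) =
      (if i = l then κ * e i else 0) • (w k * w' j) -
        (if j = k then κ * e j else 0) • (w i * w' l) := by
    intro i j k l
    rw [B.leibniz, B.leibniz_left, B.leibniz_left, h.br_self, h.br_star, h.br, B.skew (w' j) (w k),
      h.br]
    have : (if k = j then κ * e k else 0) = if j = k then κ * e j else 0 := by
      by_cases hjk : j = k
      · subst hjk; rfl
      · rw [if_neg hjk, if_neg (Ne.symm hjk)]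
    rw [this]
    simp only [zero_mul, zero_add, mul_zero, add_zero, mul_neg, neg_mul, mul_smul_comm,
      smul_mul_assoc, mul_one, one_mul]
    abel
  have hs : ∀ a b : ι, (if a = b then κ * e a else 0) = κ * (if a = b then e a else 0) := by
    intro a b; split_ifs <;> simp
  rw [hP i j, hP k l]
  simp only [map_smul, map_sub, LinearMap.smul_apply, LinearMap.sub_apply, hE, hs, hP i l,
    hP j k, hP i k, hP j l]
  have e1 : ∀ a b : ι, (if a = b then e a else 0) = (if b = a then e b else 0) := by
    intro a b
    by_cases hab : a = b
    · subst hab; rfl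
    · rw [if_neg hab, if_neg (Ne.symm hab)]
  match_scalars <;> ring_nf

/-- The anticommutator of `P_ij` and `P_kj`. -/
def anti {A ι : Type*} [Ring A] (P : ι → ι → A) (i k j : ι) : A :=
  P i j * P k j + P k j * P i j

/-- The anticommutator of `P_ik` with the anticommutator of `P_ij` and `P_kj`. -/
def triangle {A ι : Type*} [Ring A] (P : ι → ι → A) (i k j : ι) : A :=
  anti P i k j * P i k + P i k * anti P i k j

theorem anti_symm {A ι : Type*} [Ring A] {P : ι → ι → A} (i k j : ι) :
    anti P i k j = anti P k i j := add_comm _ _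

/-- The sum of a family of coefficients over all permutations of its indices, with signs. -/
def alternate {ι : Type*} (F : ι → ι → ι → ℂ) (i j k : ι) : ℂ :=
  F i j k - F j i k - F i k j + F j k i + F k i j - F k j i

namespace IsAngular

variable {A : Type*} [Ring A] [Algebra ℂ A] {B : Biderivation A} {ι : Type*}
  [DecidableEq ι] {e : ι → ℂ} {κ : ℂ} {P : ι → ι → A}

theorem self (hP : IsAngular B e κ P) (i : ι) : P i i = 0 := by
  have h := hP.antisymm i i
  have h2 : (2 : ℂ) • P i i = 0 := by rw [two_smul]; nth_rw 2 [h]; simp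
  exact (smul_eq_zero.1 h2).resolve_left two_ne_zero

theorem triangle_swap_left (hP : IsAngular B e κ P) (i k j : ι) :
    triangle P k i j = -triangle P i k j := by
  rw [triangle, triangle, anti_symm k i j, hP.antisymm k i]
  simp only [mul_neg, neg_mul]; abel

/-- For any a, b, c one has {{a,b},c} - {{c,b},a} = [b,[a,c]], where braces denote anticommutators.
With a = P_kj, b = P_lj, c = P_kl the double commutator vanishes by the `commute` axiom. Together
with `triangle_swap_left` this makes `triangle` totally antisymmetric, even when the P_ij do not
commute. -/
theorem triangle_swap_right (hP : IsAngular B e κ P) (k l j : ι) :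
    triangle P k j l = -triangle P k l j := by
  have h := (hP.commute j k l).eq
  have e1 := hP.antisymm j l
  simp only [triangle, anti, e1]
  generalize P l j = b at *
  generalize P k j = a at *
  generalize P k l = c at *
  have h2 : b * (a * c - c * a) - (a * c - c * a) * b = 0 := sub_eq_zero.2 h
  rw [← sub_eq_zero, ← h2]
  noncomm_ring

variable [Fintype ι]

theorem linear_br (hP : IsAngular B e κ P) {C : ι → ι → ℂ} (hC : ∀ i j, C i j = -C j i) (k l : ι) :
    B.br (∑ i, ∑ j, C i j • P i j) (P k l) =
      (2 * κ) • ((∑ i, (C i k * e k) • P i l) - ∑ i, (C i l * e l) • P i k) := by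
  have h1 : ∀ a b : ι, (∑ i, ∑ j, C i j • (if j = a then e j else 0) • P i b) =
      ∑ i, (C i a * e a) • P i b := by
    intro a b
    refine Finset.sum_congr rfl fun i _ => ?_
    rw [Finset.sum_eq_single a]
    · simp [smul_smul]
    · intro j _ hj; simp [hj]
    · simp
  have h2 : ∀ a b : ι, (∑ i, ∑ j, C i j • (if i = a then e i else 0) • P j b) =
      -∑ i, (C i a * e a) • P i b := by
    intro a b
    rw [Finset.sum_comm, ← h1 a b, ← Finset.sum_neg_distrib]
    refine Finset.sum_congr rfl fun i _ => ?_
    rw [← Finset.sum_neg_distrib]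
    refine Finset.sum_congr rfl fun j _ => ?_
    rw [hC j i, neg_smul]
  simp only [map_sum, map_smul, LinearMap.sum_apply, LinearMap.smul_apply, hP.br]
  have h3 : ∀ i j, C i j • κ • ((if j = k then e j else 0) • P i l +
    (if i = l then e i else 0) • P j k - (if j = l then e j else 0) • P i k -
    (if i = k then e i else 0) • P j l) = κ • (C i j • (if j = k then e j else 0) • P i l +
    C i j • (if i = l then e i else 0) • P j k - C i j • (if j = l then e j else 0) • P i k -
    C i j • (if i = k then e i else 0) • P j l) := by
    intro i j
    module
  simp only [h3, ← Finset.smul_sum, Finset.sum_sub_distrib, Finset.sum_add_distrib, h1, h2]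
  module

theorem linear_br_linear (hP : IsAngular B e κ P) {C D : ι → ι → ℂ} (hC : ∀ i j, C i j = -C j i)
    (hD : ∀ i j, D i j = -D j i) :
    B.br (∑ i, ∑ j, C i j • P i j) (∑ k, ∑ l, D k l • P k l) =
      (4 * κ) • ∑ i, ∑ l, (∑ k, C i k * e k * D k l) • P i l := by
  have h1 : ∀ k l, B.br (∑ i, ∑ j, C i j • P i j) (D k l • P k l) = D k l • (2 * κ) •
      ((∑ i, (C i k * e k) • P i l) - ∑ i, (C i l * e l) • P i k) := by
    intro k l; rw [map_smul, hP.linear_br hC]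
  have h1' : ∀ k l, D k l • (2 * κ) • ((∑ i, (C i k * e k) • P i l) - ∑ i, (C i l * e l) • P i k) =
      (2 * κ) • (∑ i, (C i k * e k * D k l) • P i l) +
      (2 * κ) • (∑ i, (C i l * e l * D l k) • P i k) := by
    intro k l
    rw [smul_comm, ← smul_add]
    congr 1
    rw [smul_sub, sub_eq_add_neg, Finset.smul_sum, Finset.smul_sum, ← Finset.sum_neg_distrib]
    congr 1
    · refine Finset.sum_congr rfl fun i _ => ?_
      rw [smul_smul, mul_comm]
    · refine Finset.sum_congr rfl fun i _ => ?_
      rw [hD l k, smul_smul, ← neg_smul]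
      congr 1; ring
  rw [B.br_sum_sum]
  simp only [h1, h1', Finset.sum_add_distrib]
  rw [Finset.sum_comm (f := fun k l => (2 * κ) • ∑ i, (C i l * e l * D l k) • P i k), ← two_smul ℂ]
  simp only [← Finset.smul_sum, smul_smul, Finset.sum_smul]
  have h2 : ∑ k, ∑ l, ∑ i, (C i k * e k * D k l) • P i l =
      ∑ i, ∑ l, ∑ k, (C i k * e k * D k l) • P i l := by
    rw [Finset.sum_comm]
    rw [Finset.sum_congr rfl fun l _ => Finset.sum_comm]
    rw [Finset.sum_comm]
  rw [h2]
  congr 1; ring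

/-- The coefficient is written as a difference so that it is symmetric in i, k and zero for i = k.
As `anti` is symmetric in i, k, this is the form in which the coefficients can be recovered from the
value of the sum. -/
theorem linear_br_squares (hP : IsAngular B e κ P) {C D : ι → ι → ℂ} (hC : ∀ i j, C i j = -C j i)
    (hD : ∀ i j, D i j = D j i) :
    B.br (∑ i, ∑ j, C i j • P i j) (∑ k, ∑ l, D k l • P k l ^ 2) =
      (2 * κ) • ∑ i, ∑ k, ∑ l, (C i k * (D k l * e k - D i l * e i)) • anti P i k l := by
  have h1 : ∀ k l, B.br (∑ i, ∑ j, C i j • P i j) (D k l • P k l ^ 2) =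
      (2 * κ) • (∑ i, (C i k * D k l * e k) • anti P i k l) +
      (2 * κ) • (∑ i, (C i l * D l k * e l) • anti P i l k) := by
    intro k l
    rw [map_smul, pow_two, B.leibniz, hP.linear_br hC]
    rw [← smul_add, smul_mul_assoc, mul_smul_comm, ← smul_add, smul_comm]
    congr 1
    simp only [sub_mul, mul_sub, Finset.sum_mul, Finset.mul_sum, smul_mul_assoc, mul_smul_comm]
    rw [sub_add_sub_comm, ← Finset.sum_add_distrib, ← Finset.sum_add_distrib, smul_sub,
      sub_eq_add_neg, Finset.smul_sum, Finset.smul_sum, ← Finset.sum_neg_distrib]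
    congr 1
    · refine Finset.sum_congr rfl fun i _ => ?_
      rw [anti, ← smul_add, smul_smul]
      congr 1; ring
    · refine Finset.sum_congr rfl fun i _ => ?_
      rw [anti, hP.antisymm l k, ← smul_add, smul_smul, hD l k, mul_neg, neg_mul, ← neg_add,
        smul_neg]
      congr 2; ring
  have h2 : B.br (∑ i, ∑ j, C i j • P i j) (∑ k, ∑ l, D k l • P k l ^ 2) =
      (4 * κ) • ∑ i, ∑ k, ∑ l, (C i k * D k l * e k) • anti P i k l := by
    rw [B.br_sum_sum]
    simp only [h1, Finset.sum_add_distrib]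
    rw [Finset.sum_comm (f := fun k l => (2 * κ) • ∑ i, (C i l * D l k * e l) • anti P i l k),
      ← two_smul ℂ]
    simp only [← Finset.smul_sum, smul_smul]
    rw [Finset.sum_congr rfl fun k _ => Finset.sum_comm, Finset.sum_comm]
    congr 1; ring
  have h3 : ∑ i, ∑ k, ∑ l, (C i k * D i l * e i) • anti P i k l =
      -∑ i, ∑ k, ∑ l, (C i k * D k l * e k) • anti P i k l := by
    rw [Finset.sum_comm, ← Finset.sum_neg_distrib]
    refine Finset.sum_congr rfl fun i _ => ?_
    rw [← Finset.sum_neg_distrib]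
    refine Finset.sum_congr rfl fun k _ => ?_
    rw [← Finset.sum_neg_distrib]
    refine Finset.sum_congr rfl fun l _ => ?_
    rw [anti_symm, hC k i, ← neg_smul]
    congr 1; ring
  have h4 : ∀ i k l, (C i k * (D k l * e k - D i l * e i)) • anti P i k l =
      (C i k * D k l * e k) • anti P i k l - (C i k * D i l * e i) • anti P i k l := by
    intro i k l
    rw [← sub_smul]; congr 1; ring
  simp only [h4, Finset.sum_sub_distrib, h3]
  rw [h2]
  module

theorem squares_br (hP : IsAngular B e κ P) {C : ι → ι → ℂ} (hC : ∀ i j, C i j = C j i) (k l : ι) :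
    B.br (∑ i, ∑ j, C i j • P i j ^ 2) (P k l) =
      (-(2 * κ)) • ∑ j, (C l j * e l - C k j * e k) • anti P k l j := by
  have h0 : ∀ i j, B.br (P k l) (C i j • P i j ^ 2) =
      κ • ((if l = i then C i j * e l else 0) • (P k j * P i j + P i j * P k j) +
        (if k = j then C i j * e k else 0) • (P l i * P i j + P i j * P l i) -
        (if l = j then C i j * e l else 0) • (P k i * P i j + P i j * P k i) -
        (if k = i then C i j * e k else 0) • (P l j * P i j + P i j * P l j)) := by
    intro i j
    have hm : ∀ (p : Prop) [Decidable p] (a b : ℂ), (if p then a * b else 0) =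
        a * (if p then b else 0) := by
      intro p _ a b; split_ifs <;> simp
    simp only [hm]
    rw [map_smul, pow_two, B.leibniz, hP.br]
    simp only [smul_mul_assoc, mul_smul_comm, sub_mul, mul_sub, add_mul, mul_add]
    module
  have s1 : ∀ (a b : ι) (c : ℂ), (∑ i, ∑ j, (if a = i then C i j * c else 0) •
      (P b j * P i j + P i j * P b j)) = ∑ j, (C a j * c) • anti P a b j := by
    intro a b c
    rw [Finset.sum_eq_single a]
    · simp [anti, add_comm]
    · intro i _ hi; simp [Ne.symm hi]
    · simp
  have s2 : ∀ (a b : ι) (c : ℂ), (∑ i, ∑ j, (if a = j then C i j * c else 0) •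
      (P b i * P i j + P i j * P b i)) = -∑ j, (C a j * c) • anti P a b j := by
    intro a b c
    rw [Finset.sum_comm, ← s1, ← Finset.sum_neg_distrib]
    refine Finset.sum_congr rfl fun i _ => ?_
    rw [← Finset.sum_neg_distrib]
    refine Finset.sum_congr rfl fun j _ => ?_
    rw [hC j i, hP.antisymm j i, ← smul_neg]
    congr 1
    rw [mul_neg, neg_mul]; abel
  rw [B.skew]
  simp only [map_sum, h0]
  simp only [← Finset.smul_sum, Finset.sum_sub_distrib, Finset.sum_add_distrib, s1, s2]
  simp only [sub_smul, Finset.sum_sub_distrib, anti_symm l k]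
  module

/-- Bracketing with P_kl gives a combination of anticommutators, and the Leibniz rule for P_kl²
wraps each in a further anticommutator with P_kl. This is exactly `triangle`, so no lower-order
terms arise. -/
theorem squares_br_squares (hP : IsAngular B e κ P) {C D : ι → ι → ℂ} (hC : ∀ i j, C i j = C j i)
    (hD : ∀ i j, D i j = D j i) :
    B.br (∑ i, ∑ j, C i j • P i j ^ 2) (∑ k, ∑ l, D k l • P k l ^ 2) =
      (-(4 * κ)) • ∑ k, ∑ l, ∑ j, (D k l * C l j * e l) • triangle P k l j := by
  have h1 : ∀ k l, B.br (∑ i, ∑ j, C i j • P i j ^ 2) (D k l • P k l ^ 2) =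
      (-(2 * κ)) • (∑ j, (D k l * C l j * e l) • triangle P k l j) +
      (-(2 * κ)) • (∑ j, (D l k * C k j * e k) • triangle P l k j) := by
    intro k l
    rw [map_smul, pow_two, B.leibniz, hP.squares_br hC]
    rw [smul_mul_assoc, mul_smul_comm, ← smul_add, ← smul_add, smul_comm]
    congr 1
    simp only [Finset.sum_mul, Finset.mul_sum, smul_mul_assoc, mul_smul_comm]
    rw [← Finset.sum_add_distrib, ← Finset.sum_add_distrib, Finset.smul_sum]
    refine Finset.sum_congr rfl fun j _ => ?_
    rw [hP.triangle_swap_left k l, hD l k, triangle]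
    module
  rw [B.br_sum_sum]
  simp only [h1, Finset.sum_add_distrib]
  rw [Finset.sum_comm (f := fun k l => (-(2 * κ)) • ∑ j, (D l k * C k j * e k) • triangle P l k j),
    ← two_smul ℂ]
  simp only [← Finset.smul_sum, smul_smul]
  congr 1; ring

/-- As `triangle` is totally antisymmetric, only the alternating part of F matters; 6 is the number
of permutations of three indices. -/
theorem sum_triangle (hP : IsAngular B e κ P) (F : ι → ι → ι → ℂ) :
    (6 : ℂ) • ∑ i, ∑ j, ∑ k, F i j k • triangle P i j k =
      ∑ i, ∑ j, ∑ k, alternate F i j k • triangle P i j k := by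
  have sl : ∀ G : ι → ι → ι → ℂ, ∑ i, ∑ j, ∑ k, G j i k • triangle P i j k =
      -∑ i, ∑ j, ∑ k, G i j k • triangle P i j k := by
    intro G
    rw [Finset.sum_comm]
    simp only [← Finset.sum_neg_distrib]
    refine Finset.sum_congr rfl fun i _ => Finset.sum_congr rfl fun j _ =>
      Finset.sum_congr rfl fun k _ => ?_
    rw [hP.triangle_swap_left i j, smul_neg]
  have sr : ∀ G : ι → ι → ι → ℂ, ∑ i, ∑ j, ∑ k, G i k j • triangle P i j k =
      -∑ i, ∑ j, ∑ k, G i j k • triangle P i j k := by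
    intro G
    rw [Finset.sum_congr rfl fun i _ => Finset.sum_comm]
    simp only [← Finset.sum_neg_distrib]
    refine Finset.sum_congr rfl fun i _ => Finset.sum_congr rfl fun j _ =>
      Finset.sum_congr rfl fun k _ => ?_
    rw [hP.triangle_swap_right i j, smul_neg]
  have a1 := sl F
  have a2 := sr F
  have a3 := sl fun i j k => F i k j
  have a4 := sr fun i j k => F j i k
  have a5 := sr fun i j k => F j k i
  simp only [alternate, add_smul, sub_smul, Finset.sum_add_distrib, Finset.sum_sub_distrib]
  rw [a5, a4, a3, a2, a1]
  module

end IsAngular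

end

/-! ### The quantum and the classical realization of the relations -/

section

variable {n : ℕ}

/-- The sign `ε_i` as a complex number. -/
def sgn (ε : Fin n → ℤˣ) (i : Fin n) : ℂ := ((ε i : ℤ) : ℂ)

theorem sgn_eq (ε : Fin n → ℤˣ) (i : Fin n) : ε i = 1 ∧ sgn ε i = 1 ∨ ε i ≠ 1 ∧ sgn ε i = -1 := by
  rcases Int.units_eq_one_or (ε i) with h | h
  · left; simp [sgn, h]
  · right; simp [sgn, h]

theorem sgn_mul_self (ε : Fin n → ℤˣ) (i : Fin n) : sgn ε i * sgn ε i = 1 := by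
  rcases sgn_eq ε i with ⟨-, h⟩ | ⟨-, h⟩ <;> rw [h] <;> ring

theorem sgn_ne_zero (ε : Fin n → ℤˣ) (i : Fin n) : sgn ε i ≠ 0 :=
  left_ne_zero_of_mul_eq_one (sgn_mul_self ε i)

/-- The constant `1 / √2`. -/
def invSqrtTwo : ℂ := ((√2 : ℝ) : ℂ)⁻¹

theorem invSqrtTwo_sq : invSqrtTwo * invSqrtTwo = 1 / 2 := by
  rw [invSqrtTwo, ← mul_inv, ← Complex.ofReal_mul, Real.mul_self_sqrt (by norm_num)]
  norm_num

/-! ### The canonical commutation relations in an algebra -/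

section Canonical

variable {A : Type*} [Ring A] [Algebra ℂ A] {ι : Type*} [DecidableEq ι]

/-- The canonical commutation relations. -/
structure IsCanonical (x p : ι → A) : Prop where
  commute_x : ∀ i j, Commute (x i) (x j)
  commute_p : ∀ i j, Commute (p i) (p j)
  p_mul_x : ∀ i j, p i * x j = x j * p i + (if i = j then -Complex.I else 0) • (1 : A)

namespace IsCanonical

variable {x p : ι → A}

theorem br_linear (h : IsCanonical x p) (a b a' b' : ℂ) (i j : ι) :
    (commutator A).br (a • x i + b • p i) (a' • x j + b' • p j) =
      (if i = j then Complex.I * (a * b' - b * a') else 0) • 1 := by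
  have hxx : (commutator A).br (x i) (x j) = 0 := commutator_br_eq_zero.2 (h.commute_x i j)
  have hpp : (commutator A).br (p i) (p j) = 0 := commutator_br_eq_zero.2 (h.commute_p i j)
  have hpx : ∀ i j, (commutator A).br (p i) (x j) =
      (if i = j then -Complex.I else 0) • 1 := fun i j => by
    rw [commutator_br, h.p_mul_x, add_sub_cancel_left]
  have hxp : (commutator A).br (x i) (p j) = (if i = j then Complex.I else 0) • 1 := by
    rw [Biderivation.skew, hpx]
    by_cases hij : i = j
    · subst hij; simp
    · simp [hij, Ne.symm hij]
  simp only [map_add, map_smul, LinearMap.add_apply, LinearMap.smul_apply, hxx, hpp, hpx, hxp]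
  by_cases hij : i = j
  · simp only [if_pos hij]; module
  · simp only [if_neg hij]; module

theorem isOscillatorSystem (h : IsCanonical x p) {e : ι → ℂ} {w w' : ι → A}
    (hw : ∀ j, w j = invSqrtTwo • x j + (invSqrtTwo * (Complex.I * e j)) • p j)
    (hw' : ∀ j, w' j = invSqrtTwo • x j + (-(invSqrtTwo * (Complex.I * e j))) • p j) :
    IsOscillatorSystem (commutator A) e 1 w w' := by
  have hc := invSqrtTwo_sq
  refine ⟨fun i j => ?_, fun i j => ?_, fun i j => ?_⟩
  · rw [hw, hw, h.br_linear]
    by_cases hij : i = j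
    · subst hij; rw [if_pos rfl]; ring_nf; simp
    · rw [if_neg hij, zero_smul]
  · rw [hw', hw', h.br_linear]
    by_cases hij : i = j
    · subst hij; rw [if_pos rfl]; ring_nf; simp
    · rw [if_neg hij, zero_smul]
  · rw [hw, hw', h.br_linear]
    by_cases hij : i = j
    · subst hij
      rw [if_pos rfl, if_pos rfl]
      congr 1
      linear_combination (-2 * Complex.I ^ 2 * e i) * hc - e i * Complex.I_sq
    · rw [if_neg hij, if_neg hij]

/-- For i ≠ j the reordering of p and x is free, so the quadratic terms cancel and no constant is
left over. This is what makes the symbol of P̂_ij equal to the classical P_ij. -/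
theorem momentum_eq (h : IsCanonical x p) {e : ι → ℂ} {w w' : ι → A}
    (hw : ∀ j, w j = invSqrtTwo • x j + (invSqrtTwo * (Complex.I * e j)) • p j)
    (hw' : ∀ j, w' j = invSqrtTwo • x j + (-(invSqrtTwo * (Complex.I * e j))) • p j)
    {i j : ι} (hij : i ≠ j) :
    Complex.I • (w i * w' j - w j * w' i) = e j • (x i * p j) + (-e i) • (x j * p i) := by
  have h1 : p i * x j = x j * p i := by rw [h.p_mul_x, if_neg hij, zero_smul, add_zero]
  have h2 : p j * x i = x i * p j := by
    rw [h.p_mul_x, if_neg (Ne.symm hij), zero_smul, add_zero]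
  have h3 := (h.commute_p i j).eq
  have h4 := (h.commute_x i j).eq
  have hc := invSqrtTwo_sq
  rw [hw, hw, hw', hw']
  simp only [smul_mul_assoc, mul_smul_comm, add_mul, mul_add, h1, h2, h3, h4]
  match_scalars
  · ring
  · linear_combination (2 * Complex.I ^ 2 * e i) * hc + e i * Complex.I_sq
  · linear_combination (-2 * Complex.I ^ 2 * e j) * hc - e j * Complex.I_sq
  · ring

end IsCanonical

/-- The last axiom holds because [P_kj, P_kl] is a multiple of P_jl for distinct indices, and
because the P_ii vanish in the degenerate cases. -/
theorem IsOscillatorSystem.isAngular {e : ι → ℂ} {w w' : ι → A}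
    (h : IsOscillatorSystem (commutator A) e 1 w w') (P : ι → ι → A)
    (hP : ∀ i j, P i j = Complex.I • (w i * w' j - w j * w' i)) :
    IsAngular (commutator A) e (-Complex.I) P := by
  have hbr := h.br_momentum P hP
  have ha : ∀ i j, P i j = -P j i := fun i j => by rw [hP, hP, ← smul_neg, neg_sub]
  have h0 : ∀ i, P i i = 0 := fun i => by rw [hP, sub_self, smul_zero]
  refine ⟨ha, fun i j k l => ?_, fun j k l => ?_⟩
  · rw [hbr, mul_one]
  · by_cases hkj : k = j
    · subst hkj; rw [h0, zero_mul, mul_zero, sub_zero]; exact Commute.zero_right _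
    by_cases hkl : k = l
    · subst hkl; rw [h0, zero_mul, mul_zero, sub_zero]; exact Commute.zero_right _
    by_cases hjl : j = l
    · subst hjl; rw [h0]; exact Commute.zero_left _
    rw [← commutator_br, hbr, if_neg (Ne.symm hkj), if_neg hkl, if_neg hjl, if_pos rfl, ha l j]
    simp only [zero_smul, zero_add, zero_sub, sub_zero]
    exact (((Commute.refl _).smul_right _).neg_right.smul_right _).neg_left

end Canonical

/-! ### The quantum oscillator system -/

theorem isCanonical_op : IsCanonical (xOp (n := n)) pOp :=
  ⟨xOp_commute, pOp_commute, pOp_mul_xOp⟩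

theorem wOp_eq (ε : Fin n → ℤˣ) (j : Fin n) :
    wOp ε j = invSqrtTwo • xOp j + (invSqrtTwo * (Complex.I * sgn ε j)) • pOp j := by
  have h1 : ∀ {A : Type} [Ring A] [Algebra ℂ A] (a b : A),
      invSqrtTwo • (a + Complex.I • b) = invSqrtTwo • a + (invSqrtTwo * (Complex.I * 1)) • b :=
    fun a b => by module
  have h2 : ∀ {A : Type} [Ring A] [Algebra ℂ A] (a b : A),
      invSqrtTwo • (a - Complex.I • b) = invSqrtTwo • a + (invSqrtTwo * (Complex.I * -1)) • b :=
    fun a b => by module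
  rcases sgn_eq ε j with ⟨h, h'⟩ | ⟨h, h'⟩
  · rw [wOp, if_pos h, h']; exact h1 (A := Op n) (xOp j) (pOp j)
  · rw [wOp, if_neg h, h']; exact h2 (A := Op n) (xOp j) (pOp j)

theorem wStarOp_eq (ε : Fin n → ℤˣ) (j : Fin n) :
    wStarOp ε j = invSqrtTwo • xOp j + (-(invSqrtTwo * (Complex.I * sgn ε j))) • pOp j := by
  have h1 : ∀ {A : Type} [Ring A] [Algebra ℂ A] (a b : A),
      invSqrtTwo • (a + Complex.I • b) = invSqrtTwo • a + (-(invSqrtTwo * (Complex.I * -1))) • b :=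
    fun a b => by module
  have h2 : ∀ {A : Type} [Ring A] [Algebra ℂ A] (a b : A),
      invSqrtTwo • (a - Complex.I • b) = invSqrtTwo • a + (-(invSqrtTwo * (Complex.I * 1))) • b :=
    fun a b => by module
  rcases sgn_eq ε j with ⟨h, h'⟩ | ⟨h, h'⟩
  · rw [wStarOp, if_pos h, h']; exact h2 (A := Op n) (xOp j) (pOp j)
  · rw [wStarOp, if_neg h, h']; exact h1 (A := Op n) (xOp j) (pOp j)

theorem isOscillatorSystem_op (ε : Fin n → ℤˣ) :
    IsOscillatorSystem (commutator (Op n)) (sgn ε) 1 (wOp ε) (wStarOp ε) :=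
  isCanonical_op.isOscillatorSystem (wOp_eq ε) (wStarOp_eq ε)

theorem isAngular_momentumOp (ε : Fin n → ℤˣ) :
    IsAngular (commutator (Op n)) (sgn ε) (-Complex.I) (momentumOp ε) :=
  (isOscillatorSystem_op ε).isAngular _ fun _ _ => rfl

theorem momentumOp_eq (ε : Fin n → ℤˣ) {i j : Fin n} (hij : i ≠ j) :
    momentumOp ε i j = sgn ε j • (xOp i * pOp j) + (-sgn ε i) • (xOp j * pOp i) :=
  isCanonical_op.momentum_eq (wOp_eq ε) (wStarOp_eq ε) hij

/-! ### The Poisson algebra of smooth functions -/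

/-- The algebra of smooth functions on phase space. -/
def smoothPhase (n : ℕ) : Subalgebra ℂ (Phase n → ℂ) where
  carrier := {f | ContDiff ℝ ∞ f}
  mul_mem' := by
    intro f g hf hg
    rw [Set.mem_ofPred_eq] at hf hg ⊢
    exact hf.mul hg
  add_mem' := by
    intro f g hf hg
    rw [Set.mem_ofPred_eq] at hf hg ⊢
    exact hf.add hg
  algebraMap_mem' := by
    intro c
    rw [Set.mem_ofPred_eq]
    exact contDiff_const

theorem mem_smoothPhase {f : Phase n → ℂ} : f ∈ smoothPhase n ↔ ContDiff ℝ ∞ f := Iff.rfl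

theorem smoothPhase_differentiableAt (f : smoothPhase n) (y : Phase n) :
    DifferentiableAt ℝ f.1 y := (mem_smoothPhase.1 f.2).differentiable (by simp) y

/-- The derivative in a fixed direction. -/
def dirDeriv (v : Phase n) : smoothPhase n →ₗ[ℂ] smoothPhase n where
  toFun f := ⟨fun y => fderiv ℝ f.1 y v, mem_smoothPhase.2
    (((mem_smoothPhase.1 f.2).fderiv_right (m := ∞) (by simp)).clm_apply contDiff_const)⟩
  map_add' f g := by
    apply Subtype.ext; funext y
    change fderiv ℝ (f.1 + g.1) y v = _
    rw [fderiv_add (smoothPhase_differentiableAt f y) (smoothPhase_differentiableAt g y)]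
    rfl
  map_smul' c f := by
    apply Subtype.ext; funext y
    change fderiv ℝ (c • f.1) y v = _
    rw [fderiv_const_smul (smoothPhase_differentiableAt f y) c]
    rfl

theorem dirDeriv_mul (v : Phase n) (f g : smoothPhase n) :
    dirDeriv v (f * g) = dirDeriv v f * g + f * dirDeriv v g := by
  apply Subtype.ext; funext y
  change fderiv ℝ (f.1 * g.1) y v = fderiv ℝ f.1 y v * g.1 y + f.1 y * fderiv ℝ g.1 y v
  rw [fderiv_mul (smoothPhase_differentiableAt f y) (smoothPhase_differentiableAt g y)]
  simp only [add_apply, smul_apply, smul_eq_mul]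
  ring

/-- The Poisson bracket given by two families of derivations of a commutative algebra. -/
def poissonOfDerivations {A ι : Type*} [CommRing A] [Algebra ℂ A] [Fintype ι]
    (dp dx : ι → A →ₗ[ℂ] A) (hp : ∀ j f g, dp j (f * g) = dp j f * g + f * dp j g)
    (hx : ∀ j f g, dx j (f * g) = dx j f * g + f * dx j g) : Biderivation A where
  br := ∑ j, ((LinearMap.mul ℂ A).compl₁₂ (dp j) (dx j) -
    (LinearMap.mul ℂ A).compl₁₂ (dx j) (dp j))
  skew f g := by
    simp only [LinearMap.sum_apply, LinearMap.sub_apply, LinearMap.compl₁₂_apply,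
      LinearMap.mul_apply', ← Finset.sum_neg_distrib]
    refine Finset.sum_congr rfl fun j _ => ?_
    ring
  leibniz f g h := by
    simp only [LinearMap.sum_apply, LinearMap.sub_apply, LinearMap.compl₁₂_apply,
      LinearMap.mul_apply', Finset.sum_mul, Finset.mul_sum, ← Finset.sum_add_distrib, hp, hx]
    refine Finset.sum_congr rfl fun j _ => ?_
    ring

theorem poissonOfDerivations_br {A ι : Type*} [CommRing A] [Algebra ℂ A] [Fintype ι]
    (dp dx : ι → A →ₗ[ℂ] A) (hp : ∀ j f g, dp j (f * g) = dp j f * g + f * dp j g)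
    (hx : ∀ j f g, dx j (f * g) = dx j f * g + f * dx j g) (f g : A) :
    (poissonOfDerivations dp dx hp hx).br f g = ∑ j, (dp j f * dx j g - dx j f * dp j g) := by
  simp only [poissonOfDerivations, LinearMap.sum_apply, LinearMap.sub_apply,
    LinearMap.compl₁₂_apply, LinearMap.mul_apply']

/-- The Poisson bracket on smooth functions. -/
def poissonBracket (n : ℕ) : Biderivation (smoothPhase n) :=
  poissonOfDerivations (fun j => dirDeriv (0, Pi.single j 1)) (fun j => dirDeriv (Pi.single j 1, 0))
    (fun _ => dirDeriv_mul _) (fun _ => dirDeriv_mul _)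

theorem poissonBracket_br (f g : smoothPhase n) (y : Phase n) :
    ((poissonBracket n).br f g).1 y = poisson f.1 g.1 y := by
  rw [poissonBracket, poissonOfDerivations_br, AddSubmonoidClass.coe_finsetSum, Finset.sum_apply]
  rfl

/-- The function `a x_j + b p_j`. -/
def linearFun (a b : ℂ) (j : Fin n) : Phase n → ℂ := fun y => a * (y.1 j : ℂ) + b * (y.2 j : ℂ)

theorem linearFun_smooth (a b : ℂ) (j : Fin n) : linearFun a b j ∈ smoothPhase n := by
  rw [mem_smoothPhase]
  unfold linearFun
  have h1 : ContDiff ℝ ∞ fun y : Phase n => ((y.1 j : ℝ) : ℂ) :=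
    Complex.ofRealCLM.contDiff.comp ((contDiff_apply ℝ ℝ j).comp contDiff_fst)
  have h2 : ContDiff ℝ ∞ fun y : Phase n => ((y.2 j : ℝ) : ℂ) :=
    Complex.ofRealCLM.contDiff.comp ((contDiff_apply ℝ ℝ j).comp contDiff_snd)
  fun_prop

theorem fderiv_linearFun (a b : ℂ) (j : Fin n) (y v : Phase n) :
    fderiv ℝ (linearFun a b j) y v = a * (v.1 j : ℂ) + b * (v.2 j : ℂ) := by
  let L : Phase n →L[ℝ] ℂ := a • (Complex.ofRealCLM.comp
      ((ContinuousLinearMap.proj j).comp (ContinuousLinearMap.fst ℝ (Fin n → ℝ) (Fin n → ℝ)))) +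
    b • (Complex.ofRealCLM.comp
      ((ContinuousLinearMap.proj j).comp (ContinuousLinearMap.snd ℝ (Fin n → ℝ) (Fin n → ℝ))))
  have h : linearFun a b j = L := rfl
  rw [h, L.fderiv]
  rfl

theorem br_linearFun (a b a' b' : ℂ) (i j : Fin n) :
    (poissonBracket n).br ⟨linearFun a b i, linearFun_smooth a b i⟩
      ⟨linearFun a' b' j, linearFun_smooth a' b' j⟩ = (if i = j then b * a' - a * b' else 0) • 1 := by
  apply Subtype.ext; funext y
  rw [poissonBracket_br]
  have h1 : ((if i = j then b * a' - a * b' else 0) • (1 : smoothPhase n)).1 y =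
      if i = j then b * a' - a * b' else 0 := mul_one _
  rw [h1]
  simp only [poisson, fderiv_linearFun, Pi.zero_apply, Complex.ofReal_zero, mul_zero, zero_add,
    add_zero, Pi.single_apply]
  rw [Finset.sum_eq_single i]
  · by_cases hij : i = j
    · subst hij; simp
    · simp [hij, Ne.symm hij]
  · intro k _ hk; simp [Ne.symm hk]
  · simp

theorem wFun_eq (ε : Fin n → ℤˣ) (j : Fin n) :
    wFun ε j = linearFun invSqrtTwo (invSqrtTwo * (Complex.I * sgn ε j)) j := by
  funext y
  rcases sgn_eq ε j with ⟨h, h'⟩ | ⟨h, h'⟩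
  · rw [wFun, if_pos h, h', zFun, linearFun, invSqrtTwo]; ring
  · rw [wFun, if_neg h, h', zFun, linearFun, invSqrtTwo]
    simp only [map_div₀, map_add, map_mul, Complex.conj_ofReal, Complex.conj_I]; ring

theorem conj_wFun_eq (ε : Fin n → ℤˣ) (j : Fin n) (y : Phase n) :
    (starRingEnd ℂ) (wFun ε j y) =
      linearFun invSqrtTwo (-(invSqrtTwo * (Complex.I * sgn ε j))) j y := by
  have hs : (starRingEnd ℂ) (sgn ε j) = sgn ε j := by
    rcases sgn_eq ε j with ⟨h, h'⟩ | ⟨h, h'⟩ <;> simp [h']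
  simp only [wFun_eq, linearFun, invSqrtTwo, map_add, map_mul, map_inv₀, Complex.conj_ofReal,
    Complex.conj_I, hs]
  ring

theorem momentum_eq (ε : Fin n → ℤˣ) (i j : Fin n) (y : Phase n) :
    momentum ε i j y = (y.1 i : ℂ) * (sgn ε j * (y.2 j : ℂ)) -
      (y.1 j : ℂ) * (sgn ε i * (y.2 i : ℂ)) := by
  rw [momentum, conj_wFun_eq, conj_wFun_eq, wFun_eq, wFun_eq]
  simp only [linearFun]
  linear_combination (2 * Complex.I ^ 2 * ((y.1 j : ℂ) * (sgn ε i * (y.2 i : ℂ)) -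
    (y.1 i : ℂ) * (sgn ε j * (y.2 j : ℂ)))) * invSqrtTwo_sq + ((y.1 j : ℂ) * (sgn ε i * (y.2 i : ℂ))
    - (y.1 i : ℂ) * (sgn ε j * (y.2 j : ℂ))) * Complex.I_sq

theorem momentum_eq_linearFun (ε : Fin n → ℤˣ) (i j : Fin n) :
    momentum ε i j = Complex.I • (linearFun invSqrtTwo (invSqrtTwo * (Complex.I * sgn ε i)) i *
      linearFun invSqrtTwo (-(invSqrtTwo * (Complex.I * sgn ε j))) j -
      linearFun invSqrtTwo (invSqrtTwo * (Complex.I * sgn ε j)) j *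
      linearFun invSqrtTwo (-(invSqrtTwo * (Complex.I * sgn ε i))) i) := by
  funext y
  rw [momentum, conj_wFun_eq, conj_wFun_eq, wFun_eq, wFun_eq]
  rfl

theorem momentum_smooth (ε : Fin n → ℤˣ) (i j : Fin n) : momentum ε i j ∈ smoothPhase n := by
  rw [momentum_eq_linearFun]
  exact Subalgebra.smul_mem _ (Subalgebra.sub_mem _ (Subalgebra.mul_mem _ (linearFun_smooth _ _ _)
    (linearFun_smooth _ _ _)) (Subalgebra.mul_mem _ (linearFun_smooth _ _ _)
    (linearFun_smooth _ _ _))) _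

/-- The classical momentum `P_ij` as an element of the Poisson algebra. -/
def momentumElem (ε : Fin n → ℤˣ) (i j : Fin n) : smoothPhase n :=
  ⟨momentum ε i j, momentum_smooth ε i j⟩

/-- Classically the oscillator constant is i, so the angular constant is -i·i = 1; in the quantum
case they are 1 and -i. The `commute` axiom is automatic in a commutative algebra. -/
theorem isAngular_momentumElem (ε : Fin n → ℤˣ) :
    IsAngular (poissonBracket n) (sgn ε) 1 (momentumElem ε) := by
  have hc := invSqrtTwo_sq
  have hS : IsOscillatorSystem (poissonBracket n) (sgn ε) Complex.I
      (fun i => ⟨linearFun invSqrtTwo (invSqrtTwo * (Complex.I * sgn ε i)) i,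
        linearFun_smooth _ _ _⟩)
      (fun i => ⟨linearFun invSqrtTwo (-(invSqrtTwo * (Complex.I * sgn ε i))) i,
        linearFun_smooth _ _ _⟩) := by
    refine ⟨fun i j => ?_, fun i j => ?_, fun i j => ?_⟩
    · rw [br_linearFun]
      by_cases hij : i = j
      · subst hij; rw [if_pos rfl]; ring_nf; simp
      · rw [if_neg hij, zero_smul]
    · rw [br_linearFun]
      by_cases hij : i = j
      · subst hij; rw [if_pos rfl]; ring_nf; simp
      · rw [if_neg hij, zero_smul]
    · rw [br_linearFun]
      by_cases hij : i = j
      · subst hij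
        rw [if_pos rfl, if_pos rfl]
        congr 1
        linear_combination (2 * Complex.I * sgn ε i) * hc
      · rw [if_neg hij, if_neg hij]
  have hbr := hS.br_momentum (momentumElem ε) fun i j =>
    Subtype.ext (momentum_eq_linearFun ε i j)
  refine ⟨fun i j => ?_, fun i j k l => ?_, fun j k l => Commute.all _ _⟩
  · apply Subtype.ext; funext y
    change momentum ε i j y = -momentum ε j i y
    rw [momentum_eq, momentum_eq]; ring
  · rw [hbr]
    congr 1
    rw [neg_mul, Complex.I_mul_I, neg_neg]

end

/-! ### From classical involution to commuting operators -/

section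

/-! ### Momenta at special points -/

/-- The minors `x_i y_j - x_j y_i` of a pair of real vectors. -/
def minor {ι : Type*} (x y : ι → ℝ) (i j : ι) : ℂ := (x i : ℂ) * (y j : ℂ) - (x j : ℂ) * (y i : ℂ)

theorem minor_eq_zero_left {ι : Type*} {x y : ι → ℝ} {i : ι} (hx : x i = 0) (hy : y i = 0) (j : ι) :
    minor x y i j = 0 := by simp [minor, hx, hy]

theorem minor_eq_zero_right {ι : Type*} {x y : ι → ℝ} {j : ι} (hx : x j = 0) (hy : y j = 0) (i : ι) :
    minor x y i j = 0 := by simp [minor, hx, hy]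

theorem sum_sum_sum_eq_of_subset {ι : Type*} [Fintype ι] (s : Finset ι) {f : ι → ι → ι → ℂ}
    (h1 : ∀ i j k, i ∉ s → f i j k = 0) (h2 : ∀ i j k, j ∉ s → f i j k = 0)
    (h3 : ∀ i j k, k ∉ s → f i j k = 0) :
    ∑ i, ∑ j, ∑ k, f i j k = ∑ i ∈ s, ∑ j ∈ s, ∑ k ∈ s, f i j k := by
  rw [← Finset.sum_subset (Finset.subset_univ s)]
  · refine Finset.sum_congr rfl fun i _ => ?_
    rw [← Finset.sum_subset (Finset.subset_univ s)]
    · refine Finset.sum_congr rfl fun j _ => ?_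
      rw [← Finset.sum_subset (Finset.subset_univ s)]
      intro k _ hk; exact h3 i j k hk
    · intro j _ hj; exact Finset.sum_eq_zero fun k _ => h2 i j k hj
  · intro i _ hi
    exact Finset.sum_eq_zero fun j _ => Finset.sum_eq_zero fun k _ => h1 i j k hi

section PlaneCoordinates

variable {ι : Type*} [Fintype ι] [DecidableEq ι]

/-- On the pair of basis vectors e_a, e_b only the minors (a,b) and (b,a) survive, with opposite
signs. -/
theorem symm_of_sum_minor_eq_zero {M : ι → ι → ℂ}
    (h : ∀ x y : ι → ℝ, ∑ i, ∑ j, M i j * minor x y i j = 0) (a b : ι) : M a b = M b a := by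
  by_cases hab : a = b
  · rw [hab]
  have h0 := h (Pi.single a 1) (Pi.single b 1)
  have h1 : ∀ i j, M i j * minor (Pi.single a 1) (Pi.single b 1) i j =
      (if i = a then (if j = b then M i j else 0) else 0) -
      (if i = b then (if j = a then M i j else 0) else 0) := by
    intro i j
    simp only [minor, Pi.single_apply]
    split_ifs <;> simp
  simp only [h1, Finset.sum_sub_distrib] at h0
  have h2 : ∀ a b : ι, ∑ i, ∑ j, (if i = a then (if j = b then M i j else 0) else 0) = M a b := by
    intro a b
    rw [Finset.sum_eq_single a]
    · simp
    · intro i _ hi; simp [hi]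
    · simp
  rw [h2, h2] at h0
  exact sub_eq_zero.1 h0

/-- On the pair e_a + e_b, e_c only the minors ac and bc are nonzero, up to order. After `hE`
removes the terms with i = k, the sum is 4 E_abc. -/
theorem eq_zero_of_sum_anti_eq_zero {E : ι → ι → ι → ℂ} (hs : ∀ i k l, E i k l = E k i l)
    (hE : ∀ i l, E i i l = 0)
    (h : ∀ x y : ι → ℝ, ∑ i, ∑ k, ∑ l, E i k l * anti (minor x y) i k l = 0)
    {a b c : ι} (hab : a ≠ b) (hac : a ≠ c) (hbc : b ≠ c) : E a b c = 0 := by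
  have h0 := h (Pi.single a 1 + Pi.single b 1) (Pi.single c 1)
  have hx : ∀ i, i ∉ ({a, b, c} : Finset ι) →
      (Pi.single a 1 + Pi.single b 1 : ι → ℝ) i = 0 ∧ (Pi.single c 1 : ι → ℝ) i = 0 := by
    intro i hi
    simp only [Finset.mem_insert, Finset.mem_singleton, not_or] at hi
    simp [hi.1, hi.2.1, hi.2.2]
  rw [sum_sum_sum_eq_of_subset {a, b, c}] at h0
  · simp only [anti, minor, Pi.add_apply, Finset.sum_insert, Finset.mem_insert,
      Finset.mem_singleton, Finset.sum_singleton, hab, hac, hbc, hab.symm, hac.symm, hbc.symm,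
      or_self, not_false_eq_true, Pi.single_eq_same, Pi.single_eq_of_ne, ne_eq, hE, hs b a c,
      Complex.ofReal_add, Complex.ofReal_one, Complex.ofReal_zero] at h0
    linear_combination h0 / 4
  · intro i k l hi
    simp [anti, minor_eq_zero_left (hx i hi).1 (hx i hi).2]
  · intro i k l hi
    simp [anti, minor_eq_zero_left (hx k hi).1 (hx k hi).2]
  · intro i k l hi
    simp [anti, minor_eq_zero_right (hx l hi).1 (hx l hi).2]

/-- On the pair e_a + e_c, e_b + e_c all three minors of {a, b, c} are ±1 and all others vanish. By
antisymmetry the six orderings contribute equally and add up to a nonzero multiple of F_abc. -/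
theorem eq_zero_of_sum_triangle_eq_zero {F : ι → ι → ι → ℂ} (hl : ∀ i j k, F j i k = -F i j k)
    (hr : ∀ i j k, F i k j = -F i j k)
    (h : ∀ x y : ι → ℝ, ∑ i, ∑ j, ∑ k, F i j k * triangle (minor x y) i j k = 0)
    {a b c : ι} (hab : a ≠ b) (hac : a ≠ c) (hbc : b ≠ c) : F a b c = 0 := by
  have h0 := h (Pi.single a 1 + Pi.single c 1) (Pi.single b 1 + Pi.single c 1)
  have hx : ∀ i, i ∉ ({a, b, c} : Finset ι) →
      (Pi.single a 1 + Pi.single c 1 : ι → ℝ) i = 0 ∧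
      (Pi.single b 1 + Pi.single c 1 : ι → ℝ) i = 0 := by
    intro i hi
    simp only [Finset.mem_insert, Finset.mem_singleton, not_or] at hi
    simp [hi.1, hi.2.1, hi.2.2]
  rw [sum_sum_sum_eq_of_subset {a, b, c}] at h0
  · have e1 := hl a b c
    have e2 := hr a b c
    have e3 := hl a c b
    have e4 := hr b a c
    have e5 := hl b c a
    simp only [triangle, anti, minor, Pi.add_apply, Finset.sum_insert, Finset.mem_insert,
      Finset.mem_singleton, Finset.sum_singleton, hab, hac, hbc, hab.symm, hac.symm, hbc.symm,
      or_self, not_false_eq_true, Pi.single_eq_same, Pi.single_eq_of_ne, ne_eq,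
      Complex.ofReal_add, Complex.ofReal_one, Complex.ofReal_zero, e5, e4, e3, e2, e1] at h0
    ring_nf at h0
    simpa using h0
  · intro i k l hi
    simp [triangle, anti, minor_eq_zero_left (hx i hi).1 (hx i hi).2]
  · intro i k l hi
    simp [triangle, anti, minor_eq_zero_left (hx k hi).1 (hx k hi).2,
      minor_eq_zero_right (hx k hi).1 (hx k hi).2]
  · intro i k l hi
    simp [triangle, anti, minor_eq_zero_right (hx l hi).1 (hx l hi).2]

end PlaneCoordinates

/-! ### Forms in the momenta -/

variable {n u : ℕ}

/-- The value of a form at elements `P_ij` of an algebra. -/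
def MomentumForm.eval {A : Type*} [Ring A] [Algebra ℂ A] {g : Fin n → Fin u} {h : Fin u}
    (P : Fin n → Fin n → A) : MomentumForm (GroupPair g h) → A
  | .linear c => ∑ e, (c e : ℂ) • P e.1.1 e.1.2
  | .squares c => ∑ e, (c e : ℂ) • P e.1.1 e.1.2 ^ 2

theorem MomentumForm.toOp_eq {g : Fin n → Fin u} {h : Fin u} (ε : Fin n → ℤˣ)
    (F : MomentumForm (GroupPair g h)) : F.toOp ε = F.eval (momentumOp ε) := by
  cases F <;> rfl

/-- Evaluation at a point of phase space. -/
def evalAt (y : Phase n) : smoothPhase n →ₐ[ℂ] ℂ :=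
  (Pi.evalAlgHom ℂ (fun _ : Phase n => ℂ) y).comp (smoothPhase n).val

theorem evalAt_apply (y : Phase n) (f : smoothPhase n) : evalAt y f = f.1 y := rfl

theorem MomentumForm.toFun_eq {g : Fin n → Fin u} {h : Fin u} (ε : Fin n → ℤˣ)
    (F : MomentumForm (GroupPair g h)) : F.toFun ε = (F.eval (momentumElem ε)).1 := by
  funext y
  rw [← evalAt_apply]
  cases F <;> simp only [MomentumForm.toFun, MomentumForm.eval, map_sum, map_smul, map_pow] <;> rfl

/-- The point of phase space with coordinates `x_i` and `ε_i p_i = y_i`. -/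
def planePoint (ε : Fin n → ℤˣ) (x y : Fin n → ℝ) : Phase n := (x, fun i => ((ε i : ℤ) : ℝ) * y i)

/-- The signs put into the momenta of `planePoint` cancel those of P_ij, so the test points work for
all ε at once. -/
theorem evalAt_momentumElem (ε : Fin n → ℤˣ) (x y : Fin n → ℝ) (i j : Fin n) :
    evalAt (planePoint ε x y) (momentumElem ε i j) = minor x y i j := by
  rw [evalAt_apply]
  change momentum ε i j _ = _
  rw [momentum_eq, minor]
  have h : ∀ i, sgn ε i * (((planePoint ε x y).2 i : ℝ) : ℂ) = y i := by
    intro i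
    simp only [planePoint, Complex.ofReal_mul, ← mul_assoc]
    have : (((ε i : ℤ) : ℝ) : ℂ) = sgn ε i := by simp [sgn]
    rw [this, sgn_mul_self, one_mul]
  rw [h, h]
  rfl

section Coefficients

variable {g : Fin n → Fin u} {h : Fin u}

/-- The coefficients of a form as an upper triangular matrix. -/
def upperCoeff (c : GroupPair g h → ℝ) (i j : Fin n) : ℂ :=
  if hij : i < j ∧ g i = h ∧ g j = h then (c ⟨(i, j), hij⟩ : ℂ) else 0

/-- The coefficients of a linear form as a skew-symmetric matrix. -/
def skewCoeff (c : GroupPair g h → ℝ) (i j : Fin n) : ℂ := upperCoeff c i j - upperCoeff c j i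

/-- The coefficients of a sum of squares as a symmetric matrix. -/
def symmCoeff (c : GroupPair g h → ℝ) (i j : Fin n) : ℂ := upperCoeff c i j + upperCoeff c j i

theorem skewCoeff_skew (c : GroupPair g h → ℝ) (i j : Fin n) :
    skewCoeff c i j = -skewCoeff c j i := by simp [skewCoeff]

theorem symmCoeff_symm (c : GroupPair g h → ℝ) (i j : Fin n) :
    symmCoeff c i j = symmCoeff c j i := add_comm _ _

theorem sum_groupPair {M : Type*} [AddCommGroup M] [Module ℂ M] (c : GroupPair g h → ℝ)
    (F : Fin n → Fin n → M) :
    ∑ e, (c e : ℂ) • F e.1.1 e.1.2 = ∑ i, ∑ j, upperCoeff c i j • F i j := by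
  rw [← Finset.sum_product', Finset.univ_product_univ]
  have h1 : ∀ x : Fin n × Fin n, upperCoeff c x.1 x.2 • F x.1 x.2 =
      if hx : x.1 < x.2 ∧ g x.1 = h ∧ g x.2 = h then (c ⟨x, hx⟩ : ℂ) • F x.1 x.2 else 0 := by
    intro x
    unfold upperCoeff
    by_cases hx : x.1 < x.2 ∧ g x.1 = h ∧ g x.2 = h
    · rw [dif_pos hx, dif_pos hx]
    · rw [dif_neg hx, dif_neg hx, zero_smul]
  rw [Finset.sum_congr rfl fun x _ => h1 x, Finset.sum_dite, Finset.sum_const_zero, add_zero]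
  symm
  refine Finset.sum_bij (fun x _ => ⟨x.1, (Finset.mem_filter.1 x.2).2⟩) ?_ ?_ ?_ ?_
  · intro a _; exact Finset.mem_univ _
  · intro a _ b _ hab; exact Subtype.ext (congrArg (fun e : GroupPair g h => e.1) hab)
  · intro b _
    exact ⟨⟨b.1, Finset.mem_filter.2 ⟨Finset.mem_univ _, b.2⟩⟩, Finset.mem_univ _, rfl⟩
  · intro a _; rfl

variable {A : Type*} [Ring A] [Algebra ℂ A] {B : Biderivation A} {e : Fin n → ℂ} {κ : ℂ}
  {P : Fin n → Fin n → A}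

/-- Each pair i < j occurs twice in the full double sum, hence the factor 2. -/
theorem two_smul_linear (hP : IsAngular B e κ P) (c : GroupPair g h → ℝ) :
    (2 : ℂ) • (MomentumForm.linear c).eval P = ∑ i, ∑ j, skewCoeff c i j • P i j := by
  rw [MomentumForm.eval, sum_groupPair c P]
  simp only [skewCoeff, sub_smul, Finset.sum_sub_distrib]
  rw [Finset.sum_comm (f := fun i j => upperCoeff c j i • P i j), two_smul, sub_eq_add_neg]
  congr 1
  simp only [← Finset.sum_neg_distrib]
  refine Finset.sum_congr rfl fun i _ => Finset.sum_congr rfl fun j _ => ?_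
  rw [hP.antisymm i j, smul_neg]

theorem two_smul_squares (hP : IsAngular B e κ P) (c : GroupPair g h → ℝ) :
    (2 : ℂ) • (MomentumForm.squares c).eval P = ∑ i, ∑ j, symmCoeff c i j • P i j ^ 2 := by
  rw [MomentumForm.eval, sum_groupPair c fun i j => P i j ^ 2]
  simp only [symmCoeff, add_smul, Finset.sum_add_distrib]
  rw [Finset.sum_comm (f := fun i j => upperCoeff c j i • P i j ^ 2), two_smul]
  congr 1
  refine Finset.sum_congr rfl fun i _ => Finset.sum_congr rfl fun j _ => ?_
  rw [hP.antisymm i j, neg_sq]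

end Coefficients

theorem anti_eq_zero_of_not_distinct {A : Type*} [Ring A] [Algebra ℂ A] {B : Biderivation A}
    {e : Fin n → ℂ} {κ : ℂ} {P : Fin n → Fin n → A} (hP : IsAngular B e κ P) {i k l : Fin n}
    (h : i = l ∨ k = l) : anti P i k l = 0 := by
  rcases h with rfl | rfl <;> simp [anti, hP.self]

theorem triangle_eq_zero_of_not_distinct {A : Type*} [Ring A] [Algebra ℂ A] {B : Biderivation A}
    {e : Fin n → ℂ} {κ : ℂ} {P : Fin n → Fin n → A} (hP : IsAngular B e κ P) {i k l : Fin n}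
    (h : i = k ∨ i = l ∨ k = l) : triangle P i k l = 0 := by
  rcases h with rfl | rfl | rfl <;> simp [triangle, anti, hP.self]

/-- Forms in involution have commuting values in every algebra in which the `P_ij` satisfy the
bracket relations of angular momenta. -/
theorem MomentumForm.br_eval_eq_zero {g : Fin n → Fin u} {h : Fin u} (ε : Fin n → ℤˣ)
    {A : Type*} [Ring A] [Algebra ℂ A] {B : Biderivation A} {κ : ℂ} {P : Fin n → Fin n → A}
    (hP : IsAngular B (sgn ε) κ P) (F G : MomentumForm (GroupPair g h))
    (hFG : (poissonBracket n).br (F.eval (momentumElem ε)) (G.eval (momentumElem ε)) = 0) :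
    B.br (F.eval P) (G.eval P) = 0 := by
  have hM := isAngular_momentumElem ε
  suffices h4 : B.br ((2 : ℂ) • F.eval P) ((2 : ℂ) • G.eval P) = 0 by
    rw [B.br_two_smul] at h4
    exact (smul_eq_zero.1 h4).resolve_left (by norm_num)
  have h4 : (poissonBracket n).br ((2 : ℂ) • F.eval (momentumElem ε))
      ((2 : ℂ) • G.eval (momentumElem ε)) = 0 := by
    rw [Biderivation.br_two_smul, hFG, smul_zero]
  -- The mixed case serves both orders of the two forms, through skew-symmetry of the brackets.
  have key_ls : ∀ c d : GroupPair g h → ℝ, (poissonBracket n).br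
      ((2 : ℂ) • (MomentumForm.linear c).eval (momentumElem ε))
      ((2 : ℂ) • (MomentumForm.squares d).eval (momentumElem ε)) = 0 →
      B.br ((2 : ℂ) • (MomentumForm.linear c).eval P)
        ((2 : ℂ) • (MomentumForm.squares d).eval P) = 0 := by
    intro c d h4
    rw [two_smul_linear hM, two_smul_squares hM,
      hM.linear_br_squares (skewCoeff_skew c) (symmCoeff_symm d)] at h4
    rw [two_smul_linear hP, two_smul_squares hP,
      hP.linear_br_squares (skewCoeff_skew c) (symmCoeff_symm d)]
    -- Evaluation at phase points turns the classical identity into one about minors, which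
    -- determines the coefficients. The same coefficients multiply the noncommutative `anti P i k
    -- l`.
    have hz : ∀ x y : Fin n → ℝ, ∑ i, ∑ k, ∑ l, (skewCoeff c i k *
        (symmCoeff d k l * sgn ε k - symmCoeff d i l * sgn ε i)) * anti (minor x y) i k l = 0 := by
      intro x y
      have h5 := congrArg (evalAt (planePoint ε x y)) h4
      simp only [map_smul, map_sum, map_zero, anti, map_add, map_mul, evalAt_momentumElem,
        smul_eq_mul] at h5
      simpa [anti] using h5
    have hE := @eq_zero_of_sum_anti_eq_zero _ _ _ _ (fun i k l => by
      rw [skewCoeff_skew c i k]; ring) (fun i l => by ring) hz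
    have : ∑ i, ∑ k, ∑ l, (skewCoeff c i k *
        (symmCoeff d k l * sgn ε k - symmCoeff d i l * sgn ε i)) • anti P i k l = 0 := by
      refine Finset.sum_eq_zero fun i _ => Finset.sum_eq_zero fun k _ =>
        Finset.sum_eq_zero fun l _ => ?_
      by_cases hil : i = l
      · rw [anti_eq_zero_of_not_distinct hP (Or.inl hil), smul_zero]
      by_cases hkl : k = l
      · rw [anti_eq_zero_of_not_distinct hP (Or.inr hkl), smul_zero]
      by_cases hik : i = k
      · subst hik; rw [sub_self, mul_zero, zero_smul]
      rw [hE hik hil hkl, zero_smul]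
    rw [this, smul_zero]
  cases F with
  | linear c =>
    cases G with
    | linear d =>
      rw [two_smul_linear hM, two_smul_linear hM,
        hM.linear_br_linear (skewCoeff_skew c) (skewCoeff_skew d)] at h4
      rw [two_smul_linear hP, two_smul_linear hP,
        hP.linear_br_linear (skewCoeff_skew c) (skewCoeff_skew d)]
      have hz : ∀ x y : Fin n → ℝ, ∑ i, ∑ l, (∑ k, skewCoeff c i k * sgn ε k * skewCoeff d k l) *
          minor x y i l = 0 := by
        intro x y
        have h5 := congrArg (evalAt (planePoint ε x y)) h4
        simp only [map_smul, map_sum, map_zero, evalAt_momentumElem, smul_eq_mul] at h5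
        simpa using h5
      -- Symmetric coefficients paired with the antisymmetric P_il give a sum equal to its own
      -- negative.
      have hs := symm_of_sum_minor_eq_zero hz
      have : (2 : ℂ) • ∑ i, ∑ l, (∑ k, skewCoeff c i k * sgn ε k * skewCoeff d k l) • P i l = 0 := by
        rw [two_smul]
        nth_rw 2 [Finset.sum_comm]
        simp only [← Finset.sum_add_distrib]
        refine Finset.sum_eq_zero fun i _ => Finset.sum_eq_zero fun l _ => ?_
        rw [hs l i, hP.antisymm l i, smul_neg, add_neg_cancel]
      rw [(smul_eq_zero.1 this).resolve_left two_ne_zero, smul_zero]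
    | squares d => exact key_ls c d h4
  | squares c =>
    cases G with
    | linear d =>
      rw [Biderivation.skew] at h4 ⊢
      rw [key_ls d c (neg_eq_zero.1 h4), neg_zero]
    | squares d =>
      rw [two_smul_squares hM, two_smul_squares hM,
        hM.squares_br_squares (symmCoeff_symm c) (symmCoeff_symm d)] at h4
      rw [two_smul_squares hP, two_smul_squares hP,
        hP.squares_br_squares (symmCoeff_symm c) (symmCoeff_symm d)]
      have h4' := (smul_eq_zero.1 h4).resolve_left (by norm_num)
      -- Only the alternating part of the coefficients is determined by the classical identity, so
      -- both brackets are put in alternated form before comparison.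
      have h6 := congrArg (fun t => (6 : ℂ) • t) h4'
      simp only [smul_zero] at h6
      rw [hM.sum_triangle fun k l j => symmCoeff d k l * symmCoeff c l j * sgn ε l] at h6
      have hz : ∀ x y : Fin n → ℝ, ∑ i, ∑ k, ∑ l, alternate (fun k l j => symmCoeff d k l *
          symmCoeff c l j * sgn ε l) i k l * triangle (minor x y) i k l = 0 := by
        intro x y
        have h5 := congrArg (evalAt (planePoint ε x y)) h6
        simpa only [map_smul, map_sum, map_zero, triangle, anti, map_add, map_mul,
          evalAt_momentumElem, smul_eq_mul] using h5
      have hE := @eq_zero_of_sum_triangle_eq_zero _ _ _ _ (fun i j k => by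
        simp only [alternate]; ring) (fun i j k => by simp only [alternate]; ring) hz
      have : (6 : ℂ) • ∑ k, ∑ l, ∑ j, (symmCoeff d k l * symmCoeff c l j * sgn ε l) •
          triangle P k l j = 0 := by
        rw [hP.sum_triangle fun k l j => symmCoeff d k l * symmCoeff c l j * sgn ε l]
        refine Finset.sum_eq_zero fun i _ => Finset.sum_eq_zero fun k _ =>
          Finset.sum_eq_zero fun l _ => ?_
        by_cases hik : i = k
        · rw [triangle_eq_zero_of_not_distinct hP (Or.inl hik), smul_zero]
        by_cases hil : i = l
        · rw [triangle_eq_zero_of_not_distinct hP (Or.inr (Or.inl hil)), smul_zero]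
        by_cases hkl : k = l
        · rw [triangle_eq_zero_of_not_distinct hP (Or.inr (Or.inr hkl)), smul_zero]
        rw [hE hik hil hkl, zero_smul]
      rw [(smul_eq_zero.1 this).resolve_left (by norm_num), smul_zero]

theorem MomentumForm.commute_toOp {g : Fin n → Fin u} {h : Fin u} (ε : Fin n → ℤˣ)
    (F G : MomentumForm (GroupPair g h)) (hFG : poisson (F.toFun ε) (G.toFun ε) = 0) :
    Commute (F.toOp ε) (G.toOp ε) := by
  rw [F.toOp_eq, G.toOp_eq]
  refine commutator_br_eq_zero.1
    (F.br_eval_eq_zero ε (isAngular_momentumOp ε) G (Subtype.ext (funext fun y => ?_)))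
  rw [poissonBracket_br, ← F.toFun_eq, ← G.toFun_eq, hFG]
  rfl

end

/-! ### Commutation of the Ĵ_r, the Im R̂_m and the forms, by counting weights -/

section

variable {n u : ℕ}

/-! ### Weights of the resonant products -/

section Weights

variable {A : Type*} [Ring A] [Algebra ℂ A]

/-- `W_h^a` if `a ≥ 0`, and `(W_h')^{-a}` if `a < 0`. -/
def omegaGen (W W' : Fin u → A) (h : Fin u) (a : ℤ) : A :=
  if 0 ≤ a then W h ^ a.toNat else W' h ^ (-a).toNat

/-- The difference of the product of the `W_h^{m_h}` and of its conjugate, divided by `2i`. -/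
def imGen (W W' : Fin u → A) (m : Fin u → ℤ) : A :=
  (1 / (2 * Complex.I)) • ((List.ofFn fun h => omegaGen W W' h (m h)).prod -
    (List.ofFn fun h => omegaGen W W' h (-m h)).reverse.prod)

namespace Biderivation

variable (B : Biderivation A)

/-- The bracket with D is a derivation, so its eigenvalues add under products; weight zero means
commuting with D. -/
theorem br_mul_weight {D a b : A} {μ ν : ℂ} (ha : B.br D a = μ • a) (hb : B.br D b = ν • b) :
    B.br D (a * b) = (μ + ν) • (a * b) := by
  rw [B.leibniz, ha, hb, smul_mul_assoc, mul_smul_comm, add_smul]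

theorem br_pow_weight {D a : A} {μ : ℂ} (ha : B.br D a = μ • a) (k : ℕ) :
    B.br D (a ^ k) = (k * μ) • a ^ k := by
  induction k with
  | zero => simp [B.br_one]
  | succ k ih =>
    rw [pow_succ, B.br_mul_weight ih ha]
    congr 1; push_cast; ring

theorem br_list_prod_weight {D : A} {ι : Type*} {f : ι → A} {μ : ι → ℂ}
    (hf : ∀ i, B.br D (f i) = μ i • f i) (l : List ι) :
    B.br D (l.map f).prod = (l.map μ).sum • (l.map f).prod := by
  induction l with
  | nil => simp [B.br_one]
  | cons i l ih =>
    rw [List.map_cons, List.map_cons, List.prod_cons, List.sum_cons]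
    exact B.br_mul_weight (hf i) ih

theorem br_omegaGen {D : A} {W W' : Fin u → A} {ν : Fin u → ℂ}
    (hW : ∀ h, B.br D (W h) = (-ν h) • W h) (hW' : ∀ h, B.br D (W' h) = ν h • W' h)
    (h : Fin u) (a : ℤ) : B.br D (omegaGen W W' h a) = (-(ν h * a)) • omegaGen W W' h a := by
  unfold omegaGen
  split_ifs with ha
  · rw [B.br_pow_weight (hW h)]
    congr 1
    have : ((a.toNat : ℤ) : ℂ) = a := by rw [Int.toNat_of_nonneg ha]
    rw [← this]; push_cast; ring
  · rw [B.br_pow_weight (hW' h)]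
    congr 1
    have : (((-a).toNat : ℤ) : ℂ) = -a := by rw [Int.toNat_of_nonneg (by omega)]; push_cast; rfl
    rw [← neg_neg (a : ℂ), ← this]; push_cast; ring

end Biderivation

/-- The resonant product has weight -∑ ν_h m_h and its conjugate the opposite weight. When this sum
vanishes, D commutes with each of the two separately, whatever the order of the factors. -/
theorem commute_imGen {D : A} {W W' : Fin u → A} {ν : Fin u → ℂ}
    (hW : ∀ h, (commutator A).br D (W h) = (-ν h) • W h)
    (hW' : ∀ h, (commutator A).br D (W' h) = ν h • W' h)
    {m : Fin u → ℤ} (hm : ∑ h, ν h * m h = 0) : Commute D (imGen W W' m) := by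
  have h1 := (commutator A).br_list_prod_weight
    (fun h => (commutator A).br_omegaGen hW hW' h (m h)) (List.finRange u)
  have h2 := (commutator A).br_list_prod_weight
    (fun h => (commutator A).br_omegaGen hW hW' h (-m h)) (List.finRange u).reverse
  rw [List.map_reverse, List.map_reverse, List.sum_reverse] at h2
  simp only [← List.ofFn_eq_map, List.sum_ofFn] at h1 h2
  rw [Finset.sum_neg_distrib, hm, neg_zero, zero_smul] at h1
  have h3 : ∑ h, -(ν h * ((-m h : ℤ) : ℂ)) = 0 := by
    rw [← hm]; refine Finset.sum_congr rfl fun h _ => ?_; push_cast; ring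
  rw [h3, zero_smul] at h2
  exact ((commutator_br_eq_zero.1 h1).sub_right (commutator_br_eq_zero.1 h2)).smul_right _

variable {x p w w' : Fin n → A} {e : Fin n → ℂ}

theorem IsCanonical.br_action_linear (h : IsCanonical x p) (i j : Fin n) (a b : ℂ) :
    (commutator A).br ((1 / 2 : ℂ) • (x i ^ 2 + p i ^ 2)) (a • x j + b • p j) =
      if i = j then Complex.I • (b • x i - a • p i) else 0 := by
  have h1 := h.br_linear 1 0 a b i j
  have h2 := h.br_linear 0 1 a b i j
  rw [one_smul, zero_smul, add_zero] at h1
  rw [one_smul, zero_smul, zero_add] at h2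
  have h3 : ∀ q, (commutator A).br ((1 / 2 : ℂ) • (x i ^ 2 + p i ^ 2)) q = (1 / 2 : ℂ) •
      ((commutator A).br (x i) q * x i + x i * (commutator A).br (x i) q +
      ((commutator A).br (p i) q * p i + p i * (commutator A).br (p i) q)) := by
    intro q
    rw [pow_two, pow_two, ← Biderivation.leibniz_left, ← Biderivation.leibniz_left]
    simp only [map_smul, map_add, LinearMap.smul_apply, LinearMap.add_apply]
  rw [h3, h1, h2]
  by_cases hij : i = j
  · subst hij
    simp only [if_true]
    simp only [smul_mul_assoc, mul_smul_comm, one_mul, mul_one]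
    module
  · simp [hij]

/-- The sum `∑_h r_h K_h`, where `K_h` is the sum of `e_i (x_i² + p_i²) / 2` over the group `h`. -/
def jGen (x p : Fin n → A) (e : Fin n → ℂ) (g : Fin n → Fin u) (r : Fin u → ℤ) : A :=
  ∑ h, (r h : ℂ) • ∑ i with g i = h, e i • ((1 / 2 : ℂ) • (x i ^ 2 + p i ^ 2))

theorem IsCanonical.br_jGen (h : IsCanonical x p) (g : Fin n → Fin u) (r : Fin u → ℤ) (j : Fin n)
    (a b : ℂ) : (commutator A).br (jGen x p e g r) (a • x j + b • p j) =
      ((r (g j) : ℂ) * e j) • (Complex.I • (b • x j - a • p j)) := by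
  simp only [jGen, map_sum, map_smul, LinearMap.sum_apply, LinearMap.smul_apply]
  have h1 : ∀ i, (commutator A).br ((1 / 2 : ℂ) • (x i ^ 2 + p i ^ 2)) (a • x j + b • p j) =
      if i = j then Complex.I • (b • x i - a • p i) else 0 := fun i => h.br_action_linear i j a b
  simp only [map_smul, LinearMap.smul_apply] at h1
  simp only [h1, Finset.sum_filter]
  rw [Finset.sum_eq_single (g j)]
  · rw [Finset.sum_eq_single j]
    · rw [if_pos rfl, if_pos rfl, smul_smul]
    · intro i _ hi; simp [hi]
    · simp
  · intro k _ hk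
    rw [Finset.sum_eq_zero, smul_zero]
    intro i _
    by_cases hij : i = j
    · subst hij; rw [if_neg (Ne.symm hk)]
    · simp [hij]
  · simp

/-- The sign of the frequency enters once through K_h and once through the choice of w_j, and e_j² =
1. The weight thus depends on the group only. -/
theorem IsCanonical.br_jGen_w (h : IsCanonical x p) (he : ∀ i, e i * e i = 1)
    (hw : ∀ j, w j = invSqrtTwo • x j + (invSqrtTwo * (Complex.I * e j)) • p j)
    (g : Fin n → Fin u) (r : Fin u → ℤ) (j : Fin n) :
    (commutator A).br (jGen x p e g r) (w j) = (-(r (g j) : ℂ)) • w j := by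
  rw [hw, h.br_jGen]
  match_scalars
  · linear_combination ((r (g j) : ℂ) * invSqrtTwo * Complex.I ^ 2) * he j +
      (r (g j) : ℂ) * invSqrtTwo * Complex.I_sq
  · ring

theorem IsCanonical.br_jGen_w' (h : IsCanonical x p) (he : ∀ i, e i * e i = 1)
    (hw' : ∀ j, w' j = invSqrtTwo • x j + (-(invSqrtTwo * (Complex.I * e j))) • p j)
    (g : Fin n → Fin u) (r : Fin u → ℤ) (j : Fin n) :
    (commutator A).br (jGen x p e g r) (w' j) = (r (g j) : ℂ) • w' j := by
  rw [hw', h.br_jGen]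
  match_scalars
  · linear_combination (-(r (g j) : ℂ) * invSqrtTwo * Complex.I ^ 2) * he j -
      (r (g j) : ℂ) * invSqrtTwo * Complex.I_sq
  · ring

theorem br_sum_sq_weight {D : A} {v : Fin n → A} {g : Fin n → Fin u} {ν : Fin u → ℂ}
    (hv : ∀ j, (commutator A).br D (v j) = ν (g j) • v j) (h : Fin u) :
    (commutator A).br D (∑ i with g i = h, e i • v i ^ 2) =
      (2 * ν h) • ∑ i with g i = h, e i • v i ^ 2 := by
  rw [map_sum, Finset.smul_sum]
  refine Finset.sum_congr rfl fun i hi => ?_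
  rw [map_smul, Biderivation.br_pow_weight _ (hv i) 2, (Finset.mem_filter.1 hi).2, smul_comm]
  simp

theorem IsCanonical.commute_jGen (h : IsCanonical x p) (g : Fin n → Fin u) (r r' : Fin u → ℤ) :
    Commute (jGen x p e g r) (jGen x p e g r') := by
  have h0 : ∀ i j, Commute ((1 / 2 : ℂ) • (x i ^ 2 + p i ^ 2))
      ((1 / 2 : ℂ) • (x j ^ 2 + p j ^ 2)) := by
    intro i j
    by_cases hij : i = j
    · subst hij; exact Commute.refl _
    have hpx : ∀ i j, i ≠ j → Commute (p i) (x j) := fun i j hij => by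
      change p i * x j = x j * p i
      rw [h.p_mul_x, if_neg hij, zero_smul, add_zero]
    refine Commute.smul_left (Commute.smul_right ?_ _) _
    exact (((h.commute_x i j).pow_pow 2 2).add_right
      ((hpx j i (Ne.symm hij)).symm.pow_pow 2 2)).add_left
      (((hpx i j hij).pow_pow 2 2).add_right ((h.commute_p i j).pow_pow 2 2))
  unfold jGen
  refine Commute.sum_left _ _ _ fun a _ => Commute.sum_right _ _ _ fun b _ =>
    Commute.smul_left (Commute.smul_right ?_ _) _
  exact Commute.sum_left _ _ _ fun i _ => Commute.sum_right _ _ _ fun j _ =>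
    Commute.smul_left (Commute.smul_right (h0 i j) _) _

/-- Each term of P_ij pairs a w with a w^* of opposite weight, so P_ij has weight zero. -/
theorem commute_momentum_of_weight {D : A} {P : Fin n → Fin n → A}
    (hP : ∀ i j, P i j = Complex.I • (w i * w' j - w j * w' i)) {i j : Fin n} {μ : ℂ}
    (hi : (commutator A).br D (w i) = (-μ) • w i) (hj : (commutator A).br D (w j) = (-μ) • w j)
    (hi' : (commutator A).br D (w' i) = μ • w' i) (hj' : (commutator A).br D (w' j) = μ • w' j) :
    Commute D (P i j) := by
  have h1 := (commutator A).br_mul_weight hi hj'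
  have h2 := (commutator A).br_mul_weight hj hi'
  rw [neg_add_cancel, zero_smul] at h1 h2
  rw [hP]
  exact ((commutator_br_eq_zero.1 h1).sub_right (commutator_br_eq_zero.1 h2)).smul_right _

/-- P_ij acts as an infinitesimal rotation mixing w_i and w_j, and ∑ e_a w_a² is its invariant
quadratic form: the terms a = i and a = j cancel. As i and j share a group, either both terms occur
in the sum or neither does. -/
theorem IsOscillatorSystem.br_momentum_sum_sq (h : IsOscillatorSystem (commutator A) e 1 w w')
    (he : ∀ i, e i * e i = 1) {P : Fin n → Fin n → A}
    (hP : ∀ i j, P i j = Complex.I • (w i * w' j - w j * w' i)) {g : Fin n → Fin u} {i j : Fin n}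
    (hg : g i = g j) (k : Fin u) :
    (commutator A).br (P i j) (∑ a with g a = k, e a • w a ^ 2) = 0 ∧
    (commutator A).br (P i j) (∑ a with g a = k, e a • w' a ^ 2) = 0 := by
  have hd : ∀ a b, (commutator A).br (w' a) (w b) = (if a = b then -e a else 0) • 1 := by
    intro a b
    rw [Biderivation.skew, h.br]
    by_cases hab : a = b
    · subst hab; simp
    · simp [hab, Ne.symm hab]
  have hw : ∀ a, (commutator A).br (P i j) (e a • w a ^ 2) =
      (if i = a then Complex.I else 0) • (w j * w i + w i * w j) -
      (if j = a then Complex.I else 0) • (w j * w i + w i * w j) := by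
    intro a
    have h1 : (commutator A).br (P i j) (w a) =
        (if i = a then Complex.I * e a else 0) • w j -
        (if j = a then Complex.I * e a else 0) • w i := by
      rw [hP, map_smul, LinearMap.smul_apply, map_sub, LinearMap.sub_apply,
        Biderivation.leibniz_left, Biderivation.leibniz_left, h.br_self, h.br_self, hd, hd]
      by_cases h1 : i = a <;> by_cases h2 : j = a <;> simp [h1, h2, smul_smul]
    rw [map_smul, pow_two, Biderivation.leibniz, h1]
    have ha := he a
    have hz : ∀ (q : A), (e a * (Complex.I * e a)) • q = Complex.I • q := fun q => by
      congr 1; linear_combination Complex.I * ha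
    by_cases h1 : i = a
    · by_cases h2 : j = a
      · subst h1; subst h2; simp
      · subst h1; simp [h2, smul_smul, hz]
    · by_cases h2 : j = a
      · subst h2; simp [h1, smul_smul, hz, smul_add]
      · simp [h1, h2]
  have hw' : ∀ a, (commutator A).br (P i j) (e a • w' a ^ 2) =
      (if i = a then Complex.I else 0) • (w' j * w' i + w' i * w' j) -
      (if j = a then Complex.I else 0) • (w' j * w' i + w' i * w' j) := by
    intro a
    have h1 : (commutator A).br (P i j) (w' a) =
        (if i = a then Complex.I * e a else 0) • w' j -
        (if j = a then Complex.I * e a else 0) • w' i := by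
      rw [hP, map_smul, LinearMap.smul_apply, map_sub, LinearMap.sub_apply,
        Biderivation.leibniz_left, Biderivation.leibniz_left, h.br_star, h.br_star, h.br, h.br]
      by_cases h1 : i = a <;> by_cases h2 : j = a <;> simp [h1, h2, smul_smul]
    rw [map_smul, pow_two, Biderivation.leibniz, h1]
    have ha := he a
    have hz : ∀ (q : A), (e a * (Complex.I * e a)) • q = Complex.I • q := fun q => by
      congr 1; linear_combination Complex.I * ha
    by_cases h1 : i = a
    · by_cases h2 : j = a
      · subst h1; subst h2; simp
      · subst h1; simp [h2, smul_smul, hz]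
    · by_cases h2 : j = a
      · subst h2; simp [h1, smul_smul, hz, smul_add]
      · simp [h1, h2]
  have hs : ∀ (q : A), ∑ a with g a = k, ((if i = a then Complex.I else 0) • q -
      (if j = a then Complex.I else 0) • q) = 0 := by
    intro q
    rw [← Finset.sum_congr rfl fun a _ => sub_smul _ _ q, ← Finset.sum_smul,
      Finset.sum_sub_distrib, Finset.sum_ite_eq, Finset.sum_ite_eq]
    simp [hg]
  constructor
  · rw [map_sum, Finset.sum_congr rfl fun a _ => hw a, hs]
  · rw [map_sum, Finset.sum_congr rfl fun a _ => hw' a, hs]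

theorem MomentumForm.commute_eval {g : Fin n → Fin u} {h : Fin u} {P : Fin n → Fin n → A} {D : A}
    (hD : ∀ i j, g i = h → g j = h → Commute D (P i j)) (F : MomentumForm (GroupPair g h)) :
    Commute D (F.eval P) := by
  cases F with
  | linear c =>
    exact Commute.sum_right _ _ _ fun e _ => (hD _ _ e.2.2.1 e.2.2.2).smul_right _
  | squares c =>
    exact Commute.sum_right _ _ _ fun e _ => ((hD _ _ e.2.2.1 e.2.2.2).pow_right 2).smul_right _

theorem IsAngular.commute_of_disjoint {P : Fin n → Fin n → A} {κ : ℂ}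
    (hP : IsAngular (commutator A) e κ P) {i j k l : Fin n} (hik : i ≠ k) (hil : i ≠ l)
    (hjk : j ≠ k) (hjl : j ≠ l) : Commute (P i j) (P k l) := by
  rw [← commutator_br_eq_zero, hP.br]
  simp [hik, hil, hjk, hjl]

end Weights

/-! ### Commutation of the quantum operators -/

theorem commute_jOp_jOp (g : Fin n → Fin u) (ε : Fin n → ℤˣ) (r r' : Fin u → ℤ) :
    Commute (jOp g ε r) (jOp g ε r') := isCanonical_op.commute_jGen g r r'

theorem br_jOp_wOp (g : Fin n → Fin u) (ε : Fin n → ℤˣ) (r : Fin u → ℤ) (j : Fin n) :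
    (commutator (Op n)).br (jOp g ε r) (wOp ε j) = (-(r (g j) : ℂ)) • wOp ε j :=
  isCanonical_op.br_jGen_w (sgn_mul_self ε) (wOp_eq ε) g r j

theorem br_jOp_wStarOp (g : Fin n → Fin u) (ε : Fin n → ℤˣ) (r : Fin u → ℤ) (j : Fin n) :
    (commutator (Op n)).br (jOp g ε r) (wStarOp ε j) = (r (g j) : ℂ) • wStarOp ε j :=
  isCanonical_op.br_jGen_w' (sgn_mul_self ε) (wStarOp_eq ε) g r j

theorem commute_jOp_imROp (g : Fin n → Fin u) (ε : Fin n → ℤˣ) {r m : Fin u → ℤ}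
    (hrm : ∑ h, r h * m h = 0) : Commute (jOp g ε r) (imROp g ε m) := by
  -- Ŵ_h is quadratic in the ŵ_i of its group, so its weight is twice theirs and the total weight is
  -- proportional to r · m.
  refine commute_imGen (A := Op n) (ν := fun h => 2 * (r h : ℂ)) (fun h => ?_) (fun h => ?_) ?_
  · have := br_sum_sq_weight (e := sgn ε) (ν := fun h => -(r h : ℂ)) (br_jOp_wOp g ε r) h
    rw [mul_neg] at this
    exact this
  · exact br_sum_sq_weight (e := sgn ε) (ν := fun h => (r h : ℂ)) (br_jOp_wStarOp g ε r) h
  · have h2 : ((∑ h, r h * m h : ℤ) : ℂ) = 0 := by rw [hrm, Int.cast_zero]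
    push_cast at h2
    simp only [mul_assoc, ← Finset.mul_sum, h2, mul_zero]

theorem commute_jOp_momentumOp (g : Fin n → Fin u) (ε : Fin n → ℤˣ) (r : Fin u → ℤ) {i j : Fin n}
    (hg : g i = g j) : Commute (jOp g ε r) (momentumOp ε i j) := by
  refine commute_momentum_of_weight (μ := (r (g i) : ℂ)) (fun _ _ => rfl) (br_jOp_wOp g ε r i) ?_
    (br_jOp_wStarOp g ε r i) ?_
  · rw [hg]; exact br_jOp_wOp g ε r j
  · rw [hg]; exact br_jOp_wStarOp g ε r j

theorem commute_momentumOp_imROp (g : Fin n → Fin u) (ε : Fin n → ℤˣ) (m : Fin u → ℤ) {i j : Fin n}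
    (hg : g i = g j) : Commute (momentumOp ε i j) (imROp g ε m) := by
  have h0 := fun k => (isOscillatorSystem_op ε).br_momentum_sum_sq (sgn_mul_self ε)
    (P := momentumOp ε) (fun _ _ => rfl) hg k
  refine commute_imGen (A := Op n) (ν := fun _ => 0) (fun h => ?_) (fun h => ?_) (by simp)
  · rw [neg_zero, zero_smul]; exact (h0 h).1
  · rw [zero_smul]; exact (h0 h).2

theorem commute_jOp_toOp {g : Fin n → Fin u} (ε : Fin n → ℤˣ) (r : Fin u → ℤ) {h : Fin u}
    (F : MomentumForm (GroupPair g h)) : Commute (jOp g ε r) (F.toOp ε) := by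
  rw [F.toOp_eq]
  exact F.commute_eval fun i j hi hj => commute_jOp_momentumOp g ε r (hi.trans hj.symm)

theorem commute_toOp_imROp {g : Fin n → Fin u} (ε : Fin n → ℤˣ) (m : Fin u → ℤ) {h : Fin u}
    (F : MomentumForm (GroupPair g h)) : Commute (F.toOp ε) (imROp g ε m) := by
  rw [F.toOp_eq]
  exact (F.commute_eval fun i j hi hj =>
    (commute_momentumOp_imROp g ε m (hi.trans hj.symm)).symm).symm

theorem commute_toOp_toOp_of_ne {g : Fin n → Fin u} (ε : Fin n → ℤˣ) {h h' : Fin u} (hh : h ≠ h')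
    (F : MomentumForm (GroupPair g h)) (G : MomentumForm (GroupPair g h')) :
    Commute (F.toOp ε) (G.toOp ε) := by
  rw [F.toOp_eq, G.toOp_eq]
  refine G.commute_eval fun k l hk hl => (F.commute_eval fun i j hi hj => ?_).symm
  have hne : ∀ a b : Fin n, g a = h → g b = h' → b ≠ a := fun a b ha hb hab =>
    hh (by rw [← ha, ← hb, hab])
  exact (isAngular_momentumOp ε).commute_of_disjoint (hne i k hi hk) (hne j k hj hk)
    (hne i l hi hl) (hne j l hj hl)

end

/-! ### Main parts of the quantum operators -/

section

variable {n u : ℕ}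

/-! ### Symbols of the quantum operators -/

theorem hasSymbol_xOp (j : Fin n) : HasSymbol 0 (xOp j) fun y => ((y.1 j : ℝ) : ℂ) := by
  convert HasSymbol.mulOp_mul_pPow (coord j) 0 (d := 0) (by simp) using 1
  · rw [pPow_zero, mul_one, xOp]
  · funext y; simp [monomialSymbol, coord]

theorem hasSymbol_one : HasSymbol 0 (1 : Op n) 1 := by
  have h1 : mulOp (⟨fun _ => 1, mem_smooth.2 contDiff_const⟩ : Smooth n) = 1 :=
    op_ext fun f x => one_mul _
  convert HasSymbol.mulOp_mul_pPow (⟨fun _ => 1, mem_smooth.2 contDiff_const⟩ : Smooth n) 0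
    (d := 0) (by simp) using 1
  · rw [h1, pPow_zero, one_mul]
  · funext y; simp [monomialSymbol]

theorem hasSymbol_pOp (j : Fin n) : HasSymbol 1 (pOp j) fun y => ((y.2 j : ℝ) : ℂ) := by
  have h := hasSymbol_one.pOp_mul j
  rwa [mul_one, mul_one] at h

theorem HasSymbol.congr {d d' : ℤ} {A : Op n} {σ σ' : Phase n → ℂ} (h : HasSymbol d A σ)
    (hd : d = d') (hσ : ∀ y, σ y = σ' y) : HasSymbol d' A σ' := by
  rw [← hd, ← (funext hσ : σ = σ')]; exact h

theorem hasSymbol_momentumOp (ε : Fin n → ℤˣ) {i j : Fin n} (hij : i ≠ j) :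
    HasSymbol 1 (momentumOp ε i j) (momentum ε i j) := by
  rw [momentumOp_eq ε hij]
  refine ((((hasSymbol_xOp i).mul (hasSymbol_pOp j)).smul _).add
    (((hasSymbol_xOp j).mul (hasSymbol_pOp i)).smul _)).congr (by norm_num) fun y => ?_
  rw [momentum_eq]
  simp only [Pi.add_apply, Pi.smul_apply, Pi.mul_apply, smul_eq_mul]
  ring

theorem MomentumForm.exists_hasSymbol {g : Fin n → Fin u} {h : Fin u} (ε : Fin n → ℤˣ)
    (F : MomentumForm (GroupPair g h)) : ∃ d, HasSymbol d (F.toOp ε) (F.toFun ε) := by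
  have h1 : ∀ e : GroupPair g h, HasSymbol 1 (momentumOp ε e.1.1 e.1.2)
      (momentum ε e.1.1 e.1.2) := fun e => hasSymbol_momentumOp ε e.2.1.ne
  cases F with
  | linear c =>
    refine ⟨1, (HasSymbol.sum Finset.univ fun e _ => (h1 e).smul (c e : ℂ)).congr rfl fun y => ?_⟩
    simp [MomentumForm.toFun]
  | squares c =>
    refine ⟨2, (HasSymbol.sum Finset.univ (A := fun e => (c e : ℂ) • momentumOp ε e.1.1 e.1.2 ^ 2)
      (σ := fun e => (c e : ℂ) • (momentum ε e.1.1 e.1.2 * momentum ε e.1.1 e.1.2))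
      fun e _ => ?_).congr rfl fun y => ?_⟩
    · rw [pow_two]
      exact ((h1 e).mul (h1 e)).smul (c e : ℂ)
    · simp [MomentumForm.toFun, pow_two]

/-- The function `∑ ε_i p_i²`, the sum being over the group `h`. -/
def kineticFun (g : Fin n → Fin u) (ε : Fin n → ℤˣ) (h : Fin u) : Phase n → ℂ :=
  fun y => ∑ i with g i = h, sgn ε i * ((y.2 i : ℝ) : ℂ) ^ 2

/-- The function `∑ x_i p_i`, the sum being over the group `h`. -/
def dilationFun (g : Fin n → Fin u) (h : Fin u) : Phase n → ℂ :=
  fun y => ∑ i with g i = h, ((y.1 i : ℝ) : ℂ) * ((y.2 i : ℝ) : ℂ)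

/-- The main part of `Ĵ_r`. -/
def jSymbol (g : Fin n → Fin u) (ε : Fin n → ℤˣ) (r : Fin u → ℤ) : Phase n → ℂ :=
  fun y => ∑ h, (r h : ℂ) * (1 / 2 * kineticFun g ε h y)

theorem hasSymbol_jOp (g : Fin n → Fin u) (ε : Fin n → ℤˣ) (r : Fin u → ℤ) :
    HasSymbol 2 (jOp g ε r) (jSymbol g ε r) := by
  have hx : ∀ i : Fin n, HasSymbol 2 (xOp i ^ 2) 0 := fun i => by
    rw [pow_two]
    exact ((hasSymbol_xOp i).mul (hasSymbol_xOp i)).of_lt (by norm_num)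
  have hp : ∀ i : Fin n, HasSymbol 2 (pOp i ^ 2) fun y => ((y.2 i : ℝ) : ℂ) ^ 2 := fun i => by
    rw [pow_two]
    exact ((hasSymbol_pOp i).mul (hasSymbol_pOp i)).congr (by norm_num) fun y => by
      simp only [Pi.mul_apply, pow_two]
  refine (HasSymbol.sum Finset.univ fun h _ => (HasSymbol.sum (Finset.univ.filter fun i => g i = h)
    fun i _ => (((hx i).add (hp i)).smul (1 / 2)).smul (sgn ε i)).smul (r h : ℂ)).congr rfl
      fun y => ?_
  simp only [Finset.sum_apply, Pi.smul_apply, zero_add, smul_eq_mul, jSymbol,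
    kineticFun, Finset.mul_sum]
  refine Finset.sum_congr rfl fun h _ => Finset.sum_congr rfl fun i _ => ?_
  ring

/-! ### Two-term expansions -/

/-- `A` is the sum of `t` and of an operator of order at most `N - 1`, where `t` has order at most
`N`; the functions `τ` and `δ` are their homogeneous parts of degrees `N` and `N - 1`. -/
def HasExpansion (N : ℤ) (A t : Op n) (τ δ : Phase n → ℂ) : Prop :=
  HasSymbol N t τ ∧ ∃ B, A = t + B ∧ HasSymbol (N - 1) B δ

namespace HasExpansion

variable {N M : ℤ} {A t A' t' : Op n} {τ δ τ' δ' : Phase n → ℂ}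

theorem one : HasExpansion 0 (1 : Op n) 1 1 0 :=
  ⟨hasSymbol_one, 0, (add_zero _).symm, HasSymbol.zero _⟩

theorem mul (h : HasExpansion N A t τ δ) (h' : HasExpansion M A' t' τ' δ') :
    HasExpansion (N + M) (A * A') (t * t') (τ * τ') (τ * δ' + δ * τ') := by
  obtain ⟨ht, B, rfl, hB⟩ := h
  obtain ⟨ht', B', rfl, hB'⟩ := h'
  refine ⟨ht.mul ht', t * B' + B * t' + B * B', ?_, ?_⟩
  · rw [add_mul, mul_add, mul_add]; abel
  · rw [← add_zero (τ * δ' + δ * τ')]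
    refine (HasSymbol.add ?_ ?_).add ((hB.mul hB').of_lt (by omega))
    · exact (ht.mul hB').congr (by ring) fun _ => rfl
    · exact (hB.mul ht').congr (by ring) fun _ => rfl

theorem sum {ι : Type*} (s : Finset ι) {A t : ι → Op n} {τ δ : ι → Phase n → ℂ}
    (h : ∀ i ∈ s, HasExpansion N (A i) (t i) (τ i) (δ i)) :
    HasExpansion N (∑ i ∈ s, A i) (∑ i ∈ s, t i) (∑ i ∈ s, τ i) (∑ i ∈ s, δ i) := by
  classical
  induction s using Finset.induction_on with
  | empty => exact ⟨HasSymbol.zero _, 0, (add_zero _).symm, HasSymbol.zero _⟩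
  | insert a s ha ih =>
    obtain ⟨h1, B, hB, h2⟩ := ih fun i hi => h i (Finset.mem_insert_of_mem hi)
    obtain ⟨h1', B', hB', h2'⟩ := h a (Finset.mem_insert_self a s)
    rw [Finset.sum_insert ha, Finset.sum_insert ha, Finset.sum_insert ha, Finset.sum_insert ha]
    refine ⟨h1'.add h1, B' + B, ?_, h2'.add h2⟩
    rw [hB, hB']; abel

/-- To next order A^k behaves as (τ + δ)^k truncated after the term linear in δ. For k = 0 the
truncated exponent k - 1 is harmless because of the factor k. -/
theorem pow (h : HasExpansion N A t τ δ) (k : ℕ) :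
    HasExpansion (k * N) (A ^ k) (t ^ k) (τ ^ k) ((k : ℂ) • (τ ^ (k - 1) * δ)) := by
  induction k with
  | zero => simpa using one
  | succ k ih =>
    have h1 := h.mul ih
    have h2 : τ * ((k : ℂ) • (τ ^ (k - 1) * δ)) + δ * τ ^ k =
        ((k + 1 : ℕ) : ℂ) • (τ ^ (k + 1 - 1) * δ) := by
      funext y
      simp only [Pi.add_apply, Pi.mul_apply, Pi.smul_apply, Pi.pow_apply, smul_eq_mul]
      cases k with
      | zero => simp
      | succ k =>
        simp only [Nat.add_sub_cancel, pow_succ]; push_cast; ring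
    rw [h2, ← pow_succ', ← pow_succ', ← pow_succ'] at h1
    have h3 : N + k * N = ((k + 1 : ℕ) : ℤ) * N := by push_cast; ring
    rwa [h3] at h1

/-- The operators keep the order of the list, whereas the two symbols do not depend on it. This lets
R̂_m and its reversed conjugate be compared. -/
theorem list_prod {ι : Type*} [DecidableEq ι] {N : ι → ℤ} {A t : ι → Op n} {τ δ : ι → Phase n → ℂ}
    (h : ∀ i, HasExpansion (N i) (A i) (t i) (τ i) (δ i)) (l : List ι) (hl : l.Nodup) :
    HasExpansion (∑ i ∈ l.toFinset, N i) (l.map A).prod (l.map t).prod (∏ i ∈ l.toFinset, τ i)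
      (∑ i ∈ l.toFinset, δ i * ∏ k ∈ l.toFinset.erase i, τ k) := by
  induction l with
  | nil => simpa using one
  | cons a l ih =>
    rw [List.nodup_cons] at hl
    have ha : a ∉ l.toFinset := by simpa using hl.1
    have h1 := (h a).mul (ih hl.2)
    rw [List.map_cons, List.map_cons, List.prod_cons, List.prod_cons, List.toFinset_cons,
      Finset.sum_insert ha, Finset.prod_insert ha, Finset.sum_insert ha, Finset.erase_insert ha]
    have h2 : τ a * ∑ i ∈ l.toFinset, δ i * ∏ k ∈ l.toFinset.erase i, τ k =
        ∑ i ∈ l.toFinset, δ i * ∏ k ∈ (insert a l.toFinset).erase i, τ k := by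
      rw [Finset.mul_sum]
      refine Finset.sum_congr rfl fun i hi => ?_
      have hai : a ≠ i := fun h => ha (h ▸ hi)
      rw [Finset.erase_insert_of_ne hai, Finset.prod_insert fun h => ha (Finset.mem_of_mem_erase h)]
      ring
    rw [h2, add_comm (∑ i ∈ l.toFinset, _)] at h1
    exact h1

end HasExpansion

/-- The squares of w and of w^* share the p̂² term and have opposite x̂ p̂ terms; the remainder has
order 0. Hence Ŵ_h and Ŵ_h^* differ to leading order by the dilation ∑ x_i p_i. -/
theorem IsCanonical.smul_sq {A : Type*} [Ring A] [Algebra ℂ A] {x p : Fin n → A}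
    (h : IsCanonical x p) (j : Fin n) {e : ℂ} (he : e * e = 1) :
    e • (invSqrtTwo • x j + (invSqrtTwo * (Complex.I * e)) • p j) ^ 2 =
      (-(1 / 2) * e) • p j ^ 2 + (Complex.I • (x j * p j) +
        ((e / 2) • x j ^ 2 + (1 / 2 : ℂ) • 1)) ∧
    e • (invSqrtTwo • x j + (-(invSqrtTwo * (Complex.I * e))) • p j) ^ 2 =
      (-(1 / 2) * e) • p j ^ 2 + ((-Complex.I) • (x j * p j) +
        ((e / 2) • x j ^ 2 + (-(1 / 2) : ℂ) • 1)) := by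
  have hc := invSqrtTwo_sq
  have hI := Complex.I_mul_I
  have hpx := h.p_mul_x j j
  rw [if_pos rfl] at hpx
  constructor
  · simp only [pow_two, add_mul, mul_add, smul_mul_assoc, mul_smul_comm, hpx, smul_add, smul_smul]
    match_scalars <;> grind
  · simp only [pow_two, add_mul, mul_add, smul_mul_assoc, mul_smul_comm, hpx, smul_add, smul_smul]
    match_scalars <;> grind

/-- The kinetic part of `Ŵ_h`. -/
def kineticOp (g : Fin n → Fin u) (ε : Fin n → ℤˣ) (h : Fin u) : Op n :=
  ∑ i with g i = h, (-(1 / 2) * sgn ε i) • pOp i ^ 2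

theorem kineticOp_commute (g : Fin n → Fin u) (ε : Fin n → ℤˣ) (h h' : Fin u) :
    Commute (kineticOp g ε h) (kineticOp g ε h') :=
  Commute.sum_left _ _ _ fun i _ => Commute.sum_right _ _ _ fun j _ =>
    Commute.smul_left (Commute.smul_right ((pOp_commute i j).pow_pow 2 2) _) _

theorem hasExpansion_bigW (g : Fin n → Fin u) (ε : Fin n → ℤˣ) (h : Fin u) :
    HasExpansion 2 (bigWOp g ε h) (kineticOp g ε h) ((-(1 / 2) : ℂ) • kineticFun g ε h)
      (Complex.I • dilationFun g h) ∧
    HasExpansion 2 (bigWStarOp g ε h) (kineticOp g ε h) ((-(1 / 2) : ℂ) • kineticFun g ε h)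
      ((-Complex.I) • dilationFun g h) := by
  have hp : ∀ i : Fin n, HasSymbol 2 ((-(1 / 2) * sgn ε i) • pOp i ^ 2)
      ((-(1 / 2) * sgn ε i) • fun y => ((y.2 i : ℝ) : ℂ) ^ 2) := fun i => by
    refine HasSymbol.smul _ ?_
    rw [pow_two]
    exact ((hasSymbol_pOp i).mul (hasSymbol_pOp i)).congr (by norm_num) fun y => by
      simp only [Pi.mul_apply, pow_two]
  have hx : ∀ (i : Fin n) (c : ℂ), HasSymbol 1 ((sgn ε i / 2) • xOp i ^ 2 + c • 1) 0 := by
    intro i c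
    rw [pow_two, ← add_zero (0 : Phase n → ℂ)]
    exact ((((hasSymbol_xOp i).mul (hasSymbol_xOp i)).smul _).of_lt (by norm_num)).add
      ((hasSymbol_one.smul c).of_lt (by norm_num))
  have hxp : ∀ (i : Fin n) (c : ℂ), HasSymbol 1 (c • (xOp i * pOp i))
      (c • fun y => ((y.1 i : ℝ) : ℂ) * ((y.2 i : ℝ) : ℂ)) := fun i c =>
    (((hasSymbol_xOp i).mul (hasSymbol_pOp i)).smul c).congr (by norm_num) fun y => rfl
  have hk : ∑ i with g i = h, ((-(1 / 2) * sgn ε i) • fun y : Phase n => ((y.2 i : ℝ) : ℂ) ^ 2) =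
      (-(1 / 2) : ℂ) • kineticFun g ε h := by
    funext y
    simp only [Finset.sum_apply, Pi.smul_apply, smul_eq_mul, kineticFun, Finset.mul_sum, mul_assoc]
  have hd : ∀ c : ℂ, ∑ i with g i = h, (c • fun y : Phase n => ((y.1 i : ℝ) : ℂ) *
      ((y.2 i : ℝ) : ℂ)) = c • dilationFun g h := by
    intro c
    funext y
    simp only [Finset.sum_apply, Pi.smul_apply, smul_eq_mul, dilationFun, Finset.mul_sum]
  constructor
  · rw [← hk, ← hd]
    have heq := fun i => (isCanonical_op (n := n).smul_sq i (sgn_mul_self ε i)).1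
    simp only [← wOp_eq] at heq
    refine HasExpansion.sum _ fun i _ => ⟨hp i, _, heq i, ?_⟩
    exact ((hxp i _).add (hx i _)).congr (by norm_num) fun y => add_zero _
  · rw [← hk, ← hd]
    have heq := fun i => (isCanonical_op (n := n).smul_sq i (sgn_mul_self ε i)).2
    simp only [← wStarOp_eq] at heq
    refine HasExpansion.sum _ fun i _ => ⟨hp i, _, heq i, ?_⟩
    exact ((hxp i _).add (hx i _)).congr (by norm_num) fun y => add_zero _

/-- For a < 0 the factor -i from Ŵ_h^* and the multiplicity -a combine to a·i, so one formula covers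
both signs of a. -/
theorem hasExpansion_omegaOp (g : Fin n → Fin u) (ε : Fin n → ℤˣ) (h : Fin u) (a : ℤ) :
    HasExpansion ((a.natAbs : ℤ) * 2) (omegaOp g ε h a) (kineticOp g ε h ^ a.natAbs)
      (((-(1 / 2) : ℂ) • kineticFun g ε h) ^ a.natAbs)
      (((a : ℂ) * Complex.I) •
        (((-(1 / 2) : ℂ) • kineticFun g ε h) ^ (a.natAbs - 1) * dilationFun g h)) := by
  obtain ⟨h1, h2⟩ := hasExpansion_bigW g ε h
  unfold omegaOp
  split_ifs with ha
  · obtain ⟨k, rfl⟩ := Int.eq_ofNat_of_zero_le ha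
    have h3 := h1.pow k
    rw [mul_smul_comm, smul_smul] at h3
    simpa only [Int.natAbs_natCast, Int.toNat_natCast, Int.cast_natCast] using h3
  · obtain ⟨k, hk⟩ := Int.eq_ofNat_of_zero_le (show 0 ≤ -a by omega)
    obtain rfl : a = -(k : ℤ) := by omega
    have h3 : (- -(k : ℤ)).toNat = k := by simp
    have h4 : (-(k : ℤ)).natAbs = k := by simp
    rw [h3, h4]
    have h5 := h2.pow k
    rw [mul_smul_comm, smul_smul] at h5
    rw [Int.cast_neg, Int.cast_natCast, neg_mul, ← mul_neg]
    exact h5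

/-- The main part of `Im R̂_m`. -/
def imSymbol (g : Fin n → Fin u) (ε : Fin n → ℤˣ) (m : Fin u → ℤ) : Phase n → ℂ :=
  fun y => ∑ h, (m h : ℂ) * dilationFun g h y *
    ((-(1 / 2) * kineticFun g ε h y) ^ ((m h).natAbs - 1) *
      ∏ k ∈ Finset.univ.erase h, (-(1 / 2) * kineticFun g ε k y) ^ (m k).natAbs)

theorem smul_add_sub_add {A : Type*} [Ring A] [Algebra ℂ A] (t b c : A) (d : ℂ) :
    d • ((t + b) - (t + c)) = d • b + (-d) • c := by
  rw [add_sub_add_left_eq_sub, smul_sub, neg_smul, sub_eq_add_neg]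

/-- The leading operators of R̂_m and R̂_m^* coincide and cancel. Their next symbols are opposite,
so dividing the difference by 2i leaves one copy without the factor i, of degree 2 ∑ |m_h| - 1. -/
theorem hasSymbol_imROp (g : Fin n → Fin u) (ε : Fin n → ℤˣ) (m : Fin u → ℤ) :
    ∃ d, HasSymbol d (imROp g ε m) (imSymbol g ε m) := by
  obtain ⟨-, b, hb, hsb⟩ := HasExpansion.list_prod (fun h => hasExpansion_omegaOp g ε h (m h))
    (List.finRange u) (List.nodup_finRange u)
  obtain ⟨-, c, hc, hsc⟩ := HasExpansion.list_prod (fun h => hasExpansion_omegaOp g ε h (-m h))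
    (List.finRange u).reverse (List.nodup_reverse.2 (List.nodup_finRange u))
  -- Equality of the leading symbols would not suffice, since a difference of order one less would
  -- spoil the main part. Here the leading operators are polynomials in the p̂_i alone, so reversing
  -- the product changes nothing.
  have ht : ((List.finRange u).reverse.map fun h => kineticOp g ε h ^ (-m h).natAbs).prod =
      ((List.finRange u).map fun h => kineticOp g ε h ^ (m h).natAbs).prod := by
    simp only [Int.natAbs_neg]
    refine List.Perm.prod_eq' ((List.reverse_perm _).map _) ?_
    rw [List.pairwise_map]
    exact List.pairwise_of_forall fun i j => (kineticOp_commute g ε i j).pow_pow _ _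
  rw [ht] at hc
  simp only [List.toFinset_reverse, List.toFinset_finRange, Int.natAbs_neg] at hsb hsc
  refine ⟨∑ h, ((m h).natAbs : ℤ) * 2 - 1, ?_⟩
  have hR : imROp g ε m = (1 / (2 * Complex.I)) • b + (-(1 / (2 * Complex.I))) • c := by
    have h1 : rOp g ε m = ((List.finRange u).map fun h => omegaOp g ε h (m h)).prod := by
      rw [rOp, List.ofFn_eq_map]
    have h2 : rStarOp g ε m = ((List.finRange u).reverse.map fun h => omegaOp g ε h (-m h)).prod := by
      rw [rStarOp, List.ofFn_eq_map, List.map_reverse]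
    rw [imROp, h1, h2, hb, hc]
    exact smul_add_sub_add (A := Op n) _ _ _ _
  rw [hR]
  refine ((hsb.smul _).add (hsc.smul _)).congr rfl fun y => ?_
  simp only [Pi.add_apply, Pi.smul_apply, Finset.sum_apply, Pi.mul_apply, Finset.prod_apply,
    Pi.pow_apply, smul_eq_mul, imSymbol]
  rw [Finset.mul_sum, Finset.mul_sum, ← Finset.sum_add_distrib]
  refine Finset.sum_congr rfl fun h _ => ?_
  have hI := Complex.I_ne_zero
  push_cast
  field_simp
  ring

end

/-! ### Functional independence of the main parts -/

section

variable {n u : ℕ}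

/-! ### Open dense sets -/

theorem contDiff_position (k : WithTop ℕ∞) (i : Fin n) :
    ContDiff ℝ k fun y : Phase n => ((y.1 i : ℝ) : ℂ) :=
  Complex.ofRealCLM.contDiff.comp ((contDiff_apply ℝ ℝ i).comp contDiff_fst)

theorem contDiff_momentum (k : WithTop ℕ∞) (i : Fin n) :
    ContDiff ℝ k fun y : Phase n => ((y.2 i : ℝ) : ℂ) :=
  Complex.ofRealCLM.contDiff.comp ((contDiff_apply ℝ ℝ i).comp contDiff_snd)

/-- Identity theorem: a real analytic function on a connected space that vanishes on an open set
vanishes identically. -/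
theorem isOpen_dense_ne_zero {f : Phase n → ℂ} (hf : ContDiff ℝ ω f) {y : Phase n} (hy : f y ≠ 0) :
    IsOpen {y | f y ≠ 0} ∧ Dense {y | f y ≠ 0} := by
  refine ⟨isOpen_ne_fun hf.continuous continuous_const, ?_⟩
  rw [show {y | f y ≠ 0} = {y | f y = 0}ᶜ from rfl, ← interior_eq_empty_iff_dense_compl]
  by_contra hne
  obtain ⟨z, hz⟩ := Set.nonempty_iff_ne_empty.2 hne
  have ha : AnalyticOnNhd ℝ f Set.univ := contDiff_omega_iff_analyticOnNhd.1 hf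
  have hev : f =ᶠ[nhds z] 0 := Filter.mem_of_superset (mem_interior_iff_mem_nhds.1 hz) fun w hw => hw
  exact hy (ha.eqOn_of_preconnected_of_eventuallyEq (analyticOnNhd_const (v := (0 : ℂ)))
    isPreconnected_univ (Set.mem_univ z) hev (Set.mem_univ y))

theorem isOpen_dense_iInter {ι : Type*} [Finite ι] {U : ι → Set (Phase n)} (ho : ∀ i, IsOpen (U i))
    (hd : ∀ i, Dense (U i)) : IsOpen (⋂ i, U i) ∧ Dense (⋂ i, U i) :=
  ⟨isOpen_iInter_of_finite ho, dense_iInter_of_isOpen ho hd⟩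

/-! ### Directional derivatives -/

theorem fderiv_apply_eq_of_hasDerivAt {f : Phase n → ℂ} (hf : Differentiable ℝ f) {y v : Phase n}
    {φ : ℝ → ℂ} {c : ℂ} (hφ : ∀ t : ℝ, f (y + t • v) = φ t) (hc : HasDerivAt φ c 0) :
    fderiv ℝ f y v = c := by
  have h1 : HasDerivAt (fun t : ℝ => f (y + t • v)) (fderiv ℝ f y v) 0 := by
    have h2 : HasFDerivAt f (fderiv ℝ f y) (y + (0 : ℝ) • v) := by
      rw [zero_smul, add_zero]; exact (hf y).hasFDerivAt
    have h3 : HasDerivAt (fun t : ℝ => y + t • v) v 0 := by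
      simpa using ((hasDerivAt_id (0 : ℝ)).smul_const v).const_add y
    exact h2.comp_hasDerivAt 0 h3
  rw [funext hφ] at h1
  exact h1.unique hc

theorem fderiv_apply_eq_zero {f : Phase n → ℂ} (hf : Differentiable ℝ f) {y v : Phase n}
    (h : ∀ t : ℝ, f (y + t • v) = f y) : fderiv ℝ f y v = 0 :=
  fderiv_apply_eq_of_hasDerivAt hf h (hasDerivAt_const 0 _)

/-- The part of a vector that belongs to the group `h`. -/
def groupPart (g : Fin n → Fin u) (h : Fin u) (v : Phase n) : Phase n :=
  (fun i => if g i = h then v.1 i else 0, fun i => if g i = h then v.2 i else 0)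

theorem sum_groupPart (g : Fin n → Fin u) (v : Phase n) : ∑ h, groupPart g h v = v := by
  refine Prod.ext (funext fun i => ?_) (funext fun i => ?_)
  · rw [Prod.fst_sum, Finset.sum_apply]; simp [groupPart]
  · rw [Prod.snd_sum, Finset.sum_apply]; simp [groupPart]

/-- The vector at `y` that shears the positions of the group `h` along the momenta. -/
def shear (g : Fin n → Fin u) (ε : Fin n → ℤˣ) (h : Fin u) (y : Phase n) : Phase n :=
  groupPart g h (fun i => ((ε i : ℤ) : ℝ) * y.2 i, 0)

/-- The vector at `y` that dilates the positions and contracts the momenta of the group `h`. -/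
def squeeze (g : Fin n → Fin u) (h : Fin u) (y : Phase n) : Phase n :=
  groupPart g h (y.1, -y.2)

theorem MomentumForm.differentiable {g : Fin n → Fin u} {h : Fin u} (ε : Fin n → ℤˣ)
    (F : MomentumForm (GroupPair g h)) : Differentiable ℝ (F.toFun ε) := by
  rw [F.toFun_eq]
  exact fun y => smoothPhase_differentiableAt _ y

/-- The effect on a form of multiplying all momenta by `s`. -/
theorem MomentumForm.toFun_scale {g : Fin n → Fin u} {h : Fin u} (ε : Fin n → ℤˣ)
    (F : MomentumForm (GroupPair g h)) : ∃ d : ℕ, ∀ (y y' : Phase n) (s : ℂ),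
      (∀ i j, g i = h → g j = h → momentum ε i j y' = s * momentum ε i j y) →
      F.toFun ε y' = s ^ d * F.toFun ε y := by
  cases F with
  | linear c =>
    refine ⟨1, fun y y' s hs => ?_⟩
    simp only [MomentumForm.toFun, Finset.mul_sum]
    refine Finset.sum_congr rfl fun e _ => ?_
    rw [hs _ _ e.2.2.1 e.2.2.2]; ring
  | squares c =>
    refine ⟨2, fun y y' s hs => ?_⟩
    simp only [MomentumForm.toFun, Finset.mul_sum]
    refine Finset.sum_congr rfl fun e _ => ?_
    rw [hs _ _ e.2.2.1 e.2.2.2]; ring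

theorem MomentumForm.toFun_congr {g : Fin n → Fin u} {h : Fin u} (ε : Fin n → ℤˣ)
    (F : MomentumForm (GroupPair g h)) {y y' : Phase n}
    (hs : ∀ i j, g i = h → g j = h → momentum ε i j y' = momentum ε i j y) :
    F.toFun ε y' = F.toFun ε y := by
  obtain ⟨d, hd⟩ := F.toFun_scale ε
  rw [hd y y' 1 fun i j hi hj => by rw [one_mul]; exact hs i j hi hj, one_pow, one_mul]

theorem MomentumForm.fderiv_groupPart_of_ne {g : Fin n → Fin u} {h h' : Fin u} (hh : h ≠ h')
    (ε : Fin n → ℤˣ) (F : MomentumForm (GroupPair g h)) (y v : Phase n) :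
    fderiv ℝ (F.toFun ε) y (groupPart g h' v) = 0 := by
  refine fderiv_apply_eq_zero (F.differentiable ε) fun t => F.toFun_congr ε fun i j hi hj => ?_
  simp [momentum_eq, groupPart, hi, hj, hh]

theorem MomentumForm.fderiv_groupPart {g : Fin n → Fin u} {h : Fin u} (ε : Fin n → ℤˣ)
    (F : MomentumForm (GroupPair g h)) (y v : Phase n) :
    fderiv ℝ (F.toFun ε) y (groupPart g h v) = fderiv ℝ (F.toFun ε) y v := by
  conv_rhs => rw [← sum_groupPart g v, map_sum]
  rw [Finset.sum_eq_single h]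
  · intro k _ hk; exact F.fderiv_groupPart_of_ne (Ne.symm hk) ε y v
  · simp

theorem ofReal_sign (ε : Fin n → ℤˣ) (i : Fin n) : ((((ε i : ℤ) : ℝ)) : ℂ) = sgn ε i := by
  simp [sgn]

/-- Under x_i ↦ x_i + t ε_i p_i both terms of P_ij change by t ε_i ε_j p_i p_j, so P_ij is fixed. -/
theorem MomentumForm.fderiv_shear {g : Fin n → Fin u} {h : Fin u} (ε : Fin n → ℤˣ)
    (F : MomentumForm (GroupPair g h)) (h' : Fin u) (y : Phase n) :
    fderiv ℝ (F.toFun ε) y (shear g ε h' y) = 0 := by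
  by_cases hh : h = h'
  · subst hh
    refine fderiv_apply_eq_zero (F.differentiable ε) fun t => F.toFun_congr ε fun i j hi hj => ?_
    simp only [momentum_eq, shear, groupPart, Prod.fst_add, Prod.snd_add, Prod.smul_fst,
      Prod.smul_snd, Pi.add_apply, Pi.smul_apply, hi, hj, if_true, smul_eq_mul, Pi.zero_apply,
      Complex.ofReal_add, Complex.ofReal_mul, ofReal_sign, mul_zero, add_zero]
    ring
  · exact F.fderiv_groupPart_of_ne hh ε y _

/-- Scaling x by 1 + t and p by 1 - t multiplies each P_ij by 1 - t², which is stationary at t = 0.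
-/
theorem MomentumForm.fderiv_squeeze {g : Fin n → Fin u} {h : Fin u} (ε : Fin n → ℤˣ)
    (F : MomentumForm (GroupPair g h)) (h' : Fin u) (y : Phase n) :
    fderiv ℝ (F.toFun ε) y (squeeze g h' y) = 0 := by
  by_cases hh : h = h'
  · subst hh
    obtain ⟨d, hd⟩ := F.toFun_scale ε
    refine fderiv_apply_eq_of_hasDerivAt (F.differentiable ε)
      (φ := fun t : ℝ => (1 - (t : ℂ) ^ 2) ^ d * F.toFun ε y) (fun t => hd y _ _ fun i j hi hj => ?_) ?_
    · simp only [momentum_eq, squeeze, groupPart, Prod.fst_add, Prod.snd_add, Prod.smul_fst,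
        Prod.smul_snd, Pi.add_apply, Pi.smul_apply, hi, hj, if_true, smul_eq_mul, Pi.neg_apply,
        Complex.ofReal_add, Complex.ofReal_mul, Complex.ofReal_neg]
      ring
    · have h1 : HasDerivAt (fun t : ℝ => (t : ℂ)) 1 0 := Complex.ofRealCLM.hasDerivAt
      refine ((((h1.fun_pow 2).const_sub 1).fun_pow d).mul_const (F.toFun ε y)).congr_deriv ?_
      simp
  · exact F.fderiv_groupPart_of_ne hh ε y _

theorem contDiff_kineticFun (k : WithTop ℕ∞) (g : Fin n → Fin u) (ε : Fin n → ℤˣ) (h : Fin u) :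
    ContDiff ℝ k (kineticFun g ε h) :=
  ContDiff.sum fun i _ => contDiff_const.mul ((contDiff_momentum k i).pow 2)

theorem contDiff_dilationFun (k : WithTop ℕ∞) (g : Fin n → Fin u) (h : Fin u) :
    ContDiff ℝ k (dilationFun (n := n) g h) :=
  ContDiff.sum fun i _ => (contDiff_position k i).mul (contDiff_momentum k i)

theorem differentiable_jSymbol (g : Fin n → Fin u) (ε : Fin n → ℤˣ) (r : Fin u → ℤ) :
    Differentiable ℝ (jSymbol g ε r) := by
  refine ContDiff.differentiable (n := 1) (ContDiff.sum fun h _ => ?_) (by simp)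
  exact contDiff_const.mul (contDiff_const.mul (contDiff_kineticFun 1 g ε h))

theorem differentiable_imSymbol (g : Fin n → Fin u) (ε : Fin n → ℤˣ) (m : Fin u → ℤ) :
    Differentiable ℝ (imSymbol g ε m) := by
  refine ContDiff.differentiable (n := 1) (ContDiff.sum fun h _ => ?_) (by simp)
  refine (contDiff_const.mul (contDiff_dilationFun 1 g h)).mul (ContDiff.mul ?_ ?_)
  · exact (contDiff_const.mul (contDiff_kineticFun 1 g ε h)).pow _
  · exact contDiff_prod fun k _ => (contDiff_const.mul (contDiff_kineticFun 1 g ε k)).pow _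

theorem kineticFun_shear (g : Fin n → Fin u) (ε : Fin n → ℤˣ) (h h' : Fin u) (y : Phase n) (t : ℝ) :
    kineticFun g ε h (y + t • shear g ε h' y) = kineticFun g ε h y := by
  simp [kineticFun, shear, groupPart]

theorem dilationFun_shear (g : Fin n → Fin u) (ε : Fin n → ℤˣ) (h h' : Fin u) (y : Phase n)
    (t : ℝ) : dilationFun g h (y + t • shear g ε h' y) =
      dilationFun g h y + t * if h = h' then kineticFun g ε h y else 0 := by
  by_cases hh : h = h'
  · subst hh
    rw [if_pos rfl]
    simp only [kineticFun, dilationFun, Finset.mul_sum]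
    rw [← Finset.sum_add_distrib]
    refine Finset.sum_congr rfl fun i hi => ?_
    simp only [shear, groupPart, Prod.fst_add, Prod.snd_add, Prod.smul_fst,
      Prod.smul_snd, Pi.add_apply, Pi.smul_apply, (Finset.mem_filter.1 hi).2, if_true, smul_eq_mul,
      Pi.zero_apply, Complex.ofReal_add, Complex.ofReal_mul, ofReal_sign, mul_zero, add_zero]
    ring
  · rw [if_neg hh, mul_zero, add_zero]
    refine Finset.sum_congr rfl fun i hi => ?_
    simp [shear, groupPart, (Finset.mem_filter.1 hi).2, hh]

theorem fderiv_jSymbol_shear (g : Fin n → Fin u) (ε : Fin n → ℤˣ) (r : Fin u → ℤ) (h : Fin u)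
    (y : Phase n) : fderiv ℝ (jSymbol g ε r) y (shear g ε h y) = 0 :=
  fderiv_apply_eq_zero (differentiable_jSymbol g ε r) fun t => by
    simp only [jSymbol, kineticFun_shear]

/-- The shear fixes all T_k and moves D_h at the rate T_h = -2·(-T_h/2). The factor -T_h/2 restores
the missing power, so the result is m_h times a product independent of h. -/
theorem fderiv_imSymbol_shear (g : Fin n → Fin u) (ε : Fin n → ℤˣ) (m : Fin u → ℤ) (h : Fin u)
    (y : Phase n) : fderiv ℝ (imSymbol g ε m) y (shear g ε h y) =
      -2 * (∏ k, (-(1 / 2) * kineticFun g ε k y) ^ (m k).natAbs) * m h := by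
  refine fderiv_apply_eq_of_hasDerivAt (differentiable_imSymbol g ε m)
    (φ := fun t : ℝ => imSymbol g ε m y +
      t * (-2 * (∏ k, (-(1 / 2) * kineticFun g ε k y) ^ (m k).natAbs) * m h)) (fun t => ?_) ?_
  · have h1 : imSymbol g ε m (y + t • shear g ε h y) = imSymbol g ε m y +
        ∑ h', if h' = h then (m h' : ℂ) * (t * kineticFun g ε h' y) *
          ((-(1 / 2) * kineticFun g ε h' y) ^ ((m h').natAbs - 1) *
            ∏ k ∈ Finset.univ.erase h', (-(1 / 2) * kineticFun g ε k y) ^ (m k).natAbs) else 0 := by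
      simp only [imSymbol, kineticFun_shear, dilationFun_shear]
      rw [← Finset.sum_add_distrib]
      refine Finset.sum_congr rfl fun h' _ => ?_
      split_ifs <;> ring
    rw [h1, Finset.sum_ite_eq' Finset.univ h, if_pos (Finset.mem_univ h),
      ← Finset.mul_prod_erase Finset.univ _ (Finset.mem_univ h)]
    -- The exponent |m_h| - 1 is truncated when m_h = 0, but then the prefactor m_h kills the term.
    by_cases hm : m h = 0
    · simp [hm]
    · have h2 : (m h).natAbs = (m h).natAbs - 1 + 1 := by omega
      nth_rw 2 [h2]
      rw [pow_succ]
      ring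
  · have h1 : HasDerivAt (fun t : ℝ => (t : ℂ)) 1 0 := Complex.ofRealCLM.hasDerivAt
    simpa using (h1.mul_const
      (-2 * (∏ k, (-(1 / 2) * kineticFun g ε k y) ^ (m k).natAbs) * m h)).const_add
      (imSymbol g ε m y)

theorem kineticFun_squeeze (g : Fin n → Fin u) (ε : Fin n → ℤˣ) (h h' : Fin u) (y : Phase n)
    (t : ℝ) : kineticFun g ε h (y + t • squeeze g h' y) = kineticFun g ε h y +
      ((1 - t) ^ 2 - 1) * if h = h' then kineticFun g ε h y else 0 := by
  by_cases hh : h = h'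
  · subst hh
    rw [if_pos rfl]
    simp only [kineticFun, Finset.mul_sum]
    rw [← Finset.sum_add_distrib]
    refine Finset.sum_congr rfl fun i hi => ?_
    simp only [squeeze, groupPart, Prod.snd_add, Prod.smul_snd, Pi.add_apply, Pi.smul_apply,
      (Finset.mem_filter.1 hi).2, if_true, smul_eq_mul, Pi.neg_apply, Complex.ofReal_add,
      Complex.ofReal_mul, Complex.ofReal_neg]
    ring
  · rw [if_neg hh, mul_zero, add_zero]
    refine Finset.sum_congr rfl fun i hi => ?_
    simp [squeeze, groupPart, (Finset.mem_filter.1 hi).2, hh]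

theorem fderiv_jSymbol_squeeze (g : Fin n → Fin u) (ε : Fin n → ℤˣ) (r : Fin u → ℤ) (h : Fin u)
    (y : Phase n) : fderiv ℝ (jSymbol g ε r) y (squeeze g h y) = -kineticFun g ε h y * r h := by
  refine fderiv_apply_eq_of_hasDerivAt (differentiable_jSymbol g ε r)
    (φ := fun t : ℝ => jSymbol g ε r y +
      ((1 - (t : ℂ)) ^ 2 - 1) * ((1 / 2) * kineticFun g ε h y * r h)) (fun t => ?_) ?_
  · have h1 : jSymbol g ε r (y + t • squeeze g h y) = jSymbol g ε r y +
        ∑ h', if h' = h then (r h' : ℂ) * (1 / 2 * (((1 - (t : ℂ)) ^ 2 - 1) *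
          kineticFun g ε h' y)) else 0 := by
      simp only [jSymbol, kineticFun_squeeze]
      rw [← Finset.sum_add_distrib]
      refine Finset.sum_congr rfl fun h' _ => ?_
      split_ifs <;> ring
    rw [h1, Finset.sum_ite_eq' Finset.univ h, if_pos (Finset.mem_univ h)]
    ring
  · have h1 : HasDerivAt (fun t : ℝ => (t : ℂ)) 1 0 := Complex.ofRealCLM.hasDerivAt
    refine (((((h1.const_sub 1).fun_pow 2).sub_const 1).mul_const
      ((1 / 2) * kineticFun g ε h y * r h)).const_add (jSymbol g ε r y)).congr_deriv ?_
    simp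
    ring

/-! ### Independence of the main parts -/

theorem linearIndependent_intCast {ι : Type*} {v : ι → Fin u → ℤ} (hv : LinearIndependent ℤ v) :
    LinearIndependent ℂ fun i h => (v i h : ℂ) := by
  have h := (linearIndependent_algebraMap_comp_iff (R := ℤ) (S := ℂ)).2 hv
  have h2 : (fun i h => (v i h : ℂ)) = fun i => algebraMap ℤ ℂ ∘ v i := by
    funext i h; simp
  rw [h2]; exact h

theorem exists_isOpen_dense_kineticFun_ne_zero {g : Fin n → Fin u} (hg : Function.Surjective g)
    (ε : Fin n → ℤˣ) : ∃ U : Set (Phase n), IsOpen U ∧ Dense U ∧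
      ∀ y ∈ U, ∀ h, kineticFun g ε h y ≠ 0 := by
  have h1 : ∀ h, IsOpen {y | kineticFun g ε h y ≠ 0} ∧ Dense {y | kineticFun g ε h y ≠ 0} := by
    intro h
    obtain ⟨i, hi⟩ := hg h
    refine isOpen_dense_ne_zero (contDiff_kineticFun ω g ε h) (y := (0, Pi.single i 1)) ?_
    rw [kineticFun, Finset.sum_eq_single i]
    · simpa using sgn_ne_zero ε i
    · intro j _ hj; simp [hj]
    · simp [hi]
  obtain ⟨ho, hd⟩ := isOpen_dense_iInter (fun h => (h1 h).1) fun h => (h1 h).2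
  exact ⟨_, ho, hd, fun y hy h => Set.mem_iInter.1 hy h⟩

/-- The main parts of the operators `(Ĵ_1, Ẑ; Ĵ_2, R̂, L̂)`. -/
def mainParts (g : Fin n → Fin u) (ε : Fin n → ℤˣ) (k' : ℕ) (r : Fin u → Fin u → ℤ)
    (m : Fin (u - k') → Fin u → ℤ) (z : Fin u → ℕ)
    (Z : ∀ h, Fin (z h) → MomentumForm (GroupPair g h))
    (L : ∀ h, Fin (2 * (groupSize g h - z h - 1)) → MomentumForm (GroupPair g h)) :
    ({i : Fin u // (i : ℕ) < k'} ⊕ (Σ h, Fin (z h))) ⊕ ({i : Fin u // k' ≤ (i : ℕ)} ⊕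
      Fin (u - k') ⊕ (Σ h, Fin (2 * (groupSize g h - z h - 1)))) → Phase n → ℂ :=
  Sum.elim (Sum.elim (fun i => jSymbol g ε (r i)) fun a => (Z a.1 a.2).toFun ε)
    (Sum.elim (fun i => jSymbol g ε (r i)) (Sum.elim (fun j => imSymbol g ε (m j))
      fun a => (L a.1 a.2).toFun ε))

/-- On the open dense set where all T_h are nonzero and each (Z_h, L_h) is independent, a vanishing
combination of differentials is tested on shears, then squeezes, then vectors supported in one
group. Each test isolates one kind of coefficient. -/
theorem functionallyIndependent_mainParts {g : Fin n → Fin u} (hg : Function.Surjective g)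
    (ε : Fin n → ℤˣ) (k' : ℕ) {r : Fin u → Fin u → ℤ} (hr : LinearIndependent ℤ r)
    {m : Fin (u - k') → Fin u → ℤ} (hm : LinearIndependent ℤ m) {z : Fin u → ℕ}
    {Z : ∀ h, Fin (z h) → MomentumForm (GroupPair g h)}
    {L : ∀ h, Fin (2 * (groupSize g h - z h - 1)) → MomentumForm (GroupPair g h)}
    (hZL : ∀ h, FunctionallyIndependent fun i => (Sum.elim (Z h) (L h) i).toFun ε) :
    FunctionallyIndependent (mainParts g ε k' r m z Z L) := by
  obtain ⟨U, hUo, hUd, hU⟩ := exists_isOpen_dense_kineticFun_ne_zero hg ε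
  choose V hVo hVd hV using hZL
  obtain ⟨hIo, hId⟩ := isOpen_dense_iInter hVo hVd
  refine ⟨U ∩ ⋂ h, V h, hUo.inter hIo, hUd.inter_of_isOpen_left hId hUo, ?_⟩
  rintro y ⟨hyU, hyV⟩
  have hT := hU y hyU
  rw [Fintype.linearIndependent_iff]
  intro c hc
  have H : ∀ v, (∑ i, c (Sum.inl (Sum.inl i)) * fderiv ℝ (jSymbol g ε (r i)) y v +
      ∑ a : Σ h, Fin (z h), c (Sum.inl (Sum.inr a)) * fderiv ℝ ((Z a.1 a.2).toFun ε) y v) +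
      (∑ i, c (Sum.inr (Sum.inl i)) * fderiv ℝ (jSymbol g ε (r i)) y v +
      (∑ j, c (Sum.inr (Sum.inr (Sum.inl j))) * fderiv ℝ (imSymbol g ε (m j)) y v +
      ∑ a : Σ h, Fin (2 * (groupSize g h - z h - 1)), c (Sum.inr (Sum.inr (Sum.inr a))) *
        fderiv ℝ ((L a.1 a.2).toFun ε) y v)) = 0 := by
    intro v
    have h1 := congrArg (fun T : Phase n →L[ℝ] ℂ => T v) hc
    simp only [Fintype.sum_sum_type, mainParts, Sum.elim_inl, Sum.elim_inr] at h1
    simpa [sum_apply] using h1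
  -- The shears of all groups together give a linear relation among the vectors m^{(j)}, with each
  -- coefficient multiplied by a nonzero product of powers of the T_k.
  have hm' : ∀ j, c (Sum.inr (Sum.inr (Sum.inl j))) = 0 := by
    intro j
    have h1 := Fintype.linearIndependent_iff.1 (linearIndependent_intCast hm)
      (fun j => c (Sum.inr (Sum.inr (Sum.inl j))) *
        (-2 * ∏ k, (-(1 / 2) * kineticFun g ε k y) ^ (m j k).natAbs)) (by
      funext h
      have h2 := H (shear g ε h y)
      simp only [fderiv_jSymbol_shear, MomentumForm.fderiv_shear, fderiv_imSymbol_shear, mul_zero,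
        Finset.sum_const_zero, zero_add, add_zero] at h2
      rw [Finset.sum_apply, Pi.zero_apply, ← h2]
      refine Finset.sum_congr rfl fun j _ => ?_
      rw [Pi.smul_apply, smul_eq_mul]; ring) j
    refine (mul_eq_zero.1 h1).resolve_right (mul_ne_zero (by norm_num) ?_)
    exact Finset.prod_ne_zero_iff.2 fun k _ => pow_ne_zero _ (mul_ne_zero (by norm_num) (hT k))
  -- The two families of Ĵ_r are treated as one, because the squeezes see all of them and the
  -- r^{(i)} are jointly independent.
  have hr' : ∀ i : {i : Fin u // (i : ℕ) < k'} ⊕ {i : Fin u // k' ≤ (i : ℕ)},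
      Sum.elim (fun i => c (Sum.inl (Sum.inl i))) (fun i => c (Sum.inr (Sum.inl i))) i = 0 := by
    have hinj : Function.Injective (Sum.elim Subtype.val Subtype.val :
        {i : Fin u // (i : ℕ) < k'} ⊕ {i : Fin u // k' ≤ (i : ℕ)} → Fin u) := by
      refine Function.Injective.sumElim Subtype.val_injective Subtype.val_injective fun a b hab => ?_
      have := a.2; have := b.2; rw [← hab] at this; omega
    refine Fintype.linearIndependent_iff.1 ((linearIndependent_intCast hr).comp _ hinj) _ ?_
    funext h
    have h2 := H (squeeze g h y)
    simp only [fderiv_jSymbol_squeeze, MomentumForm.fderiv_squeeze, hm', mul_zero, zero_mul,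
      Finset.sum_const_zero, add_zero] at h2
    rw [Finset.sum_apply, Pi.zero_apply, Fintype.sum_sum_type]
    refine mul_left_cancel₀ (neg_ne_zero.2 (hT h)) ?_
    rw [mul_zero, ← h2, mul_add, Finset.mul_sum, Finset.mul_sum]
    congr 1 <;> refine Finset.sum_congr rfl fun i _ => ?_
    · simp only [Sum.elim_inl, Function.comp_apply, Pi.smul_apply, smul_eq_mul]; ring
    · simp only [Sum.elim_inr, Function.comp_apply, Pi.smul_apply, smul_eq_mul]; ring
  have hr1 : ∀ i, c (Sum.inl (Sum.inl i)) = 0 := fun i => hr' (Sum.inl i)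
  have hr2 : ∀ i, c (Sum.inr (Sum.inl i)) = 0 := fun i => hr' (Sum.inr i)
  have hf : ∀ h, ∀ i : Fin (z h) ⊕ Fin (2 * (groupSize g h - z h - 1)),
      Sum.elim (fun i => c (Sum.inl (Sum.inr ⟨h, i⟩)))
        (fun i => c (Sum.inr (Sum.inr (Sum.inr ⟨h, i⟩)))) i = 0 := by
    intro h
    refine Fintype.linearIndependent_iff.1 (hV h y (Set.mem_iInter.1 hyV h)) _ ?_
    refine ContinuousLinearMap.ext fun v => ?_
    have h2 := H (groupPart g h v)
    simp only [hr1, hr2, hm', zero_mul, Finset.sum_const_zero, zero_add] at h2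
    rw [Fintype.sum_sigma, Fintype.sum_sigma, Finset.sum_eq_single h, Finset.sum_eq_single h] at h2
    · simp only [MomentumForm.fderiv_groupPart] at h2
      rw [Fintype.sum_sum_type]
      simpa [sum_apply] using h2
    · intro k _ hk
      refine Finset.sum_eq_zero fun i _ => ?_
      rw [MomentumForm.fderiv_groupPart_of_ne hk, mul_zero]
    · simp
    · intro k _ hk
      refine Finset.sum_eq_zero fun i _ => ?_
      rw [MomentumForm.fderiv_groupPart_of_ne hk, mul_zero]
    · simp
  rintro ((i | ⟨h, a⟩) | (i | j | ⟨h, a⟩))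
  · exact hr1 i
  · exact hf h (Sum.inl a)
  · exact hr2 i
  · exact hm' j
  · exact hf h (Sum.inr a)

end

/-! ### Partial Casimirs and derivatives along test vectors -/

section

variable {n u : ℕ} {g : Fin n → Fin u} {h : Fin u}

/-! ### Partial Casimir functions -/

/-- The partial Casimir form `∑ ε_i ε_j P_ij²`, the sum being over the pairs `i < j ≤ top`. -/
def casimirForm (ε : Fin n → ℤˣ) (top : Fin n) : MomentumForm (GroupPair g h) :=
  .squares fun e => if e.1.2 ≤ top then (((ε e.1.1 : ℤ) * (ε e.1.2 : ℤ) : ℤ) : ℝ) else 0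

/-- The form `P_ij`. -/
def pairForm (e : GroupPair g h) : MomentumForm (GroupPair g h) := .linear (Pi.single e 1)

theorem pairForm_eval {A : Type*} [Ring A] [Algebra ℂ A] (P : Fin n → Fin n → A)
    (e : GroupPair g h) : (pairForm e).eval P = P e.1.1 e.1.2 := by
  rw [pairForm, MomentumForm.eval, Finset.sum_eq_single e]
  · simp
  · intro b _ hb; simp [hb]
  · simp

theorem pairForm_toFun (ε : Fin n → ℤˣ) (e : GroupPair g h) :
    (pairForm e).toFun ε = momentum ε e.1.1 e.1.2 := by
  rw [MomentumForm.toFun_eq, pairForm_eval]; rfl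

/-- The form is the quadratic Casimir of the rotations on the indices up to `top`. In `squares_br`
the coefficient C_lj e_l equals ε_j for every j ≠ l in the segment, independently of l, so the
differences vanish. At j = k or j = l the factor `anti` is zero. -/
theorem casimir_br_momentum (ε : Fin n → ℤˣ) {A : Type*} [Ring A] [Algebra ℂ A]
    {B : Biderivation A} {κ : ℂ} {P : Fin n → Fin n → A} (hP : IsAngular B (sgn ε) κ P)
    {top k l : Fin n} (hk : g k = h) (hl : g l = h) (hkt : k ≤ top) (hlt : l ≤ top) :
    B.br ((casimirForm (g := g) (h := h) ε top).eval P) (P k l) = 0 := by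
  have hcoeff : ∀ a j : Fin n, g a = h → a ≤ top → symmCoeff (g := g) (h := h) (fun e =>
      if e.1.2 ≤ top then (((ε e.1.1 : ℤ) * (ε e.1.2 : ℤ) : ℤ) : ℝ) else 0) a j * sgn ε a =
      if g j = h ∧ j ≤ top ∧ a ≠ j then sgn ε j else 0 := by
    intro a j ha hat
    have hs := sgn_mul_self ε a
    simp only [symmCoeff, upperCoeff, ha]
    by_cases hj : g j = h
    · rcases lt_trichotomy a j with haj | haj | haj
      · by_cases hjt : j ≤ top
        · simp only [hj, haj, haj.not_gt, haj.ne, hjt, and_self, dite_true, if_true, false_and,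
            dite_false, ne_eq, not_false_eq_true]
          push_cast
          change (sgn ε a * sgn ε j + 0) * sgn ε a = sgn ε j
          linear_combination sgn ε j * hs
        · simp [hj, haj, haj.not_gt, hjt]
      · subst haj; simp
      · have hjt : j ≤ top := haj.le.trans hat
        simp only [hj, haj, haj.not_gt, haj.ne', hjt, hat, and_self, dite_true, if_true, false_and,
          dite_false, ne_eq, not_false_eq_true]
        push_cast
        change (0 + sgn ε j * sgn ε a) * sgn ε a = sgn ε j
        linear_combination sgn ε j * hs
    · simp [hj]
  have h2 : (2 : ℂ) • B.br ((casimirForm (g := g) (h := h) ε top).eval P) (P k l) = 0 := by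
    rw [← LinearMap.smul_apply, ← map_smul, casimirForm, two_smul_squares hP,
      hP.squares_br (symmCoeff_symm _)]
    rw [Finset.sum_eq_zero, smul_zero]
    intro j _
    rw [hcoeff l j hl hlt, hcoeff k j hk hkt]
    by_cases hlj : l = j
    · rw [anti_eq_zero_of_not_distinct hP (Or.inr hlj), smul_zero]
    by_cases hkj : k = j
    · rw [anti_eq_zero_of_not_distinct hP (Or.inl hkj), smul_zero]
    simp only [ne_eq, hlj, hkj, sub_self, zero_smul]
  exact (smul_eq_zero.1 h2).resolve_left two_ne_zero

theorem poisson_eq_zero_of_br (ε : Fin n → ℤˣ) {F G : MomentumForm (GroupPair g h)}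
    (hFG : (poissonBracket n).br (F.eval (momentumElem ε)) (G.eval (momentumElem ε)) = 0) :
    poisson (F.toFun ε) (G.toFun ε) = 0 := by
  funext y
  rw [F.toFun_eq, G.toFun_eq, ← poissonBracket_br, hFG]
  rfl

theorem poisson_casimir_pair (ε : Fin n → ℤˣ) {top : Fin n} {e : GroupPair g h}
    (he : e.1.2 ≤ top) : poisson ((casimirForm (g := g) (h := h) ε top).toFun ε)
      ((pairForm e).toFun ε) = 0 := by
  refine poisson_eq_zero_of_br ε ?_
  rw [pairForm_eval]
  exact casimir_br_momentum ε (isAngular_momentumElem ε) e.2.2.1 e.2.2.2 (e.2.1.le.trans he) he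

/-- The smaller of two nested Casimirs is a polynomial in momenta that the larger one annihilates.
-/
theorem poisson_casimir_casimir (ε : Fin n → ℤˣ) (top top' : Fin n) :
    poisson ((casimirForm (g := g) (h := h) ε top).toFun ε)
      ((casimirForm (g := g) (h := h) ε top').toFun ε) = 0 := by
  have key : ∀ top top' : Fin n, top' ≤ top → (poissonBracket n).br
      ((casimirForm (g := g) (h := h) ε top).eval (momentumElem ε))
      ((casimirForm (g := g) (h := h) ε top').eval (momentumElem ε)) = 0 := by
    intro top top' htop
    generalize hC : (casimirForm (g := g) (h := h) ε top).eval (momentumElem ε) = C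
    rw [casimirForm, MomentumForm.eval, map_sum]
    refine Finset.sum_eq_zero fun e _ => ?_
    rw [map_smul]
    by_cases he : e.1.2 ≤ top'
    · have h1 : (poissonBracket n).br C (momentumElem ε e.1.1 e.1.2) = 0 := by
        rw [← hC]
        exact casimir_br_momentum ε (isAngular_momentumElem ε) e.2.2.1 e.2.2.2
          (e.2.1.le.trans (he.trans htop)) (he.trans htop)
      rw [pow_two, Biderivation.leibniz, h1, zero_mul, mul_zero, add_zero, smul_zero]
    · rw [if_neg he, Complex.ofReal_zero, zero_smul]
  refine poisson_eq_zero_of_br ε ?_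
  rcases le_total top' top with ht | ht
  · exact key _ _ ht
  · rw [Biderivation.skew, key _ _ ht, neg_zero]

/-! ### Derivatives of forms along weighted dilations -/

/-- The vector at `y` that dilates the coordinates of the `i`-th oscillator at the rate `wt i`. -/
def dilation (wt : Fin n → ℝ) (y : Phase n) : Phase n :=
  (fun i => wt i * y.1 i, fun i => wt i * y.2 i)

theorem momentum_dilation (ε : Fin n → ℤˣ) (wt : Fin n → ℝ) (y : Phase n) (t : ℝ) (i j : Fin n) :
    momentum ε i j (y + t • dilation wt y) =
      (1 + t * wt i) * (1 + t * wt j) * momentum ε i j y := by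
  simp only [momentum_eq, dilation, Prod.fst_add, Prod.snd_add, Prod.smul_fst, Prod.smul_snd,
    Pi.add_apply, Pi.smul_apply, smul_eq_mul, Complex.ofReal_add, Complex.ofReal_mul]
  ring

theorem hasDerivAt_scale (a b c : ℂ) :
    HasDerivAt (fun t : ℝ => (1 + t * a) * (1 + t * b) * c) ((a + b) * c) 0 := by
  have h1 : HasDerivAt (fun t : ℝ => (t : ℂ)) 1 0 := Complex.ofRealCLM.hasDerivAt
  refine ((((h1.mul_const a).const_add 1).fun_mul ((h1.mul_const b).const_add 1)).mul_const
    c).congr_deriv ?_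
  simp

theorem fderiv_pairForm_dilation (ε : Fin n → ℤˣ) (e : GroupPair g h) (wt : Fin n → ℝ)
    (y : Phase n) : fderiv ℝ ((pairForm e).toFun ε) y (dilation wt y) =
      (wt e.1.1 + wt e.1.2) * momentum ε e.1.1 e.1.2 y := by
  refine fderiv_apply_eq_of_hasDerivAt (MomentumForm.differentiable ε _) (fun t => ?_)
    (hasDerivAt_scale _ _ _)
  rw [pairForm_toFun, momentum_dilation]

theorem fderiv_squares_dilation (ε : Fin n → ℤˣ) (c : GroupPair g h → ℝ) (wt : Fin n → ℝ)
    (y : Phase n) : fderiv ℝ ((MomentumForm.squares c).toFun ε) y (dilation wt y) =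
      ∑ e, (c e : ℂ) * (2 * (wt e.1.1 + wt e.1.2)) * momentum ε e.1.1 e.1.2 y ^ 2 := by
  refine fderiv_apply_eq_of_hasDerivAt (MomentumForm.differentiable ε _)
    (φ := fun t : ℝ => ∑ e : GroupPair g h, (c e : ℂ) *
      ((1 + t * wt e.1.1) * (1 + t * wt e.1.2) * momentum ε e.1.1 e.1.2 y) ^ 2) (fun t => ?_) ?_
  · simp only [MomentumForm.toFun, momentum_dilation]
  · refine HasDerivAt.fun_sum fun e _ => ?_
    refine (((hasDerivAt_scale (wt e.1.1) (wt e.1.2)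
      (momentum ε e.1.1 e.1.2 y)).fun_pow 2).const_mul (c e : ℂ)).congr_deriv ?_
    simp
    ring

/-- The vector at `y` that moves the `j`-th oscillator along the `k`-th one. -/
def transport (ε : Fin n → ℤˣ) (j k : Fin n) (y : Phase n) : Phase n :=
  (Pi.single j (y.1 k), Pi.single j (((ε j : ℤ) : ℝ) * ((ε k : ℤ) : ℝ) * y.2 k))

/-- P_ij is linear in the j-th oscillator; adding t times the k-th one, with signs adjusted, turns
P_ij into P_ij + t P_ik. -/
theorem fderiv_pairForm_transport (ε : Fin n → ℤˣ) (e : GroupPair g h) {j : Fin n} (k : Fin n)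
    (hj : e.1.1 ≠ j) (y : Phase n) : fderiv ℝ ((pairForm e).toFun ε) y (transport ε j k y) =
      if e.1.2 = j then momentum ε e.1.1 k y else 0 := by
  have h1 : HasDerivAt (fun t : ℝ => (t : ℂ)) 1 0 := Complex.ofRealCLM.hasDerivAt
  refine fderiv_apply_eq_of_hasDerivAt (MomentumForm.differentiable ε _) (fun t => ?_)
    (((h1.mul_const (if e.1.2 = j then momentum ε e.1.1 k y else 0)).const_add
      (momentum ε e.1.1 e.1.2 y)).congr_deriv (one_mul _))
  rw [pairForm_toFun]
  by_cases he : e.1.2 = j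
  · have hs := sgn_mul_self ε j
    rw [if_pos he, he]
    simp only [momentum_eq, transport, Prod.fst_add, Prod.snd_add, Prod.smul_fst, Prod.smul_snd,
      Pi.add_apply, Pi.smul_apply, smul_eq_mul, Complex.ofReal_add, Complex.ofReal_mul,
      Pi.single_eq_same, Pi.single_eq_of_ne hj, ofReal_sign, mul_zero,
      add_zero]
    linear_combination (t * (y.1 e.1.1 : ℂ) * sgn ε k * (y.2 k : ℂ)) * hs
  · rw [if_neg he, mul_zero, add_zero]
    simp only [momentum_eq, transport, Prod.fst_add, Prod.snd_add, Prod.smul_fst, Prod.smul_snd,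
      Pi.add_apply, Pi.smul_apply, smul_eq_mul,
      Pi.single_eq_of_ne he, Pi.single_eq_of_ne hj, mul_zero, add_zero]

theorem contDiff_momentumFun (k : WithTop ℕ∞) (ε : Fin n → ℤˣ) (i j : Fin n) :
    ContDiff ℝ k (momentum ε i j) := by
  rw [funext (momentum_eq ε i j)]
  exact ((contDiff_position k i).mul (contDiff_const.mul (contDiff_momentum k j))).sub
    ((contDiff_position k j).mul (contDiff_const.mul (contDiff_momentum k i)))

theorem momentum_planePoint_single (ε : Fin n → ℤˣ) {a b : Fin n} (hab : a < b) {i j : Fin n}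
    (hij : i < j) : momentum ε i j (planePoint ε (Pi.single a 1) (Pi.single b 1)) =
      if i = a ∧ j = b then 1 else 0 := by
  have h1 : momentum ε i j (planePoint ε (Pi.single a 1) (Pi.single b 1)) = _ :=
    evalAt_momentumElem ε (Pi.single a 1) (Pi.single b 1) i j
  rw [h1, minor]
  simp only [Pi.single_apply]
  by_cases hi : i = a
  · subst hi
    by_cases hj : j = b
    · subst hj; simp [hij.ne]
    · simp [hj, hij.ne']
  · by_cases hj : j = a
    · subst hj; simp [hi, (hij.trans hab).ne]
    · simp [hi, hj]

end

/-! ### Construction of an admissible choice in each group -/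

section

variable {n u : ℕ} {g : Fin n → Fin u} {h : Fin u}

/-! ### Existence of admissible choices -/

/-- The first `q_h` values of `v` are the elements of the group `h`, in increasing order. -/
structure IsEnumeration (g : Fin n → Fin u) (h : Fin u) (v : ℕ → Fin n) : Prop where
  lt : ∀ {a b : ℕ}, a < b → b < groupSize g h → v a < v b
  mem : ∀ {a : ℕ}, a < groupSize g h → g (v a) = h

theorem exists_isEnumeration (hq : 0 < groupSize g h) : ∃ v, IsEnumeration g h v := by
  set o := (Finset.univ.filter fun i => g i = h).orderEmbOfFin rfl with ho
  refine ⟨fun a => if ha : a < groupSize g h then o ⟨a, ha⟩ else o ⟨0, hq⟩, ⟨?_, ?_⟩⟩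
  · intro a b hab hb
    rw [dif_pos hb, dif_pos (hab.trans hb)]
    exact o.strictMono hab
  · intro a ha
    rw [dif_pos ha]
    exact (Finset.mem_filter.1 (Finset.orderEmbOfFin_mem _ rfl ⟨a, ha⟩)).2

/-- The pair formed by two elements of an enumerated group. -/
def IsEnumeration.pair {v : ℕ → Fin n} (hv : IsEnumeration g h v) {a b : ℕ} (hab : a < b)
    (hb : b < groupSize g h) : GroupPair g h :=
  ⟨(v a, v b), hv.lt hab hb, hv.mem (hab.trans hb), hv.mem hb⟩

theorem IsEnumeration.ne {v : ℕ → Fin n} (hv : IsEnumeration g h v) {a b : ℕ}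
    (ha : a < groupSize g h) (hb : b < groupSize g h) (hab : a ≠ b) : v a ≠ v b := by
  rcases lt_or_gt_of_ne hab with hlt | hlt
  · exact (hv.lt hlt hb).ne
  · exact (hv.lt hlt ha).ne'

theorem IsEnumeration.le {v : ℕ → Fin n} (hv : IsEnumeration g h v) {a b : ℕ}
    (hab : a ≤ b) (hb : b < groupSize g h) : v a ≤ v b := by
  rcases hab.eq_or_lt with rfl | hlt
  · exact le_rfl
  · exact (hv.lt hlt hb).le

/-- Weights for which the dilation is transversal to the level `k` of the partial Casimir
functions, but tangent to the lower levels down to the level `s`. -/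
def levelWeight (v : ℕ → Fin n) (s k : ℕ) : Fin n → ℝ :=
  if k = s then fun i => if i = v 0 ∨ i = v 1 then 1 else -1 else Pi.single (v k) 1

theorem fderiv_casimirForm_dilation (ε : Fin n → ℤˣ) (top : Fin n) (wt : Fin n → ℝ)
    (y : Phase n) : fderiv ℝ ((casimirForm (g := g) (h := h) ε top).toFun ε) y (dilation wt y) =
      ∑ e : GroupPair g h, (if e.1.2 ≤ top then sgn ε e.1.1 * sgn ε e.1.2 else 0) *
        (2 * (wt e.1.1 + wt e.1.2)) * momentum ε e.1.1 e.1.2 y ^ 2 := by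
  rw [casimirForm, fderiv_squares_dilation]
  refine Finset.sum_congr rfl fun e _ => ?_
  split_ifs
  · push_cast; rfl
  · simp

theorem isOpen_dense_fderiv_casimirForm_dilation_ne_zero (ε : Fin n → ℤˣ) {top : Fin n}
    {wt : Fin n → ℝ} (e : GroupPair g h) (he : e.1.2 ≤ top) (hwt : wt e.1.1 + wt e.1.2 ≠ 0) :
    IsOpen {y | fderiv ℝ ((casimirForm (g := g) (h := h) ε top).toFun ε) y (dilation wt y) ≠ 0} ∧
    Dense {y | fderiv ℝ ((casimirForm (g := g) (h := h) ε top).toFun ε) y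
      (dilation wt y) ≠ 0} := by
  simp only [fderiv_casimirForm_dilation]
  refine isOpen_dense_ne_zero
    (ContDiff.sum fun i _ => contDiff_const.mul ((contDiff_momentumFun _ ε _ _).pow 2))
    (y := planePoint ε (Pi.single e.1.1 1) (Pi.single e.1.2 1)) ?_
  rw [Finset.sum_eq_single e]
  · rw [if_pos he, momentum_planePoint_single ε e.2.1 e.2.1, if_pos ⟨rfl, rfl⟩, one_pow, mul_one]
    refine mul_ne_zero (mul_ne_zero (sgn_ne_zero ε _) (sgn_ne_zero ε _))
      (mul_ne_zero two_ne_zero ?_)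
    exact_mod_cast hwt
  · intro b _ hb
    rw [momentum_planePoint_single ε e.2.1 b.2.1, if_neg (c := _ ∧ _), zero_pow two_ne_zero, mul_zero]
    rintro ⟨h1, h2⟩
    exact hb (Subtype.ext (Prod.ext h1 h2))
  · intro hn; exact absurd (Finset.mem_univ _) hn

theorem momentum_self (ε : Fin n → ℤˣ) (i : Fin n) (y : Phase n) : momentum ε i i y = 0 := by
  simp only [momentum, sub_self, mul_zero]

theorem momentum_swap (ε : Fin n → ℤˣ) (i j : Fin n) (y : Phase n) :
    momentum ε i j y = -momentum ε j i y := by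
  simp only [momentum]; ring

section Choice

variable {v : ℕ → Fin n} {z : ℕ}

/-- The partial Casimir forms of the `z` highest levels. -/
def casimirChoice (g : Fin n → Fin u) (h : Fin u) (ε : Fin n → ℤˣ) (v : ℕ → Fin n) (z : ℕ)
    (a : Fin z) : MomentumForm (GroupPair g h) :=
  casimirForm ε (v (groupSize g h - 1 - a))

/-- The index pairs of the momenta `P_{c, t+2}` with `c = 0, 1` and `t < q - z - 1`. -/
def choicePair (hv : IsEnumeration g h v) (hz : 1 ≤ z) (l : Fin (2 * (groupSize g h - z - 1))) : GroupPair g h :=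
  hv.pair (a := l % 2) (b := l / 2 + 2) (by omega) (by omega)

/-- The momenta `P_{c, t+2}` with `c = 0, 1` and `t < q - z - 1`. -/
def pairChoice (hv : IsEnumeration g h v) (hz : 1 ≤ z)
    (l : Fin (2 * (groupSize g h - z - 1))) : MomentumForm (GroupPair g h) :=
  pairForm (choicePair hv hz l)

/-- The Casimirs occupy the levels q - z, ..., q - 1 of the enumeration, and the chosen pairs use
indices at most q - z. Every pair thus lies inside the segment of every Casimir. -/
theorem poisson_choice (hv : IsEnumeration g h v) (ε : Fin n → ℤˣ)
    (hz : 1 ≤ z) (hzq : z ≤ groupSize g h - 1) (a : Fin z)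
    (i : Fin z ⊕ Fin (2 * (groupSize g h - z - 1))) :
    poisson ((casimirChoice g h ε v z a).toFun ε)
      ((Sum.elim (casimirChoice g h ε v z) (pairChoice hv hz) i).toFun ε) = 0 := by
  rcases i with a' | l
  · exact poisson_casimir_casimir ε _ _
  · refine poisson_casimir_pair ε (hv.le ?_ ?_) <;> omega

/-- At the lowest level q - z the weight is 1 on v 0, v 1 and -1 elsewhere, so each chosen pair has
total weight 0. Above it the only weighted oscillator is v k, which occurs in no chosen pair. The
lowest level needs its own weight because v (q - z) may occur in a chosen pair. -/
theorem fderiv_pairChoice_dilation (hv : IsEnumeration g h v) (ε : Fin n → ℤˣ)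
    (hz : 1 ≤ z) (hzq : z ≤ groupSize g h - 1)
    {k : ℕ} (hk : groupSize g h - z ≤ k) (hkq : k < groupSize g h)
    (l : Fin (2 * (groupSize g h - z - 1))) (y : Phase n) :
    fderiv ℝ ((pairChoice hv hz l).toFun ε) y
      (dilation (levelWeight v (groupSize g h - z) k) y) = 0 := by
  rw [pairChoice, fderiv_pairForm_dilation]
  refine mul_eq_zero_of_left ?_ _
  change ((levelWeight v (groupSize g h - z) k (v (l % 2)) : ℝ) : ℂ) +
    (levelWeight v (groupSize g h - z) k (v (l / 2 + 2)) : ℝ) = 0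
  rw [← Complex.ofReal_add, Complex.ofReal_eq_zero, levelWeight]
  split_ifs with hks
  · have h1 : v (l % 2) = v 0 ∨ v (l % 2) = v 1 := by
      rcases Nat.mod_two_eq_zero_or_one (l : ℕ) with h2 | h2 <;> simp [h2]
    have h2 : ¬(v (l / 2 + 2) = v 0 ∨ v (l / 2 + 2) = v 1) := by
      rw [not_or]
      constructor <;> refine hv.ne ?_ ?_ ?_ <;> omega
    simp only [if_pos h1, if_neg h2]; norm_num
  · rw [Pi.single_eq_of_ne, Pi.single_eq_of_ne, add_zero] <;> refine hv.ne ?_ ?_ ?_ <;> omega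

theorem fderiv_casimirForm_dilation_of_lt (hv : IsEnumeration g h v) (ε : Fin n → ℤˣ)
    {s b k : ℕ} (hsb : s ≤ b)
    (hbk : b < k) (hkq : k < groupSize g h) (y : Phase n) :
    fderiv ℝ ((casimirForm (g := g) (h := h) ε (v b)).toFun ε) y
      (dilation (levelWeight v s k) y) = 0 := by
  rw [fderiv_casimirForm_dilation]
  refine Finset.sum_eq_zero fun e _ => ?_
  by_cases he : e.1.2 ≤ v b
  · have h2 : e.1.2 < v k := he.trans_lt (hv.lt hbk hkq)
    have hw : levelWeight v s k = Pi.single (v k) 1 := if_neg (by omega)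
    rw [hw, Pi.single_eq_of_ne h2.ne,
      Pi.single_eq_of_ne (e.2.1.trans h2).ne]
    simp
  · rw [if_neg he]; simp

/-- A single pair of nonzero weight suffices: (v 0, v 1), of weight 2, at the lowest level, and (v
0, v k), of weight 1, above it. -/
theorem isOpen_dense_level (hv : IsEnumeration g h v) (ε : Fin n → ℤˣ)
    {s k : ℕ} (hs : 1 ≤ s) (hsk : s ≤ k)
    (hkq : k < groupSize g h) :
    IsOpen {y | fderiv ℝ ((casimirForm (g := g) (h := h) ε (v k)).toFun ε) y
      (dilation (levelWeight v s k) y) ≠ 0} ∧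
    Dense {y | fderiv ℝ ((casimirForm (g := g) (h := h) ε (v k)).toFun ε) y
      (dilation (levelWeight v s k) y) ≠ 0} := by
  by_cases hks : k = s
  · refine isOpen_dense_fderiv_casimirForm_dilation_ne_zero ε
      (hv.pair (a := 0) (b := 1) one_pos (by omega)) (hv.le (hs.trans hsk) hkq) ?_
    simp [levelWeight, hks, IsEnumeration.pair]
  · refine isOpen_dense_fderiv_casimirForm_dilation_ne_zero ε
      (hv.pair (a := 0) (b := k) (by omega) hkq) le_rfl ?_
    have h1 : v 0 ≠ v k := hv.ne (by omega) hkq (by omega)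
    simp [levelWeight, hks, IsEnumeration.pair, h1]

/-- Transporting the oscillator t + 2 along the oscillator 1 - c turns P_{c,t+2} into ±P_01. It
kills the companion P_{1-c,t+2}, since P_{1-c,1-c} = 0, and touches no other chosen pair. -/
theorem fderiv_pairChoice_transport (hv : IsEnumeration g h v) (ε : Fin n → ℤˣ)
    (hz : 1 ≤ z)
    (l l' : Fin (2 * (groupSize g h - z - 1))) (y : Phase n) :
    fderiv ℝ ((pairChoice hv hz l').toFun ε) y
      (transport ε (v (l / 2 + 2)) (v (1 - l % 2)) y) =
      if l' = l then momentum ε (v (l % 2)) (v (1 - l % 2)) y else 0 := by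
  rw [pairChoice, fderiv_pairForm_transport]
  · change (if v (l' / 2 + 2) = v (l / 2 + 2) then momentum ε (v (l' % 2)) _ y else 0) = _
    by_cases hll : l' = l
    · rw [hll, if_pos rfl, if_pos rfl]
    rw [if_neg hll]
    split_ifs with ht
    · have h1 : (l' : ℕ) / 2 = l / 2 := by
        by_contra h2
        refine hv.ne ?_ ?_ ?_ ht <;> omega
      have h2 : (l' : ℕ) ≠ l := fun h3 => hll (Fin.ext h3)
      rw [show (l' : ℕ) % 2 = 1 - l % 2 by omega, momentum_self]
    · rfl
  · change v (l' % 2) ≠ _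
    refine hv.ne ?_ ?_ ?_ <;> omega

/-- The Casimirs are triangular with respect to the level dilations, which annihilate all the chosen
pairs. Once they are eliminated, the transports separate the pairs wherever P_01 is nonzero. -/
theorem functionallyIndependent_choice (hv : IsEnumeration g h v) (ε : Fin n → ℤˣ)
    (hz : 1 ≤ z)
    (hzq : z ≤ groupSize g h - 1) :
    FunctionallyIndependent fun i =>
      (Sum.elim (casimirChoice g h ε v z) (pairChoice hv hz) i).toFun ε := by
  obtain ⟨hIo, hId⟩ := isOpen_dense_iInter
    (fun a : Fin z => (isOpen_dense_level hv ε (s := groupSize g h - z)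
      (k := groupSize g h - 1 - a) (by omega) (by omega) (by omega)).1)
    (fun a : Fin z => (isOpen_dense_level hv ε (s := groupSize g h - z)
      (k := groupSize g h - 1 - a) (by omega) (by omega) (by omega)).2)
  have h01 : v 0 < v 1 := hv.lt one_pos (by omega)
  obtain ⟨hPo, hPd⟩ := isOpen_dense_ne_zero (contDiff_momentumFun ω ε (v 0) (v 1))
    (y := planePoint ε (Pi.single (v 0) 1) (Pi.single (v 1) 1))
    (by rw [momentum_planePoint_single ε h01 h01, if_pos ⟨rfl, rfl⟩]; exact one_ne_zero)
  refine ⟨_, hPo.inter hIo, hPd.inter_of_isOpen_left hId hPo, ?_⟩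
  rintro y ⟨hy, hyQ⟩
  rw [Set.mem_iInter] at hyQ
  rw [Fintype.linearIndependent_iff]
  intro c hc
  have H : ∀ w, ∑ a, c (Sum.inl a) * fderiv ℝ ((casimirChoice g h ε v z a).toFun ε) y w +
      ∑ l, c (Sum.inr l) * fderiv ℝ ((pairChoice hv hz l).toFun ε) y w = 0 := by
    intro w
    have h1 := congrArg (fun T : Phase n →L[ℝ] ℂ => T w) hc
    simp only [Fintype.sum_sum_type, Sum.elim_inl, Sum.elim_inr] at h1
    simpa [sum_apply] using h1
  have hZ : ∀ a, c (Sum.inl a) = 0 := by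
    intro a
    -- Small a means a high level. Higher Casimirs are already eliminated by induction, and lower
    -- ones are constant along the dilation of the current level.
    induction a using WellFoundedLT.induction with
    | ind a ih =>
      have h1 := H (dilation (levelWeight v (groupSize g h - z) (groupSize g h - 1 - a)) y)
      rw [Finset.sum_eq_zero (s := Finset.univ (α := Fin (2 * (groupSize g h - z - 1)))) fun l _ =>
          by rw [fderiv_pairChoice_dilation hv ε hz hzq (by omega) (by omega), mul_zero], add_zero,
        Finset.sum_eq_single a] at h1
      · exact (mul_eq_zero.1 h1).resolve_right (hyQ a)
      · intro b _ hba
        rcases lt_or_gt_of_ne hba with hlt | hlt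
        · rw [ih b hlt, zero_mul]
        · rw [casimirChoice, fderiv_casimirForm_dilation_of_lt hv ε (by omega) (by omega) (by omega),
            mul_zero]
      · intro hn; exact absurd (Finset.mem_univ _) hn
  have hL : ∀ l, c (Sum.inr l) = 0 := by
    intro l
    have h1 := H (transport ε (v (l / 2 + 2)) (v (1 - l % 2)) y)
    simp only [hZ, zero_mul, Finset.sum_const_zero, zero_add, fderiv_pairChoice_transport,
      mul_ite, mul_zero, Finset.sum_ite_eq', Finset.mem_univ, if_true] at h1
    refine (mul_eq_zero.1 h1).resolve_right ?_
    rcases Nat.mod_two_eq_zero_or_one (l : ℕ) with h2 | h2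
    · rw [h2]; exact hy
    · rw [h2, momentum_swap]; exact neg_ne_zero.2 hy
  rintro (a | l)
  · exact hZ a
  · exact hL l

end Choice

theorem exists_choice (g : Fin n → Fin u) (ε : Fin n → ℤˣ) (h : Fin u) {z : ℕ}
    (hz_le : z ≤ groupSize g h - 1) (hz_pos : 1 < groupSize g h → 1 ≤ z) :
    ∃ (Z : Fin z → MomentumForm (GroupPair g h))
      (L : Fin (2 * (groupSize g h - z - 1)) → MomentumForm (GroupPair g h)),
      (FunctionallyIndependent fun i => (Sum.elim Z L i).toFun ε) ∧
      ∀ a i, poisson ((Z a).toFun ε) ((Sum.elim Z L i).toFun ε) = 0 := by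
  by_cases hq : 1 < groupSize g h
  · obtain ⟨v, hv⟩ := exists_isEnumeration (zero_lt_one.trans hq)
    exact ⟨casimirChoice g h ε v z, pairChoice hv (hz_pos hq),
      functionallyIndependent_choice hv ε (hz_pos hq) hz_le,
      poisson_choice hv ε (hz_pos hq) hz_le⟩
  -- In a group with at most one oscillator both index sets are empty.
  · have : IsEmpty (Fin z) := ⟨fun i => by have := i.isLt; omega⟩
    have : IsEmpty (Fin (2 * (groupSize g h - z - 1))) := ⟨fun i => by have := i.isLt; omega⟩
    exact ⟨isEmptyElim, isEmptyElim, ⟨Set.univ, isOpen_univ, dense_univ,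
      fun _ _ => linearIndependent_empty_type⟩, isEmptyElim⟩

theorem exists_isAdmissible (g : Fin n → Fin u) (ε : Fin n → ℤˣ) {z : Fin u → ℕ}
    (hz_le : ∀ h, z h ≤ groupSize g h - 1) (hz_pos : ∀ h, 1 < groupSize g h → 1 ≤ z h) :
    ∃ Z L, IsAdmissible g ε z Z L := by
  choose Z L hi hp using fun h => exists_choice g ε h (hz_le h) (hz_pos h)
  exact ⟨Z, L, hi, hp⟩

end

/-! ### Counting the elements and assembling the result -/

section

variable {n u : ℕ}

/-! ### Quasi-integrability -/

theorem sum_groupSize (g : Fin n → Fin u) : ∑ h, groupSize g h = n := by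
  have h1 := Finset.card_eq_sum_card_fiberwise (s := (Finset.univ : Finset (Fin n)))
    (t := (Finset.univ : Finset (Fin u))) (f := g) (fun _ _ => by simp)
  rw [Finset.card_univ, Fintype.card_fin] at h1
  exact h1.symm

theorem groupSize_pos {g : Fin n → Fin u} (hg : Function.Surjective g) (h : Fin u) :
    0 < groupSize g h := by
  obtain ⟨i, hi⟩ := hg h
  exact Finset.card_pos.2 ⟨i, by simp [hi]⟩

theorem card_lt {k' : ℕ} (hk : k' ≤ u) : Fintype.card {i : Fin u // (i : ℕ) < k'} = k' := by
  rw [Fintype.card_subtype, Fin.card_filter_val_lt, min_eq_right hk]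

theorem card_le {k' : ℕ} (hk : k' ≤ u) : Fintype.card {i : Fin u // k' ≤ (i : ℕ)} = u - k' := by
  have h1 := Fintype.card_subtype_compl fun i : Fin u => (i : ℕ) < k'
  simp only [not_lt, Fintype.card_fin] at h1
  rw [h1, card_lt hk]

theorem commute_toOp_centralOps {g : Fin n → Fin u} {ε : Fin n → ℤˣ} {z : Fin u → ℕ}
    {Z : ∀ h, Fin (z h) → MomentumForm (GroupPair g h)}
    {L : ∀ h, Fin (2 * (groupSize g h - z h - 1)) → MomentumForm (GroupPair g h)}
    (hZL : IsAdmissible g ε z Z L) {h h' : Fin u} (a : Fin (z h))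
    (i : Fin (z h') ⊕ Fin (2 * (groupSize g h' - z h' - 1))) :
    Commute ((Z h a).toOp ε) ((Sum.elim (Z h') (L h') i).toOp ε) := by
  by_cases hh : h = h'
  · subst hh
    exact MomentumForm.commute_toOp ε _ _ (hZL.involutive h a i)
  · exact commute_toOp_toOp_of_ne ε hh _ _

/-- Groups are nonempty and z_h ≤ q_h - 1, so the natural-number subtraction in 2(q_h - z_h - 1) is
never truncated and the sizes add up to n. -/
theorem sum_card {g : Fin n → Fin u} (hg : Function.Surjective g) {z : Fin u → ℕ}
    (hz_le : ∀ h, z h ≤ groupSize g h - 1) :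
    2 * ∑ h, z h + ∑ h, 2 * (groupSize g h - z h - 1) + 2 * u = 2 * n := by
  have h1 : ∀ h, 2 * z h + 2 * (groupSize g h - z h - 1) + 2 = 2 * groupSize g h := by
    intro h
    have := hz_le h; have := groupSize_pos hg h
    omega
  have h2 := Finset.sum_congr rfl fun h (_ : h ∈ Finset.univ) => h1 h
  simp only [Finset.sum_add_distrib, ← Finset.mul_sum, sum_groupSize, Finset.sum_const,
    Finset.card_univ, Fintype.card_fin, smul_eq_mul] at h2 ⊢
  omega

/-- The total is (k' + z) + 2(u - k') + 2(n - z - u) = 2n - (k' + z), where z is the sum of the z_h.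
Resonance is needed only for commutation of the first k' operators Ĵ with the Im R̂_m. -/
theorem isQuasiIntegrable {g : Fin n → Fin u} (hg : Function.Surjective g) {ε : Fin n → ℤˣ}
    {k' : ℕ} (hk' : k' ≤ u) {r : Fin u → Fin u → ℤ} (hr : LinearIndependent ℤ r)
    {m : Fin (u - k') → Fin u → ℤ} (hm : LinearIndependent ℤ m)
    (hrm : ∀ i : Fin u, (i : ℕ) < k' → ∀ j, ∑ h, r i h * m j h = 0) {z : Fin u → ℕ}
    (hz_le : ∀ h, z h ≤ groupSize g h - 1)
    {Z : ∀ h, Fin (z h) → MomentumForm (GroupPair g h)}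
    {L : ∀ h, Fin (2 * (groupSize g h - z h - 1)) → MomentumForm (GroupPair g h)}
    (hZL : IsAdmissible g ε z Z L) :
    IsQuasiIntegrable (k' + ∑ h, z h) (centralOps g ε k' r z Z) (otherOps g ε k' r m z L) := by
  refine ⟨?_, ?_, ?_, ?_, ?_⟩
  · simp [card_lt hk']
  · have h1 := sum_card hg hz_le
    simp only [Fintype.card_sum, Fintype.card_sigma, Fintype.card_fin, card_lt hk',
      card_le hk']
    omega
  · rintro (i | ⟨h, a⟩) (j | ⟨h', b⟩)
    · exact commute_jOp_jOp g ε (r i) (r j)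
    · exact commute_jOp_toOp ε (r i) (Z h' b)
    · exact (commute_jOp_toOp ε (r j) (Z h a)).symm
    · exact commute_toOp_centralOps hZL a (Sum.inl b)
  · rintro (i | ⟨h, a⟩) (j | j | ⟨h', b⟩)
    · exact commute_jOp_jOp g ε (r i) (r j)
    · exact commute_jOp_imROp g ε (hrm i i.2 j)
    · exact commute_jOp_toOp ε (r i) (L h' b)
    · exact (commute_jOp_toOp ε (r j) (Z h a)).symm
    · exact commute_toOp_imROp ε (m j) (Z h a)
    · exact commute_toOp_centralOps hZL a (Sum.inr b)
  · refine quasiIndependent_of_hasSymbol (σ := mainParts g ε k' r m z Z L) ?_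
      (functionallyIndependent_mainParts hg ε k' hr hm hZL.independent)
    rintro ((i | a) | (i | j | a))
    · exact ⟨2, hasSymbol_jOp g ε (r i)⟩
    · exact MomentumForm.exists_hasSymbol ε (Z a.1 a.2)
    · exact ⟨2, hasSymbol_jOp g ε (r i)⟩
    · exact hasSymbol_imROp g ε (m j)
    · exact MomentumForm.exists_hasSymbol ε (L a.1 a.2)

end

end ResonantOscillators

end

theorem mainTheorem6 {n u : ℕ}
    (g : Fin n → Fin u) (hg : Function.Surjective g)
    (ε : Fin n → ℤˣ)
    (s : Fin u → ℕ) (hs : ∀ h, 0 < s h)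
    (k' : ℕ) (hk'_pos : 1 ≤ k') (hk'_le : k' ≤ u)
    (r : Fin u → Fin u → ℤ) (hr : LinearIndependent ℤ r)
    (hr_first : ∀ i : Fin u, (i : ℕ) = 0 → ∀ h, r i h = (s h : ℤ))
    (m : Fin (u - k') → Fin u → ℤ) (hm : LinearIndependent ℤ m)
    (hrm : ∀ i : Fin u, (i : ℕ) < k' → ∀ j, ∑ h, r i h * m j h = 0)
    (z : Fin u → ℕ)
    (hz_le : ∀ h, z h ≤ ResonantOscillators.groupSize g h - 1)
    (hz_pos : ∀ h, 1 < ResonantOscillators.groupSize g h → 1 ≤ z h) :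
    (∃ Z L, ResonantOscillators.IsAdmissible g ε z Z L) ∧
    ∀ Z L, ResonantOscillators.IsAdmissible g ε z Z L →
      ResonantOscillators.IsQuasiIntegrable (k' + ∑ h, z h)
        (ResonantOscillators.centralOps g ε k' r z Z)
        (ResonantOscillators.otherOps g ε k' r m z L) :=
  ⟨ResonantOscillators.exists_isAdmissible g ε hz_le hz_pos, fun _ _ hZL =>
    ResonantOscillators.isQuasiIntegrable hg hk'_le hr hm hrm hz_le hZL⟩
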